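/- Let $\mathbb{H}$ be the real quaternion algebra. For a quaternion matrix $A$ let $r(A)$ be its rank (the maximal number of left linearly independent rows, equivalently of right linearly independent columns), $A^*$ its conjugate transpose, $A^\dagger$ its Moore–Penrose inverse, i.e. the unique $Y$ with $AYA=A$, $YAY=Y$, $(AY)^*=AY$, $(YA)^*=YA$, and put $L_A=I-A^\dagger A$, $R_A=I-AA^\dagger$. Let $A_i\in\mathbb{H}^{a_i\times p_i}$, $B_i\in\mathbb{H}^{q_i\times b_i}$, $C_i\in\mathbb{H}^{a_i\times q_i}$, $D_i\in\mathbb{H}^{p_i\times b_i}$, $E_i\in\mathbb{H}^{s\times p_i}$, $F_i\in\mathbb{H}^{q_i\times t}$ $(i=1,2,3)$ and $C\in\mathbb{H}^{s\times t}$ be given, and consider the system in the unknowns $X\in\mathbb{H}^{p_1\times q_1}$, $Y\in\mathbb{H}^{p_2\times q_2}$, $Z\in\mathbb{H}^{p_3\times q_3}$ $$(\ast)\qquad \begin{aligned}&A_1X=C_1,\ XB_1=D_1,\quad A_2Y=C_2,\ YB_2=D_2,\quad A_3Z=C_3,\ ZB_3=D_3,\\ &E_1XF_1+E_2YF_2+E_3ZF_3=C.\end{aligned}$$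 Put $$\begin{aligned} &A_{ii}=E_iL_{A_i},\quad B_{ii}=R_{B_i}F_i\ (i=1,2,3),\quad M_1=R_{A_{11}}A_{22},\quad N_1=B_{22}L_{B_{11}},\quad S_1=A_{22}L_{M_1},\quad G=R_{M_1}R_{A_{11}},\\ &T_1=C-\sum_{i=1}^{3}E_i(A_i^\dagger C_i+L_{A_i}D_iB_i^\dagger)F_i,\\ &G_1=GA_{33},\quad G_2=R_{A_{11}}A_{33},\quad G_3=R_{A_{22}}A_{33},\quad G_4=A_{33},\quad H=L_{B_{11}}L_{N_1},\\ &H_1=B_{33},\quad H_2=B_{33}L_{B_{22}},\quad H_3=B_{33}L_{B_{11}},\quad H_4=B_{33}H,\\ &L_1=GT_1,\quad L_2=R_{A_{11}}T_1L_{B_{22}},\quad L_3=R_{A_{22}}T_1L_{B_{11}},\quad L_4=T_1H,\\ &C_{11}=(L_{G_2},\ L_{G_4}),\quad D_{11}=\begin{pmatrix}R_{H_1}\\R_{H_3}\end{pmatrix},\quad C_{22}=L_{G_1},\quad D_{22}=R_{H_2},\quad C_{33}=L_{G_3},\quad D_{33}=R_{H_4},\\ &E_{11}=R_{C_{11}}C_{22},\quad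 E_{22}=R_{C_{11}}C_{33},\quad E_{33}=D_{22}L_{D_{11}},\quad E_{44}=D_{33}L_{D_{11}},\quad M=R_{E_{11}}E_{22},\quad N=E_{44}L_{E_{33}},\\ &F_{10}=G_1^\dagger L_1H_1^\dagger+L_{G_1}G_2^\dagger L_2H_2^\dagger,\quad F_{20}=G_3^\dagger L_3H_3^\dagger+L_{G_3}G_4^\dagger L_4H_4^\dagger,\\ &F=F_{20}-F_{10},\quad E=R_{C_{11}}FL_{D_{11}},\quad S=E_{22}L_M. \end{aligned}$$ Then the following three statements are equivalent. (1) The system $(\ast)$ has a solution $(X,Y,Z)$. (2) $A_iD_i=C_iB_i$ for $i=1,2,3$, and $$R_{A_i}C_i=0,\quad D_iL_{B_i}=0\ (i=1,2,3),\quad R_{G_j}L_j=0,\quad L_jL_{H_j}=0\ (j=1,2,3,4),\quad R_{E_{22}}EL_{E_{33}}=0.$$ (3) $A_iD_i=C_iB_i$ for $i=1,2,3$, and $$r(C_i,\ A_i)=r(A_i),\qquad r\begin{pmatrix}D_i\\B_i\end{pmatrix}=r(B_i)\qquad(i=1,2,3),$$ $$r\begin{pmatrix}C&E_1&E_2&E_3\\C_1F_1&A_1&0&0\\C_2F_2&0&A_2&0\\C_3F_3&0&0&A_3\end{pmatrix}=r\begin{pmatrix}E_1&E_2&E_3\\A_1&0&0\\0&A_2&0\\0&0&A_3\end{pmatrix},$$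 $$r\begin{pmatrix}C&E_1&E_3&E_2D_2\\F_2&0&0&B_2\\C_1F_1&A_1&0&0\\C_3F_3&0&A_3&0\end{pmatrix}=r\begin{pmatrix}E_1&E_3\\A_1&0\\0&A_3\end{pmatrix}+r(F_2,\ B_2),$$ $$r\begin{pmatrix}C&E_3&E_2&E_1D_1\\F_1&0&0&B_1\\C_3F_3&A_3&0&0\\C_2F_2&0&A_2&0\end{pmatrix}=r\begin{pmatrix}E_3&E_2\\A_3&0\\0&A_2\end{pmatrix}+r(F_1,\ B_1),$$ $$r\begin{pmatrix}C&E_3&E_1D_1&E_2D_2\\F_1&0&B_1&0\\F_2&0&0&B_2\\C_3F_3&A_3&0&0\end{pmatrix}=r\begin{pmatrix}F_1&B_1&0\\F_2&0&B_2\end{pmatrix}+r\begin{pmatrix}E_3\\A_3\end{pmatrix},$$ $$r\begin{pmatrix}C&E_1&E_2&E_3D_3\\F_3&0&0&B_3\\C_1F_1&A_1&0&0\\C_2F_2&0&A_2&0\end{pmatrix}=r\begin{pmatrix}E_1&E_2\\A_1&0\\0&A_2\end{pmatrix}+r(F_3,\ B_3),$$ $$r\begin{pmatrix}C&E_1&E_3D_3&E_2D_2\\F_3&0&B_3&0\\F_2&0&0&B_2\\C_1F_1&A_1&0&0\end{pmatrix}=r\begin{pmatrix}F_3&B_3&0\\F_2&0&B_2\end{pmatrix}+r\begin{pmatrix}E_1\\A_1\end{pmatrix},$$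 $$r\begin{pmatrix}C&E_2&E_1D_1&E_3D_3\\F_1&0&B_1&0\\F_3&0&0&B_3\\C_2F_2&A_2&0&0\end{pmatrix}=r\begin{pmatrix}F_1&B_1&0\\F_3&0&B_3\end{pmatrix}+r\begin{pmatrix}E_2\\A_2\end{pmatrix},$$ $$r\begin{pmatrix}C&E_1D_1&E_2D_2&E_3D_3\\F_1&B_1&0&0\\F_2&0&B_2&0\\F_3&0&0&B_3\end{pmatrix}=r\begin{pmatrix}F_1&B_1&0&0\\F_2&0&B_2&0\\F_3&0&0&B_3\end{pmatrix},$$ $$r\begin{pmatrix}C&0&E_1&0&E_3&E_2D_2&0&E_3D_3\\0&-C&0&E_2&E_3&0&-E_1D_1&0\\F_2&0&0&0&0&B_2&0&0\\0&F_1&0&0&0&0&B_1&0\\F_3&F_3&0&0&0&0&0&B_3\\C_1F_1&0&A_1&0&0&0&0&0\\0&-C_2F_2&0&A_2&0&0&0&0\\0&-C_3F_3&0&0&A_3&0&0&0\end{pmatrix}=r\begin{pmatrix}F_2&0&B_2&0&0\\0&F_1&0&B_1&0\\F_3&F_3&0&0&B_3\end{pmatrix}+r\begin{pmatrix}E_1&0&E_3\\0&E_2&E_3\\A_1&0&0\\0&A_2&0\\0&0&A_3\end{pmatrix}.$$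 If these statements hold, the general solution of $(\ast)$ is $$X=A_1^\dagger C_1+L_{A_1}D_1B_1^\dagger+L_{A_1}U_1R_{B_1},\quad Y=A_2^\dagger C_2+L_{A_2}D_2B_2^\dagger+L_{A_2}U_2R_{B_2},\quad Z=A_3^\dagger C_3+L_{A_3}D_3B_3^\dagger+L_{A_3}U_3R_{B_3},$$ where, with $T=T_1-A_{33}U_3B_{33}$, $$\begin{aligned} U_1={}&A_{11}^\dagger TB_{11}^\dagger-A_{11}^\dagger A_{22}M_1^\dagger TB_{11}^\dagger-A_{11}^\dagger S_1A_{22}^\dagger TN_1^\dagger B_{22}B_{11}^\dagger-A_{11}^\dagger S_1U_4R_{N_1}B_{22}B_{11}^\dagger+L_{A_{11}}U_5+U_6R_{B_{11}},\\ U_2={}&M_1^\dagger TB_{22}^\dagger+S_1^\dagger S_1A_{22}^\dagger TN_1^\dagger+L_{M_1}L_{S_1}U_7+U_8R_{B_{22}}+L_{M_1}U_4R_{N_1},\\ U_3={}&F_{10}+L_{G_2}V_1+V_2R_{H_1}+L_{G_1}V_3R_{H_2}\quad\text{or}\quad U_3=F_{20}-L_{G_4}W_1-W_2R_{H_3}-L_{G_3}W_3R_{H_4},\\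 V_1={}&(I_m,\ 0)\,C_{11}^\dagger\Phi-(I_m,\ 0)\left[C_{11}^\dagger U_{11}D_{11}-L_{C_{11}}U_{12}\right],\\ W_1={}&(0,\ I_m)\,C_{11}^\dagger\Phi-(0,\ I_m)\left[C_{11}^\dagger U_{11}D_{11}-L_{C_{11}}U_{12}\right],\\ V_2={}&R_{C_{11}}\Phi D_{11}^\dagger\begin{pmatrix}I_n\\0\end{pmatrix}+\left[C_{11}C_{11}^\dagger U_{11}+U_{21}R_{D_{11}}\right]\begin{pmatrix}I_n\\0\end{pmatrix},\\ W_2={}&R_{C_{11}}\Phi D_{11}^\dagger\begin{pmatrix}0\\I_n\end{pmatrix}+\left[C_{11}C_{11}^\dagger U_{11}+U_{21}R_{D_{11}}\right]\begin{pmatrix}0\\I_n\end{pmatrix},\\ V_3={}&E_{11}^\dagger FE_{33}^\dagger-E_{11}^\dagger E_{22}M^\dagger FE_{33}^\dagger-E_{11}^\dagger SE_{22}^\dagger FN^\dagger E_{44}E_{33}^\dagger-E_{11}^\dagger SU_{31}R_NE_{44}E_{33}^\dagger+L_{E_{11}}U_{32}+U_{33}R_{E_{33}},\\ W_3={}&M^\dagger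 FE_{44}^\dagger+S^\dagger SE_{22}^\dagger FN^\dagger+L_ML_SU_{41}+L_MU_{31}R_N+U_{42}R_{E_{44}}, \end{aligned}$$ with $\Phi=F-C_{22}V_3D_{22}-C_{33}W_3D_{33}$, $m=p_3$, $n=q_3$, and $U_4,\dots,U_8,U_{11},U_{12},U_{21},U_{31},U_{32},U_{33},U_{41},U_{42}$ arbitrary quaternion matrices of conformable sizes. That is, with either of the two expressions for $U_3$, the triples $(X,Y,Z)$ obtained from all choices of the arbitrary matrices are exactly the solutions of $(\ast)$. -/

import Mathlib

open scoped Quaternion Matrix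

namespace QuatMat

/-! Notation for block matrices: `X │ Y` is the block row `(X, Y)`, and `X ⊟ Y` is the block
column with `X` above `Y`.  `│` binds more strongly, so that a partitioned matrix is written as
its block rows, separated by `⊟`. -/

infixr:64 " │ " => Matrix.fromCols
infixr:62 " ⊟ " => Matrix.fromRows

/-! ### The rank of a quaternion matrix -/

/-- The rank of a quaternion matrix: the dimension of the left `ℍ`-space spanned by its rows, that
is, the largest number of left linearly independent rows (equivalently, of right linearly
independent columns). -/
noncomputable def rk {m n : Type*} (A : Matrix m n ℍ[ℝ]) : ℕ :=
  Module.finrank ℍ[ℝ] (Submodule.span ℍ[ℝ] (Set.range A.row))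

/-! ### The Moore-Penrose inverse of a quaternion matrix -/

/-- The four Penrose equations. -/
def IsMoorePenrose {m n : Type*} [Fintype m] [Fintype n]
    (A : Matrix m n ℍ[ℝ]) (Y : Matrix n m ℍ[ℝ]) : Prop :=
  A * Y * A = A ∧ Y * A * Y = Y ∧ (A * Y)ᴴ = A * Y ∧ (Y * A)ᴴ = Y * A

theorem eq_zero_of_conjTranspose_mul_self {m n : Type*} [Fintype m]
    {A : Matrix m n ℍ[ℝ]} (h : Aᴴ * A = 0) : A = 0 := by
  ext1 i j
  have h1 : (Aᴴ * A) j j = 0 := by rw [h]; rfl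
  have h2 : ∑ k, Quaternion.normSq (A k j) = 0 := by
    have h3 : algebraMap ℝ ℍ[ℝ] (∑ k, Quaternion.normSq (A k j)) = 0 := by
      rw [← h1, Matrix.mul_apply, map_sum]
      refine Finset.sum_congr rfl fun k _ => ?_
      rw [Matrix.conjTranspose_apply, Quaternion.star_mul_self]
      rfl
    exact (map_eq_zero _).1 h3
  rw [Finset.sum_eq_zero_iff_of_nonneg fun k _ => Quaternion.normSq_nonneg] at h2
  exact Quaternion.normSq_eq_zero.1 (h2 i (Finset.mem_univ i))

theorem IsMoorePenrose.unique {m n : Type*} [Fintype m] [Fintype n]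
    {A : Matrix m n ℍ[ℝ]} {Y Z : Matrix n m ℍ[ℝ]}
    (hY : IsMoorePenrose A Y) (hZ : IsMoorePenrose A Z) : Y = Z := by
  obtain ⟨y1, y2, y3, y4⟩ := hY
  obtain ⟨z1, z2, z3, z4⟩ := hZ
  have h1 : A * Y = A * Z := by
    calc A * Y = (A * Y)ᴴ := y3.symm
      _ = (A * Z * (A * Y))ᴴ := by rw [← Matrix.mul_assoc, z1]
      _ = A * Y * (A * Z) := by rw [Matrix.conjTranspose_mul, y3, z3]
      _ = A * Z := by rw [← Matrix.mul_assoc, y1]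
  have h2 : Y * A = Z * A := by
    calc Y * A = (Y * A)ᴴ := y4.symm
      _ = (Y * A * (Z * A))ᴴ := by rw [Matrix.mul_assoc, ← Matrix.mul_assoc A, z1]
      _ = Z * A * (Y * A) := by rw [Matrix.conjTranspose_mul, y4, z4]
      _ = Z * A := by rw [Matrix.mul_assoc, ← Matrix.mul_assoc A, y1]
  calc Y = Y * A * Y := y2.symm
    _ = Z * A * Z := by rw [h2, Matrix.mul_assoc, h1, ← Matrix.mul_assoc]
    _ = Z := z2

theorem exists_isMoorePenrose {m n : Type*} [Fintype m] [Fintype n]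
    (A : Matrix m n ℍ[ℝ]) : ∃ Y, IsMoorePenrose A Y := by
  classical
  obtain ⟨T, hT⟩ : ∃ T, T = Aᴴ * A := ⟨_, rfl⟩
  have hTs : Tᴴ = T := by
    rw [hT, Matrix.conjTranspose_mul, Matrix.conjTranspose_conjTranspose]
  have hA : ∀ B : Matrix n n ℍ[ℝ], T * B = 0 → A * B = 0 := fun B hB => by
    refine eq_zero_of_conjTranspose_mul_self ?_
    rw [Matrix.conjTranspose_mul, Matrix.mul_assoc, ← Matrix.mul_assoc Aᴴ, ← hT, hB,
      Matrix.mul_zero]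
  have hTT : ∀ B : Matrix n n ℍ[ℝ], T * (T * B) = 0 → T * B = 0 := fun B hB => by
    refine eq_zero_of_conjTranspose_mul_self ?_
    rw [Matrix.conjTranspose_mul, hTs, Matrix.mul_assoc, hB, Matrix.mul_zero]
  -- `T` and `T * T` have the same range
  obtain ⟨B, hB⟩ : ∃ B : Matrix n n ℍ[ℝ], T * (T * B) = T := by
    let f : Matrix n n ℍ[ℝ] →ₗ[ℝ] Matrix n n ℍ[ℝ] := LinearMap.mulLeft ℝ T
    have hker : LinearMap.ker (f ∘ₗ f) = LinearMap.ker f := by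
      ext C
      simp only [LinearMap.mem_ker, LinearMap.comp_apply, f, LinearMap.mulLeft_apply]
      exact ⟨hTT C, fun h => by rw [h, mul_zero]⟩
    have hrange : LinearMap.range (f ∘ₗ f) = LinearMap.range f := by
      refine Submodule.eq_of_le_of_finrank_eq (LinearMap.range_comp_le_range f f) ?_
      have e1 := LinearMap.finrank_range_add_finrank_ker (f ∘ₗ f)
      have e2 := LinearMap.finrank_range_add_finrank_ker f
      rw [hker] at e1
      omega
    have hmem : T ∈ LinearMap.range (f ∘ₗ f) := by
      rw [hrange]
      exact ⟨1, by simp [f]⟩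
    exact hmem
  have hB' : Bᴴ * T * T = T := by
    have := congrArg Matrix.conjTranspose hB
    rwa [Matrix.conjTranspose_mul, Matrix.conjTranspose_mul, hTs] at this
  obtain ⟨P, hP⟩ : ∃ P, P = T * B := ⟨_, rfl⟩
  have hP' : P = Bᴴ * T := by
    calc P = Bᴴ * T * T * B := by rw [hB', hP]
      _ = Bᴴ * (T * (T * B)) := by simp only [Matrix.mul_assoc]
      _ = Bᴴ * T := by rw [hB]
  have hPs : Pᴴ = P := by
    rw [hP, Matrix.conjTranspose_mul, hTs, ← hP', hP]
  have hTP : T * P = T := by rw [hP, hB]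
  have hPT : P * T = T := by rw [hP', hB']
  have hPP : P * P = P := by
    nth_rewrite 2 [hP]
    rw [← Matrix.mul_assoc, hPT, hP]
  obtain ⟨G, hG⟩ : ∃ G, G = P * B := ⟨_, rfl⟩
  have hG' : G = Bᴴ * P := by
    rw [hG, hP', Matrix.mul_assoc, ← hP, ← hP']
  have hGs : Gᴴ = G := by
    rw [hG, Matrix.conjTranspose_mul, hPs, ← hG', hG]
  have hGT : G * T = P := by rw [hG', Matrix.mul_assoc, hPT, ← hP']
  have hPG : P * G = G := by rw [hG, ← Matrix.mul_assoc, hPP]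
  have hAP : A * P = A := by
    have := hA (1 - P) (by rw [Matrix.mul_sub, Matrix.mul_one, hTP, sub_self])
    rw [Matrix.mul_sub, Matrix.mul_one, sub_eq_zero] at this
    exact this.symm
  have hYA : G * Aᴴ * A = P := by rw [Matrix.mul_assoc, ← hT, hGT]
  refine ⟨G * Aᴴ, ?_, ?_, ?_, ?_⟩
  · rw [Matrix.mul_assoc, hYA, hAP]
  · rw [hYA, ← Matrix.mul_assoc, hPG]
  · rw [Matrix.conjTranspose_mul, Matrix.conjTranspose_mul, Matrix.conjTranspose_conjTranspose,
      hGs, Matrix.mul_assoc]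
  · rw [hYA, hPs]

/-- The Moore-Penrose inverse `A†` of a quaternion matrix `A`: the unique solution `Y` of
`AYA = A`, `YAY = Y`, `(AY)* = AY`, `(YA)* = YA`. -/
noncomputable def pinv {m n : Type*} [Fintype m] [Fintype n]
    (A : Matrix m n ℍ[ℝ]) : Matrix n m ℍ[ℝ] :=
  Classical.choose (exists_isMoorePenrose A)

postfix:max "†" => pinv

theorem pinv_spec {m n : Type*} [Fintype m] [Fintype n] (A : Matrix m n ℍ[ℝ]) :
    IsMoorePenrose A A† :=
  Classical.choose_spec (exists_isMoorePenrose A)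

/-- The projector `L_A = I - A†A`. -/
noncomputable def Lp {m n : Type*} [Fintype m] [Fintype n] [DecidableEq n]
    (A : Matrix m n ℍ[ℝ]) : Matrix n n ℍ[ℝ] :=
  1 - A† * A

/-- The projector `R_A = I - AA†`. -/
noncomputable def Rp {m n : Type*} [Fintype m] [Fintype n] [DecidableEq m]
    (A : Matrix m n ℍ[ℝ]) : Matrix m m ℍ[ℝ] :=
  1 - A * A†

/-! ### The system `Aᵢ Xᵢ = Cᵢ`, `Xᵢ Bᵢ = Dᵢ`, `E₁ X F₁ + E₂ Y F₂ + E₃ Z F₃ = C` -/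

/-- The given matrices of the system
`A₁ X = C₁`, `X B₁ = D₁`, `A₂ Y = C₂`, `Y B₂ = D₂`, `A₃ Z = C₃`, `Z B₃ = D₃`,
`E₁ X F₁ + E₂ Y F₂ + E₃ Z F₃ = C`, where the unknowns `X`, `Y`, `Z` have sizes
`p₁ × q₁`, `p₂ × q₂`, `p₃ × q₃`. -/
structure TwoSidedSystem (s t p₁ q₁ a₁ b₁ p₂ q₂ a₂ b₂ p₃ q₃ a₃ b₃ : ℕ) where
  A₁ : Matrix (Fin a₁) (Fin p₁) ℍ[ℝ]
  B₁ : Matrix (Fin q₁) (Fin b₁) ℍ[ℝ]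
  C₁ : Matrix (Fin a₁) (Fin q₁) ℍ[ℝ]
  D₁ : Matrix (Fin p₁) (Fin b₁) ℍ[ℝ]
  E₁ : Matrix (Fin s) (Fin p₁) ℍ[ℝ]
  F₁ : Matrix (Fin q₁) (Fin t) ℍ[ℝ]
  A₂ : Matrix (Fin a₂) (Fin p₂) ℍ[ℝ]
  B₂ : Matrix (Fin q₂) (Fin b₂) ℍ[ℝ]
  C₂ : Matrix (Fin a₂) (Fin q₂) ℍ[ℝ]
  D₂ : Matrix (Fin p₂) (Fin b₂) ℍ[ℝ]
  E₂ : Matrix (Fin s) (Fin p₂) ℍ[ℝ]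
  F₂ : Matrix (Fin q₂) (Fin t) ℍ[ℝ]
  A₃ : Matrix (Fin a₃) (Fin p₃) ℍ[ℝ]
  B₃ : Matrix (Fin q₃) (Fin b₃) ℍ[ℝ]
  C₃ : Matrix (Fin a₃) (Fin q₃) ℍ[ℝ]
  D₃ : Matrix (Fin p₃) (Fin b₃) ℍ[ℝ]
  E₃ : Matrix (Fin s) (Fin p₃) ℍ[ℝ]
  F₃ : Matrix (Fin q₃) (Fin t) ℍ[ℝ]
  C : Matrix (Fin s) (Fin t) ℍ[ℝ]

/-- The matrices that may be chosen arbitrarily in the general solution. -/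
structure FreeParams (p₁ q₁ p₂ q₂ p₃ q₃ : ℕ) where
  U4 : Matrix (Fin p₂) (Fin q₂) ℍ[ℝ]
  U5 : Matrix (Fin p₁) (Fin q₁) ℍ[ℝ]
  U6 : Matrix (Fin p₁) (Fin q₁) ℍ[ℝ]
  U7 : Matrix (Fin p₂) (Fin q₂) ℍ[ℝ]
  U8 : Matrix (Fin p₂) (Fin q₂) ℍ[ℝ]
  U11 : Matrix (Fin p₃) (Fin q₃ ⊕ Fin q₃) ℍ[ℝ]
  U12 : Matrix (Fin p₃ ⊕ Fin p₃) (Fin q₃) ℍ[ℝ]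
  U21 : Matrix (Fin p₃) (Fin q₃ ⊕ Fin q₃) ℍ[ℝ]
  U31 : Matrix (Fin p₃) (Fin q₃) ℍ[ℝ]
  U32 : Matrix (Fin p₃) (Fin q₃) ℍ[ℝ]
  U33 : Matrix (Fin p₃) (Fin q₃) ℍ[ℝ]
  U41 : Matrix (Fin p₃) (Fin q₃) ℍ[ℝ]
  U42 : Matrix (Fin p₃) (Fin q₃) ℍ[ℝ]

namespace TwoSidedSystem

section

variable {s t p₁ q₁ a₁ b₁ p₂ q₂ a₂ b₂ p₃ q₃ a₃ b₃ : ℕ}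
  (Q : TwoSidedSystem s t p₁ q₁ a₁ b₁ p₂ q₂ a₂ b₂ p₃ q₃ a₃ b₃)

/-- `(X, Y, Z)` solves the system. -/
def IsSolution (X : Matrix (Fin p₁) (Fin q₁) ℍ[ℝ]) (Y : Matrix (Fin p₂) (Fin q₂) ℍ[ℝ])
    (Z : Matrix (Fin p₃) (Fin q₃) ℍ[ℝ]) : Prop :=
  (Q.A₁ * X = Q.C₁ ∧ X * Q.B₁ = Q.D₁) ∧
  (Q.A₂ * Y = Q.C₂ ∧ Y * Q.B₂ = Q.D₂) ∧
  (Q.A₃ * Z = Q.C₃ ∧ Z * Q.B₃ = Q.D₃) ∧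
  Q.E₁ * X * Q.F₁ + Q.E₂ * Y * Q.F₂ + Q.E₃ * Z * Q.F₃ = Q.C

/-! #### The auxiliary matrices -/

noncomputable def A11 : Matrix (Fin s) (Fin p₁) ℍ[ℝ] := Q.E₁ * Lp Q.A₁

noncomputable def A22 : Matrix (Fin s) (Fin p₂) ℍ[ℝ] := Q.E₂ * Lp Q.A₂

noncomputable def A33 : Matrix (Fin s) (Fin p₃) ℍ[ℝ] := Q.E₃ * Lp Q.A₃

noncomputable def B11 : Matrix (Fin q₁) (Fin t) ℍ[ℝ] := Rp Q.B₁ * Q.F₁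

noncomputable def B22 : Matrix (Fin q₂) (Fin t) ℍ[ℝ] := Rp Q.B₂ * Q.F₂

noncomputable def B33 : Matrix (Fin q₃) (Fin t) ℍ[ℝ] := Rp Q.B₃ * Q.F₃

noncomputable def M1 : Matrix (Fin s) (Fin p₂) ℍ[ℝ] := Rp Q.A11 * Q.A22

noncomputable def N1 : Matrix (Fin q₂) (Fin t) ℍ[ℝ] := Q.B22 * Lp Q.B11

noncomputable def S1 : Matrix (Fin s) (Fin p₂) ℍ[ℝ] := Q.A22 * Lp Q.M1

noncomputable def G : Matrix (Fin s) (Fin s) ℍ[ℝ] := Rp Q.M1 * Rp Q.A11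

/-- `A₁†C₁ + L_{A₁}D₁B₁†`, the part of `X` without free parameters. -/
noncomputable def X0 : Matrix (Fin p₁) (Fin q₁) ℍ[ℝ] := Q.A₁† * Q.C₁ + Lp Q.A₁ * Q.D₁ * Q.B₁†

/-- `A₂†C₂ + L_{A₂}D₂B₂†`, the part of `Y` without free parameters. -/
noncomputable def Y0 : Matrix (Fin p₂) (Fin q₂) ℍ[ℝ] := Q.A₂† * Q.C₂ + Lp Q.A₂ * Q.D₂ * Q.B₂†

/-- `A₃†C₃ + L_{A₃}D₃B₃†`, the part of `Z` without free parameters. -/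
noncomputable def Z0 : Matrix (Fin p₃) (Fin q₃) ℍ[ℝ] := Q.A₃† * Q.C₃ + Lp Q.A₃ * Q.D₃ * Q.B₃†

noncomputable def T1 : Matrix (Fin s) (Fin t) ℍ[ℝ] :=
  Q.C - (Q.E₁ * Q.X0 * Q.F₁ + Q.E₂ * Q.Y0 * Q.F₂ + Q.E₃ * Q.Z0 * Q.F₃)

noncomputable def G1 : Matrix (Fin s) (Fin p₃) ℍ[ℝ] := Q.G * Q.A33

noncomputable def G2 : Matrix (Fin s) (Fin p₃) ℍ[ℝ] := Rp Q.A11 * Q.A33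

noncomputable def G3 : Matrix (Fin s) (Fin p₃) ℍ[ℝ] := Rp Q.A22 * Q.A33

noncomputable def G4 : Matrix (Fin s) (Fin p₃) ℍ[ℝ] := Q.A33

noncomputable def H : Matrix (Fin t) (Fin t) ℍ[ℝ] := Lp Q.B11 * Lp Q.N1

noncomputable def H1 : Matrix (Fin q₃) (Fin t) ℍ[ℝ] := Q.B33

noncomputable def H2 : Matrix (Fin q₃) (Fin t) ℍ[ℝ] := Q.B33 * Lp Q.B22

noncomputable def H3 : Matrix (Fin q₃) (Fin t) ℍ[ℝ] := Q.B33 * Lp Q.B11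

noncomputable def H4 : Matrix (Fin q₃) (Fin t) ℍ[ℝ] := Q.B33 * Q.H

noncomputable def L1 : Matrix (Fin s) (Fin t) ℍ[ℝ] := Q.G * Q.T1

noncomputable def L2 : Matrix (Fin s) (Fin t) ℍ[ℝ] := Rp Q.A11 * Q.T1 * Lp Q.B22

noncomputable def L3 : Matrix (Fin s) (Fin t) ℍ[ℝ] := Rp Q.A22 * Q.T1 * Lp Q.B11

noncomputable def L4 : Matrix (Fin s) (Fin t) ℍ[ℝ] := Q.T1 * Q.H

noncomputable def C11 : Matrix (Fin p₃) (Fin p₃ ⊕ Fin p₃) ℍ[ℝ] := Lp Q.G2 │ Lp Q.G4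

noncomputable def D11 : Matrix (Fin q₃ ⊕ Fin q₃) (Fin q₃) ℍ[ℝ] := Rp Q.H1 ⊟ Rp Q.H3

noncomputable def C22 : Matrix (Fin p₃) (Fin p₃) ℍ[ℝ] := Lp Q.G1

noncomputable def D22 : Matrix (Fin q₃) (Fin q₃) ℍ[ℝ] := Rp Q.H2

noncomputable def C33 : Matrix (Fin p₃) (Fin p₃) ℍ[ℝ] := Lp Q.G3

noncomputable def D33 : Matrix (Fin q₃) (Fin q₃) ℍ[ℝ] := Rp Q.H4

noncomputable def E11 : Matrix (Fin p₃) (Fin p₃) ℍ[ℝ] := Rp Q.C11 * Q.C22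

noncomputable def E22 : Matrix (Fin p₃) (Fin p₃) ℍ[ℝ] := Rp Q.C11 * Q.C33

noncomputable def E33 : Matrix (Fin q₃) (Fin q₃) ℍ[ℝ] := Q.D22 * Lp Q.D11

noncomputable def E44 : Matrix (Fin q₃) (Fin q₃) ℍ[ℝ] := Q.D33 * Lp Q.D11

noncomputable def M : Matrix (Fin p₃) (Fin p₃) ℍ[ℝ] := Rp Q.E11 * Q.E22

noncomputable def N : Matrix (Fin q₃) (Fin q₃) ℍ[ℝ] := Q.E44 * Lp Q.E33

noncomputable def F10 : Matrix (Fin p₃) (Fin q₃) ℍ[ℝ] :=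
  Q.G1† * Q.L1 * Q.H1† + Lp Q.G1 * Q.G2† * Q.L2 * Q.H2†

noncomputable def F20 : Matrix (Fin p₃) (Fin q₃) ℍ[ℝ] :=
  Q.G3† * Q.L3 * Q.H3† + Lp Q.G3 * Q.G4† * Q.L4 * Q.H4†

noncomputable def F : Matrix (Fin p₃) (Fin q₃) ℍ[ℝ] := Q.F20 - Q.F10

noncomputable def E : Matrix (Fin p₃) (Fin q₃) ℍ[ℝ] := Rp Q.C11 * Q.F * Lp Q.D11

noncomputable def S : Matrix (Fin p₃) (Fin p₃) ℍ[ℝ] := Q.E22 * Lp Q.M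

/-! #### The solvability criteria -/

/-- `Aᵢ Dᵢ = Cᵢ Bᵢ` for `i = 1, 2, 3`. -/
def Compatible : Prop :=
  Q.A₁ * Q.D₁ = Q.C₁ * Q.B₁ ∧ Q.A₂ * Q.D₂ = Q.C₂ * Q.B₂ ∧ Q.A₃ * Q.D₃ = Q.C₃ * Q.B₃

/-- The conditions in terms of the projectors of the Moore-Penrose inverses. -/
def ProjectorConditions : Prop :=
  (Rp Q.A₁ * Q.C₁ = 0 ∧ Q.D₁ * Lp Q.B₁ = 0) ∧
  (Rp Q.A₂ * Q.C₂ = 0 ∧ Q.D₂ * Lp Q.B₂ = 0) ∧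
  (Rp Q.A₃ * Q.C₃ = 0 ∧ Q.D₃ * Lp Q.B₃ = 0) ∧
  (Rp Q.G1 * Q.L1 = 0 ∧ Q.L1 * Lp Q.H1 = 0) ∧
  (Rp Q.G2 * Q.L2 = 0 ∧ Q.L2 * Lp Q.H2 = 0) ∧
  (Rp Q.G3 * Q.L3 = 0 ∧ Q.L3 * Lp Q.H3 = 0) ∧
  (Rp Q.G4 * Q.L4 = 0 ∧ Q.L4 * Lp Q.H4 = 0) ∧
  Rp Q.E22 * Q.E * Lp Q.E33 = 0

/-- The conditions in terms of ranks of block matrices. -/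
def RankConditions : Prop :=
  (rk (Q.C₁ │ Q.A₁) = rk Q.A₁ ∧ rk (Q.D₁ ⊟ Q.B₁) = rk Q.B₁) ∧
  (rk (Q.C₂ │ Q.A₂) = rk Q.A₂ ∧ rk (Q.D₂ ⊟ Q.B₂) = rk Q.B₂) ∧
  (rk (Q.C₃ │ Q.A₃) = rk Q.A₃ ∧ rk (Q.D₃ ⊟ Q.B₃) = rk Q.B₃) ∧
  rk (Q.C │ Q.E₁ │ Q.E₂ │ Q.E₃ ⊟
      Q.C₁ * Q.F₁ │ Q.A₁ │ 0 │ 0 ⊟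
      Q.C₂ * Q.F₂ │ 0 │ Q.A₂ │ 0 ⊟
      Q.C₃ * Q.F₃ │ 0 │ 0 │ Q.A₃)
    = rk (Q.E₁ │ Q.E₂ │ Q.E₃ ⊟
          Q.A₁ │ 0 │ 0 ⊟
          0 │ Q.A₂ │ 0 ⊟
          0 │ 0 │ Q.A₃) ∧
  rk (Q.C │ Q.E₁ │ Q.E₃ │ Q.E₂ * Q.D₂ ⊟
      Q.F₂ │ 0 │ 0 │ Q.B₂ ⊟
      Q.C₁ * Q.F₁ │ Q.A₁ │ 0 │ 0 ⊟
      Q.C₃ * Q.F₃ │ 0 │ Q.A₃ │ 0)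
    = rk (Q.E₁ │ Q.E₃ ⊟
          Q.A₁ │ 0 ⊟
          0 │ Q.A₃)
    + rk (Q.F₂ │ Q.B₂) ∧
  rk (Q.C │ Q.E₃ │ Q.E₂ │ Q.E₁ * Q.D₁ ⊟
      Q.F₁ │ 0 │ 0 │ Q.B₁ ⊟
      Q.C₃ * Q.F₃ │ Q.A₃ │ 0 │ 0 ⊟
      Q.C₂ * Q.F₂ │ 0 │ Q.A₂ │ 0)
    = rk (Q.E₃ │ Q.E₂ ⊟
          Q.A₃ │ 0 ⊟
          0 │ Q.A₂)
    + rk (Q.F₁ │ Q.B₁) ∧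
  rk (Q.C │ Q.E₃ │ Q.E₁ * Q.D₁ │ Q.E₂ * Q.D₂ ⊟
      Q.F₁ │ 0 │ Q.B₁ │ 0 ⊟
      Q.F₂ │ 0 │ 0 │ Q.B₂ ⊟
      Q.C₃ * Q.F₃ │ Q.A₃ │ 0 │ 0)
    = rk (Q.F₁ │ Q.B₁ │ 0 ⊟
          Q.F₂ │ 0 │ Q.B₂)
    + rk (Q.E₃ ⊟
          Q.A₃) ∧
  rk (Q.C │ Q.E₁ │ Q.E₂ │ Q.E₃ * Q.D₃ ⊟
      Q.F₃ │ 0 │ 0 │ Q.B₃ ⊟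
      Q.C₁ * Q.F₁ │ Q.A₁ │ 0 │ 0 ⊟
      Q.C₂ * Q.F₂ │ 0 │ Q.A₂ │ 0)
    = rk (Q.E₁ │ Q.E₂ ⊟
          Q.A₁ │ 0 ⊟
          0 │ Q.A₂)
    + rk (Q.F₃ │ Q.B₃) ∧
  rk (Q.C │ Q.E₁ │ Q.E₃ * Q.D₃ │ Q.E₂ * Q.D₂ ⊟
      Q.F₃ │ 0 │ Q.B₃ │ 0 ⊟
      Q.F₂ │ 0 │ 0 │ Q.B₂ ⊟
      Q.C₁ * Q.F₁ │ Q.A₁ │ 0 │ 0)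
    = rk (Q.F₃ │ Q.B₃ │ 0 ⊟
          Q.F₂ │ 0 │ Q.B₂)
    + rk (Q.E₁ ⊟
          Q.A₁) ∧
  rk (Q.C │ Q.E₂ │ Q.E₁ * Q.D₁ │ Q.E₃ * Q.D₃ ⊟
      Q.F₁ │ 0 │ Q.B₁ │ 0 ⊟
      Q.F₃ │ 0 │ 0 │ Q.B₃ ⊟
      Q.C₂ * Q.F₂ │ Q.A₂ │ 0 │ 0)
    = rk (Q.F₁ │ Q.B₁ │ 0 ⊟
          Q.F₃ │ 0 │ Q.B₃)
    + rk (Q.E₂ ⊟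
          Q.A₂) ∧
  rk (Q.C │ Q.E₁ * Q.D₁ │ Q.E₂ * Q.D₂ │ Q.E₃ * Q.D₃ ⊟
      Q.F₁ │ Q.B₁ │ 0 │ 0 ⊟
      Q.F₂ │ 0 │ Q.B₂ │ 0 ⊟
      Q.F₃ │ 0 │ 0 │ Q.B₃)
    = rk (Q.F₁ │ Q.B₁ │ 0 │ 0 ⊟
          Q.F₂ │ 0 │ Q.B₂ │ 0 ⊟
          Q.F₃ │ 0 │ 0 │ Q.B₃) ∧
  rk (Q.C │ 0 │ Q.E₁ │ 0 │ Q.E₃ │ Q.E₂ * Q.D₂ │ 0 │ Q.E₃ * Q.D₃ ⊟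
      0 │ -Q.C │ 0 │ Q.E₂ │ Q.E₃ │ 0 │ -(Q.E₁ * Q.D₁) │ 0 ⊟
      Q.F₂ │ 0 │ 0 │ 0 │ 0 │ Q.B₂ │ 0 │ 0 ⊟
      0 │ Q.F₁ │ 0 │ 0 │ 0 │ 0 │ Q.B₁ │ 0 ⊟
      Q.F₃ │ Q.F₃ │ 0 │ 0 │ 0 │ 0 │ 0 │ Q.B₃ ⊟
      Q.C₁ * Q.F₁ │ 0 │ Q.A₁ │ 0 │ 0 │ 0 │ 0 │ 0 ⊟
      0 │ -(Q.C₂ * Q.F₂) │ 0 │ Q.A₂ │ 0 │ 0 │ 0 │ 0 ⊟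
      0 │ -(Q.C₃ * Q.F₃) │ 0 │ 0 │ Q.A₃ │ 0 │ 0 │ 0)
    = rk (Q.F₂ │ 0 │ Q.B₂ │ 0 │ 0 ⊟
          0 │ Q.F₁ │ 0 │ Q.B₁ │ 0 ⊟
          Q.F₃ │ Q.F₃ │ 0 │ 0 │ Q.B₃)
    + rk (Q.E₁ │ 0 │ Q.E₃ ⊟
          0 │ Q.E₂ │ Q.E₃ ⊟
          Q.A₁ │ 0 │ 0 ⊟
          0 │ Q.A₂ │ 0 ⊟
          0 │ 0 │ Q.A₃)

/-! #### The general solution -/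

variable (P : FreeParams p₁ q₁ p₂ q₂ p₃ q₃)

noncomputable def V3 : Matrix (Fin p₃) (Fin q₃) ℍ[ℝ] :=
  Q.E11† * Q.F * Q.E33† - Q.E11† * Q.E22 * Q.M† * Q.F * Q.E33†
    - Q.E11† * Q.S * Q.E22† * Q.F * Q.N† * Q.E44 * Q.E33†
    - Q.E11† * Q.S * P.U31 * Rp Q.N * Q.E44 * Q.E33†
    + Lp Q.E11 * P.U32 + P.U33 * Rp Q.E33

noncomputable def W3 : Matrix (Fin p₃) (Fin q₃) ℍ[ℝ] :=
  Q.M† * Q.F * Q.E44† + Q.S† * Q.S * Q.E22† * Q.F * Q.N†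
    + Lp Q.M * Lp Q.S * P.U41 + Lp Q.M * P.U31 * Rp Q.N + P.U42 * Rp Q.E44

/-- `F - C₂₂V₃D₂₂ - C₃₃W₃D₃₃`, which occurs in `V₁`, `V₂`, `W₁`, `W₂`. -/
noncomputable def Res : Matrix (Fin p₃) (Fin q₃) ℍ[ℝ] :=
  Q.F - Q.C22 * Q.V3 P * Q.D22 - Q.C33 * Q.W3 P * Q.D33

noncomputable def V1 : Matrix (Fin p₃) (Fin q₃) ℍ[ℝ] :=
  (1 │ 0) * (Q.C11† * Q.Res P) - (1 │ 0) * (Q.C11† * P.U11 * Q.D11 - Lp Q.C11 * P.U12)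

noncomputable def W1 : Matrix (Fin p₃) (Fin q₃) ℍ[ℝ] :=
  (0 │ 1) * (Q.C11† * Q.Res P) - (0 │ 1) * (Q.C11† * P.U11 * Q.D11 - Lp Q.C11 * P.U12)

noncomputable def V2 : Matrix (Fin p₃) (Fin q₃) ℍ[ℝ] :=
  (Rp Q.C11 * Q.Res P * Q.D11†) * (1 ⊟ 0)
    + (Q.C11 * Q.C11† * P.U11 + P.U21 * Rp Q.D11) * (1 ⊟ 0)

noncomputable def W2 : Matrix (Fin p₃) (Fin q₃) ℍ[ℝ] :=
  (Rp Q.C11 * Q.Res P * Q.D11†) * (0 ⊟ 1)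
    + (Q.C11 * Q.C11† * P.U11 + P.U21 * Rp Q.D11) * (0 ⊟ 1)

/-- The first expression for `U₃`. -/
noncomputable def U3 : Matrix (Fin p₃) (Fin q₃) ℍ[ℝ] :=
  Q.F10 + Lp Q.G2 * Q.V1 P + Q.V2 P * Rp Q.H1 + Lp Q.G1 * Q.V3 P * Rp Q.H2

/-- The second expression for `U₃`. -/
noncomputable def U3' : Matrix (Fin p₃) (Fin q₃) ℍ[ℝ] :=
  Q.F20 - Lp Q.G4 * Q.W1 P - Q.W2 P * Rp Q.H3 - Lp Q.G3 * Q.W3 P * Rp Q.H4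

/-- `T = T₁ - A₃₃U₃B₃₃`, as a function of `U₃`. -/
noncomputable def T (U : Matrix (Fin p₃) (Fin q₃) ℍ[ℝ]) : Matrix (Fin s) (Fin t) ℍ[ℝ] :=
  Q.T1 - Q.A33 * U * Q.B33

/-- `U₁`, as a function of the parameters and of `U₃`. -/
noncomputable def U1 (U : Matrix (Fin p₃) (Fin q₃) ℍ[ℝ]) : Matrix (Fin p₁) (Fin q₁) ℍ[ℝ] :=
  Q.A11† * Q.T U * Q.B11† - Q.A11† * Q.A22 * Q.M1† * Q.T U * Q.B11†
    - Q.A11† * Q.S1 * Q.A22† * Q.T U * Q.N1† * Q.B22 * Q.B11†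
    - Q.A11† * Q.S1 * P.U4 * Rp Q.N1 * Q.B22 * Q.B11†
    + Lp Q.A11 * P.U5 + P.U6 * Rp Q.B11

/-- `U₂`, as a function of the parameters and of `U₃`. -/
noncomputable def U2 (U : Matrix (Fin p₃) (Fin q₃) ℍ[ℝ]) : Matrix (Fin p₂) (Fin q₂) ℍ[ℝ] :=
  Q.M1† * Q.T U * Q.B22† + Q.S1† * Q.S1 * Q.A22† * Q.T U * Q.N1†
    + Lp Q.M1 * Lp Q.S1 * P.U7 + P.U8 * Rp Q.B22 + Lp Q.M1 * P.U4 * Rp Q.N1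

/-- `(X, Y, Z)` is given by the formula for the general solution, with the parameters `P` and
with `U` in the place of `U₃`. -/
def IsGivenBy (U : Matrix (Fin p₃) (Fin q₃) ℍ[ℝ]) (X : Matrix (Fin p₁) (Fin q₁) ℍ[ℝ])
    (Y : Matrix (Fin p₂) (Fin q₂) ℍ[ℝ]) (Z : Matrix (Fin p₃) (Fin q₃) ℍ[ℝ]) : Prop :=
  X = Q.A₁† * Q.C₁ + Lp Q.A₁ * Q.D₁ * Q.B₁† + Lp Q.A₁ * Q.U1 P U * Rp Q.B₁ ∧
  Y = Q.A₂† * Q.C₂ + Lp Q.A₂ * Q.D₂ * Q.B₂† + Lp Q.A₂ * Q.U2 P U * Rp Q.B₂ ∧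
  Z = Q.A₃† * Q.C₃ + Lp Q.A₃ * Q.D₃ * Q.B₃† + Lp Q.A₃ * U * Rp Q.B₃

end

end TwoSidedSystem

end QuatMat

namespace QuatMat

/-! ### Algebra of Moore–Penrose inverses and of the projectors `Lp`, `Rp`. -/

section Pinv

/-! The one-sided equations fix `X`, `Y`, `Z` up to terms `Lp Aᵢ * Uᵢ * Rp Bᵢ`, so the system
becomes `A11 U₁ B11 + A22 U₂ B22 + A33 U₃ B33 = T1`. For fixed `U₃` this is a two-term equation `A X
B + C Y D = E`, solvable exactly under four projector identities (`two_term_sound`,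
`two_term_complete`). Read as conditions on `U₃`, these are the four linear equations `Gⱼ U₃ Hⱼ =
Lⱼ`.

Equations 1, 2 and equations 3, 4 form two nested pairs (`nested_pair_particular`,
`nested_pair_complete`), with particular solutions `F10` and `F20`. Equating the two general
solutions leaves one equation for the coefficients `Vᵢ`, `Wᵢ`. Multiplication by `Rp C11` and `Lp
D11` removes its one-sided terms, and what remains is again a two-term equation, `E11 V₃ E33 + E22
W₃ E44 = E`. Of its four solvability conditions all but `Rp E22 * E * Lp E33 = 0` follow from the
conditions on the pairs, because `G1 F H3 = 0` and `G2 F H4 = 0`. Back substitution through a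
one-sided equation (`sylvester_sound`, `sylvester_complete`) gives the remaining coefficients.

For the ranks, `rk (T │ E ⊟ F │ 0) = rk E + rk F` holds if and only if `T = E P + Q F` is solvable.
Hence each block rank condition says that certain linear equations are solvable in which each
product `X Fᵢ` or `Eᵢ X` is replaced by an independent unknown. A solution of the system supplies
these unknowns. Conversely, the first eight block conditions give the conditions on the pairs, and
the ninth, tested against suitable rows and columns, gives `Rp E22 * E * Lp E33 = 0`
(`Rp_E22_mul_E_mul_Lp_E33`). The equivalence is closed as the cycle 1 → 3 → 2 → 1. -/

theorem mul_reassoc {k l m n : Type*} [Fintype l] [Fintype m] {A : Matrix k l ℍ[ℝ]}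
    {B : Matrix l m ℍ[ℝ]} {C : Matrix k m ℍ[ℝ]} (h : A * B = C) (X : Matrix m n ℍ[ℝ]) :
    A * (B * X) = C * X := by
  rw [← Matrix.mul_assoc, h]

/-- Products are normalised to the right-associated form; this rule and `mul_reassoc` let an
identity for a short product act inside a longer one. -/
theorem mul_mul_reassoc {k l m n p : Type*} [Fintype l] [Fintype m] [Fintype p]
    {A : Matrix k l ℍ[ℝ]} {B : Matrix l m ℍ[ℝ]} {C : Matrix m p ℍ[ℝ]} {D : Matrix k p ℍ[ℝ]}
    (h : A * (B * C) = D) (X : Matrix p n ℍ[ℝ]) : A * (B * (C * X)) = D * X := by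
  rw [← Matrix.mul_assoc B, mul_reassoc h]

theorem mul_pinv_mul {m n : Type*} [Fintype m] [Fintype n] (A : Matrix m n ℍ[ℝ]) :
    A * (A† * A) = A := by
  rw [← Matrix.mul_assoc]; exact (pinv_spec A).1

theorem mul_pinv_mul_assoc {l m n : Type*} [Fintype m] [Fintype n] (A : Matrix m n ℍ[ℝ])
    (X : Matrix n l ℍ[ℝ]) : A * (A† * (A * X)) = A * X := by
  rw [← Matrix.mul_assoc A†, mul_reassoc (mul_pinv_mul A)]

theorem pinv_mul_pinv {m n : Type*} [Fintype m] [Fintype n] (A : Matrix m n ℍ[ℝ]) :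
    A† * (A * A†) = A† := by
  rw [← Matrix.mul_assoc]; exact (pinv_spec A).2.1

theorem mul_Lp {m n : Type*} [Fintype m] [Fintype n] [DecidableEq n] (A : Matrix m n ℍ[ℝ]) :
    A * Lp A = 0 := by
  rw [Lp, Matrix.mul_sub, Matrix.mul_one, mul_pinv_mul, sub_self]

theorem Rp_mul {m n : Type*} [Fintype m] [Fintype n] [DecidableEq m] (A : Matrix m n ℍ[ℝ]) :
    Rp A * A = 0 := by
  rw [Rp, Matrix.sub_mul, Matrix.one_mul, Matrix.mul_assoc, mul_pinv_mul, sub_self]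

theorem Lp_mul_apply {l m n : Type*} [Fintype m] [Fintype n] [DecidableEq n]
    (A : Matrix m n ℍ[ℝ]) (X : Matrix n l ℍ[ℝ]) : Lp A * X = X - A† * (A * X) := by
  rw [Lp, Matrix.sub_mul, Matrix.one_mul, Matrix.mul_assoc]

theorem Rp_mul_apply {l m n : Type*} [Fintype m] [Fintype n] [DecidableEq m]
    (A : Matrix m n ℍ[ℝ]) (X : Matrix m l ℍ[ℝ]) : Rp A * X = X - A * (A† * X) := by
  rw [Rp, Matrix.sub_mul, Matrix.one_mul, Matrix.mul_assoc]

theorem mul_Lp_apply {l m n : Type*} [Fintype m] [Fintype n] [DecidableEq n]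
    (X : Matrix l n ℍ[ℝ]) (A : Matrix m n ℍ[ℝ]) : X * Lp A = X - X * (A† * A) := by
  rw [Lp, Matrix.mul_sub, Matrix.mul_one]

theorem mul_Rp_apply {l m n : Type*} [Fintype m] [Fintype n] [DecidableEq m]
    (X : Matrix l m ℍ[ℝ]) (A : Matrix m n ℍ[ℝ]) : X * Rp A = X - X * (A * A†) := by
  rw [Rp, Matrix.mul_sub, Matrix.mul_one]

theorem Rp_mul_eq_zero_iff {l m n : Type*} [Fintype m] [Fintype n] [DecidableEq m]
    {A : Matrix m n ℍ[ℝ]} {X : Matrix m l ℍ[ℝ]} : Rp A * X = 0 ↔ A * (A† * X) = X := by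
  rw [Rp_mul_apply, sub_eq_zero, eq_comm]

theorem mul_Lp_eq_zero_iff {l m n : Type*} [Fintype m] [Fintype n] [DecidableEq n]
    {A : Matrix m n ℍ[ℝ]} {X : Matrix l n ℍ[ℝ]} : X * Lp A = 0 ↔ X * (A† * A) = X := by
  rw [mul_Lp_apply, sub_eq_zero, eq_comm]

theorem Lp_mul_of_mul_eq_zero {l m n : Type*} [Fintype m] [Fintype n] [DecidableEq n]
    {A : Matrix m n ℍ[ℝ]} {X : Matrix n l ℍ[ℝ]} (h : A * X = 0) : Lp A * X = X := by
  rw [Lp_mul_apply, h, Matrix.mul_zero, sub_zero]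

theorem mul_Rp_of_mul_eq_zero {l m n : Type*} [Fintype m] [Fintype n] [DecidableEq m]
    {A : Matrix m n ℍ[ℝ]} {X : Matrix l m ℍ[ℝ]} (h : X * A = 0) : X * Rp A = X := by
  rw [mul_Rp_apply, ← Matrix.mul_assoc, h, Matrix.zero_mul, sub_zero]

theorem conjTranspose_Rp {m n : Type*} [Fintype m] [Fintype n] [DecidableEq m]
    (A : Matrix m n ℍ[ℝ]) : (Rp A)ᴴ = Rp A := by
  rw [Rp, Matrix.conjTranspose_sub, Matrix.conjTranspose_one, (pinv_spec A).2.2.1]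

theorem conjTranspose_Lp {m n : Type*} [Fintype m] [Fintype n] [DecidableEq n]
    (A : Matrix m n ℍ[ℝ]) : (Lp A)ᴴ = Lp A := by
  rw [Lp, Matrix.conjTranspose_sub, Matrix.conjTranspose_one, (pinv_spec A).2.2.2]

/-- Taking conjugate transposes in `P * (A * A†) = A * A†` moves `P` to the right of the Hermitian
product `A * A†`, and `A† = A† * (A * A†)` ends in that product. -/
theorem pinv_mul_of_mul_eq {m n : Type*} [Fintype m] [Fintype n]
    {A : Matrix m n ℍ[ℝ]} {P : Matrix m m ℍ[ℝ]} (hP : Pᴴ = P) (h : P * A = A) :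
    A† * P = A† := by
  have h1 : A * (A† * P) = A * A† := by
    rw [← Matrix.mul_assoc]
    nth_rewrite 1 [← (pinv_spec A).2.2.1]
    nth_rewrite 1 [← hP]
    rw [← Matrix.conjTranspose_mul, ← Matrix.mul_assoc, h, (pinv_spec A).2.2.1]
  calc A† * P = A† * (A * (A† * P)) := by
        rw [← Matrix.mul_assoc, ← Matrix.mul_assoc, (pinv_spec A).2.1]
    _ = A† := by rw [h1, pinv_mul_pinv]

theorem mul_pinv_of_mul_eq {m n : Type*} [Fintype m] [Fintype n]
    {A : Matrix m n ℍ[ℝ]} {P : Matrix n n ℍ[ℝ]} (hP : Pᴴ = P) (h : A * P = A) :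
    P * A† = A† := by
  have h1 : P * (A† * A) = A† * A := by
    nth_rewrite 1 [← (pinv_spec A).2.2.2]
    nth_rewrite 1 [← hP]
    rw [← Matrix.conjTranspose_mul, Matrix.mul_assoc, h, (pinv_spec A).2.2.2]
  calc P * A† = P * (A† * A) * A† := by rw [Matrix.mul_assoc, Matrix.mul_assoc, pinv_mul_pinv]
    _ = A† := by rw [h1, (pinv_spec A).2.1]

theorem Rp_mul_Rp {m n : Type*} [Fintype m] [Fintype n] [DecidableEq m]
    (A : Matrix m n ℍ[ℝ]) : Rp A * Rp A = Rp A := by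
  rw [mul_Rp_apply, mul_reassoc (Rp_mul A), Matrix.zero_mul, sub_zero]

theorem Lp_mul_Lp {m n : Type*} [Fintype m] [Fintype n] [DecidableEq n]
    (A : Matrix m n ℍ[ℝ]) : Lp A * Lp A = Lp A :=
  Lp_mul_of_mul_eq_zero (mul_Lp A)

theorem pinv_mul_Rp {k m n : Type*} [Fintype k] [Fintype m] [Fintype n] [DecidableEq m]
    {A : Matrix m n ℍ[ℝ]} {B : Matrix m k ℍ[ℝ]} (h : Rp B * A = A) : A† * Rp B = A† :=
  pinv_mul_of_mul_eq (conjTranspose_Rp B) h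

theorem Lp_mul_pinv {k m n : Type*} [Fintype k] [Fintype m] [Fintype n] [DecidableEq n]
    {A : Matrix m n ℍ[ℝ]} {B : Matrix k n ℍ[ℝ]} (h : A * Lp B = A) : Lp B * A† = A† :=
  mul_pinv_of_mul_eq (conjTranspose_Lp B) h

theorem pinv_mul_eq_zero {k m n : Type*} [Fintype k] [Fintype m] [Fintype n] [DecidableEq m]
    {A : Matrix m n ℍ[ℝ]} {B : Matrix m k ℍ[ℝ]} (h : Rp B * A = A) : A† * B = 0 := by
  rw [← pinv_mul_Rp h, Matrix.mul_assoc, Rp_mul, Matrix.mul_zero]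

theorem mul_pinv_eq_zero {k m n : Type*} [Fintype k] [Fintype m] [Fintype n] [DecidableEq n]
    {A : Matrix m n ℍ[ℝ]} {B : Matrix k n ℍ[ℝ]} (h : A * Lp B = A) : B * A† = 0 := by
  rw [← Lp_mul_pinv h, ← Matrix.mul_assoc, mul_Lp, Matrix.zero_mul]

end Pinv

/-! ### One-term equations, and the one-sided equation `A V + W B = Φ`. -/

section OneTerm

variable {m n p q : Type*} [Fintype m] [Fintype n] [Fintype p] [Fintype q]

/-- Solutions of the homogeneous equation `A X B = 0`. -/
theorem eq_of_mul_mul_eq_zero [DecidableEq p] [DecidableEq q] {A : Matrix m p ℍ[ℝ]}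
    {B : Matrix q n ℍ[ℝ]} {X : Matrix p q ℍ[ℝ]} (h : A * X * B = 0) :
    X = Lp A * X + A† * A * X * Rp B := by
  simp only [Matrix.mul_assoc] at h
  simp only [Lp_mul_apply, mul_Rp_apply, Matrix.mul_assoc, Matrix.mul_sub, mul_mul_reassoc h,
    Matrix.zero_mul, Matrix.mul_zero]
  abel

/-- A particular solution of the pair `A X = C`, `X B = D`. -/
theorem particular_mul [DecidableEq p] {A : Matrix m p ℍ[ℝ]} {B : Matrix q n ℍ[ℝ]}
    {C : Matrix m q ℍ[ℝ]} {D : Matrix p n ℍ[ℝ]} [DecidableEq m] (h : Rp A * C = 0) :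
    A * (A† * C + Lp A * D * B†) = C := by
  rw [Matrix.mul_add, Rp_mul_eq_zero_iff.1 h]
  simp only [Matrix.mul_assoc, mul_reassoc (mul_Lp A), Matrix.zero_mul, add_zero]

/-- Compatibility is what makes this work: `A† C B = A† A D` is exactly the part of `D` that `Lp A`
removes. -/
theorem mul_particular [DecidableEq p] [DecidableEq n] {A : Matrix m p ℍ[ℝ]}
    {B : Matrix q n ℍ[ℝ]}
    {C : Matrix m q ℍ[ℝ]} {D : Matrix p n ℍ[ℝ]} (hc : A * D = C * B) (h : D * Lp B = 0) :
    (A† * C + Lp A * D * B†) * B = D := by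
  rw [mul_Lp_eq_zero_iff] at h
  simp only [Matrix.mul_assoc, Matrix.add_mul, Matrix.sub_mul, h, ← hc, Lp_mul_apply]
  abel

/-- The general solution of the pair `A X = C`, `X B = D`. -/
theorem eq_particular_add [DecidableEq p] [DecidableEq q] {A : Matrix m p ℍ[ℝ]}
    {B : Matrix q n ℍ[ℝ]} {C : Matrix m q ℍ[ℝ]} {D : Matrix p n ℍ[ℝ]} {X : Matrix p q ℍ[ℝ]}
    (h1 : A * X = C) (h2 : X * B = D) :
    X = A† * C + Lp A * D * B† + Lp A * X * Rp B := by
  subst h1 h2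
  simp only [Lp_mul_apply, mul_Rp_apply, Matrix.mul_assoc, Matrix.sub_mul, Matrix.mul_sub]
  abel

end OneTerm

section OneSided

variable {m n p q : Type*} [Fintype m] [Fintype n] [Fintype p] [Fintype q]
  [DecidableEq m] [DecidableEq p] [DecidableEq q]

/-- Solutions of `A V + W B = Φ`. -/
theorem sylvester_sound [DecidableEq n] {A : Matrix m p ℍ[ℝ]} {B : Matrix q n ℍ[ℝ]} {Φ : Matrix m n ℍ[ℝ]}
    (h : Rp A * Φ * Lp B = 0) (U V : Matrix m q ℍ[ℝ]) (W : Matrix p n ℍ[ℝ]) :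
    A * (A† * Φ - (A† * U * B - Lp A * W)) + (Rp A * Φ * B† + (A * A† * U + V * Rp B)) * B = Φ := by
  rw [mul_Lp_eq_zero_iff] at h
  simp only [Matrix.mul_assoc, Matrix.mul_sub, Matrix.add_mul,
    mul_reassoc (mul_Lp A), Rp_mul, Matrix.mul_zero, Matrix.zero_mul] at h ⊢
  rw [h, Rp_mul_apply]
  abel

/-- A given solution is reproduced by taking, in `sylvester_sound`, the parameters `U`, `V`, `W` to
be `W`, `Rp A * W`, `V`. -/
theorem sylvester_complete {A : Matrix m p ℍ[ℝ]} {B : Matrix q n ℍ[ℝ]} {Φ : Matrix m n ℍ[ℝ]}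
    {V : Matrix p n ℍ[ℝ]} {W : Matrix m q ℍ[ℝ]} (h : A * V + W * B = Φ) :
    V = A† * Φ - (A† * W * B - Lp A * V) ∧
      W = Rp A * Φ * B† + (A * A† * W + Rp A * W * Rp B) := by
  subst h
  constructor
  · simp only [Matrix.mul_assoc, Matrix.mul_add, Lp_mul_apply]
    abel
  · rw [Matrix.mul_add, ← Matrix.mul_assoc (Rp A) A, Rp_mul, Matrix.zero_mul, zero_add]
    simp only [Matrix.mul_assoc, mul_Rp_apply, Rp_mul_apply, Matrix.sub_mul, Matrix.mul_sub]
    abel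

end OneSided

/-! ### Nested pairs of equations for one unknown. -/

section Pair

variable {m n p q m' n' : Type*} [Fintype m] [Fintype n] [Fintype p] [Fintype q]
  [Fintype m'] [Fintype n'] [DecidableEq p]

/-- The particular solution of the nested pair `G₁ U H₁ = L₁`, `G₂ U H₂ = L₂`, where
`G₁ = R G₂` and `H₂ = H₁ K`. -/
theorem nested_pair_particular [DecidableEq m] [DecidableEq n] [DecidableEq m'] [DecidableEq n']
    {G₁ : Matrix m' p ℍ[ℝ]} {G₂ : Matrix m p ℍ[ℝ]}
    {H₁ : Matrix q n ℍ[ℝ]} {H₂ : Matrix q n' ℍ[ℝ]} {R : Matrix m' m ℍ[ℝ]} {K : Matrix n n' ℍ[ℝ]}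
    {L₁ : Matrix m' n ℍ[ℝ]} {L₂ : Matrix m n' ℍ[ℝ]}
    (hG : G₁ = R * G₂) (hH : H₂ = H₁ * K) (hL : L₁ * K = R * L₂)
    (h1 : Rp G₁ * L₁ = 0) (h1' : L₁ * Lp H₁ = 0) (h2 : Rp G₂ * L₂ = 0) (h2' : L₂ * Lp H₂ = 0) :
    G₁ * (G₁† * L₁ * H₁† + Lp G₁ * G₂† * L₂ * H₂†) * H₁ = L₁ ∧
      G₂ * (G₁† * L₁ * H₁† + Lp G₁ * G₂† * L₂ * H₂†) * H₂ = L₂ := by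
  rw [Rp_mul_eq_zero_iff] at h1 h2
  rw [mul_Lp_eq_zero_iff] at h1' h2'
  constructor
  · simp only [Matrix.mul_assoc, Matrix.mul_add, mul_reassoc (mul_Lp G₁),
      Matrix.zero_mul, add_zero, h1', h1]
  -- Both `L₁ H₁† H₂` and `G₁ G₂† L₂` equal `R L₂`, so in the second equation the first summand
  -- cancels against the `G₁† G₁` part of `Lp G₁`.
  · have e1 : L₁ * (H₁† * H₂) = R * L₂ := by
      rw [hH, ← hL]
      nth_rewrite 2 [← h1']
      simp only [Matrix.mul_assoc]
    have e2 : G₁ * (G₂† * L₂) = R * L₂ := by rw [hG, Matrix.mul_assoc, h2]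
    simp only [Matrix.mul_assoc, Matrix.mul_add, Matrix.add_mul, e1, h2', Lp_mul_apply,
      Matrix.mul_sub, Matrix.sub_mul, e2, h2]
    abel

/-- The homogeneous nested pair. -/
theorem nested_pair_complete [DecidableEq q] {G₁ : Matrix m' p ℍ[ℝ]} {G₂ : Matrix m p ℍ[ℝ]}
    {H₁ : Matrix q n ℍ[ℝ]} {H₂ : Matrix q n' ℍ[ℝ]} {R : Matrix m' m ℍ[ℝ]} {K : Matrix n n' ℍ[ℝ]}
    (hG : G₁ = R * G₂) (hH : H₂ = H₁ * K) {U : Matrix p q ℍ[ℝ]}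
    (h1 : G₁ * U * H₁ = 0) (h2 : G₂ * U * H₂ = 0) :
    U = Lp G₂ * U + G₂† * G₂ * U * Rp H₁
      + Lp G₁ * (G₂† * G₂ * U * H₁ * H₁†) * Rp H₂ := by
  -- `U` always splits as `Lp G₂ U + G₂†G₂ U Rp H₁ + G₂†G₂ U H₁H₁†`. The two equations say that the
  -- last piece is killed by `G₁` on the left and by `H₂` on the right, so it absorbs `Lp G₁` and
  -- `Rp H₂`.
  have e1 : G₁ * (G₂† * (G₂ * (U * (H₁ * H₁†)))) = 0 := by
    rw [hG, Matrix.mul_assoc, mul_pinv_mul_assoc, ← Matrix.mul_assoc, ← hG,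
      ← Matrix.mul_assoc, ← Matrix.mul_assoc, h1, Matrix.zero_mul]
  have e2 : G₂ * (U * (H₁ * (H₁† * H₂))) = 0 := by
    rw [hH, mul_pinv_mul_assoc, ← hH, ← Matrix.mul_assoc, h2]
  have e3 : Lp G₁ * (G₂† * G₂ * U * H₁ * H₁†) * Rp H₂ = G₂† * (G₂ * (U * (H₁ * H₁†))) := by
    rw [Lp_mul_of_mul_eq_zero, mul_Rp_of_mul_eq_zero]
    · simp only [Matrix.mul_assoc]
    · simp only [Matrix.mul_assoc, e2, Matrix.mul_zero]
    · simpa only [Matrix.mul_assoc] using e1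
  rw [e3, Lp_mul_apply, mul_Rp_apply]
  simp only [Matrix.mul_assoc]
  abel

end Pair

/-! ### The two-term equation `A X B + C Y D = E`. -/

section TwoTerm

variable {m n p q k l : Type*} [Fintype m] [Fintype n] [Fintype p] [Fintype q]
  [Fintype k] [Fintype l] [DecidableEq m] [DecidableEq n] [DecidableEq p] [DecidableEq q]
  [DecidableEq k] [DecidableEq l]
  {A : Matrix m p ℍ[ℝ]} {B : Matrix q n ℍ[ℝ]} {C : Matrix m k ℍ[ℝ]} {D : Matrix l n ℍ[ℝ]}
  {E : Matrix m n ℍ[ℝ]} {M : Matrix m k ℍ[ℝ]} {N : Matrix l n ℍ[ℝ]} {S : Matrix m k ℍ[ℝ]}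

/-- Sufficiency for the equation `A X B + C Y D = E`. -/
theorem two_term_sound (hM : M = Rp A * C) (hN : N = D * Lp B) (hS : S = C * Lp M)
    (h1 : Rp M * (Rp A * E) = 0) (h2 : Rp A * E * Lp D = 0) (h3 : Rp C * E * Lp B = 0)
    (h4 : E * Lp B * Lp N = 0) (U4 : Matrix k l ℍ[ℝ]) (U5 U6 : Matrix p q ℍ[ℝ])
    (U7 U8 : Matrix k l ℍ[ℝ]) :
    A * (A† * E * B† - A† * C * M† * E * B† - A† * S * C† * E * N† * D * B†
      - A† * S * U4 * Rp N * D * B† + Lp A * U5 + U6 * Rp B) * B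
    + C * (M† * E * D† + S† * S * C† * E * N† + Lp M * Lp S * U7 + U8 * Rp D
      + Lp M * U4 * Rp N) * D = E := by
  -- `M` has the left factor `Rp A`, hence `M†` absorbs `Rp A` and kills `A`; dually for `N†` and
  -- `B`.
  have hMA : M† * A = 0 :=
    pinv_mul_eq_zero (by rw [hM, ← Matrix.mul_assoc, Rp_mul_Rp])
  have hBN : B * N† = 0 :=
    mul_pinv_eq_zero (by rw [hN, Matrix.mul_assoc, Lp_mul_Lp])
  have hSM : S * Lp M = S := by rw [hS, Matrix.mul_assoc, Lp_mul_Lp]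
  have hMS : M * S† = 0 := mul_pinv_eq_zero hSM
  have hAC : A * (A† * C) = C - M := by rw [hM, Rp_mul_apply]; abel
  have hAS : A * (A† * S) = S := by
    rw [← Rp_mul_eq_zero_iff, hS, ← Matrix.mul_assoc, ← hM, mul_Lp]
  have hDB : D * (B† * B) = D - N := by rw [hN, mul_Lp_apply]; abel
  -- `M S† = 0` makes `Lp M` act trivially on `S†`, so `C` and `S = C * Lp M` agree there.
  have hCS : C * (S† * S) = S := by
    have : S * (S† * S) = C * (S† * S) := by
      nth_rewrite 1 [hS]
      rw [Matrix.mul_assoc, ← Matrix.mul_assoc (Lp M), Lp_mul_apply, hMS, Matrix.mul_zero,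
        sub_zero]
    rw [← this, mul_pinv_mul]
  -- `c1` to `c4` are the four hypotheses without their outer projectors, `c2` after multiplication
  -- by `M†`; `c5` combines `c3` with `M† M = M† C`.
  have c1 : M * (M† * E) = E - A * (A† * E) := by
    rw [Rp_mul_eq_zero_iff, Rp_mul_apply, Matrix.mul_sub, ← Matrix.mul_assoc M†, hMA,
      Matrix.zero_mul, sub_zero] at h1
    exact h1
  have c2 : M† * (E * (D† * D)) = M† * E := by
    rw [mul_Lp_eq_zero_iff] at h2
    have := congrArg (M† * ·) h2
    simpa only [Rp_mul_apply, Matrix.sub_mul, Matrix.mul_sub, mul_reassoc hMA,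
      Matrix.mul_assoc, Matrix.zero_mul, sub_zero] using this
  have c3 : C * (C† * (E - E * (B† * B))) = E - E * (B† * B) := by
    rwa [Matrix.mul_assoc, Rp_mul_eq_zero_iff, mul_Lp_apply] at h3
  have c4 : E * (N† * N) = E - E * (B† * B) := by
    rw [mul_Lp_eq_zero_iff, mul_Lp_apply, Matrix.sub_mul] at h4
    simp only [Matrix.mul_assoc, mul_reassoc hBN, Matrix.zero_mul, Matrix.mul_zero, sub_zero] at h4
    exact h4
  have c5 : S * (C† * (E - E * (B† * B))) = E - E * (B† * B) - C * (M† * (E - E * (B† * B))) := by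
    have : M† * M = M† * C := by
      nth_rewrite 2 [hM]
      rw [Rp_mul_apply, Matrix.mul_sub, mul_reassoc hMA, Matrix.zero_mul, sub_zero]
    rw [hS, Matrix.mul_assoc, Lp_mul_apply, ← Matrix.mul_assoc M†, this, Matrix.mul_assoc, c3,
      Matrix.mul_sub, c3]
  have hCM : C * Lp M = S := hS.symm
  -- The correction terms of `A X B` reproduce terms of `C Y D`, up to terms in `E` that cancel in
  -- the end.
  have t3 : A * (A† * (S * (C† * (E * (N† * (D * (B† * B)))))))
      = S * (C† * (E * (N† * D))) - (E - E * (B† * B) - C * (M† * (E - E * (B† * B)))) := by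
    rw [hDB, ← Matrix.mul_assoc A†, mul_reassoc hAS, Matrix.mul_sub, Matrix.mul_sub, c4,
      Matrix.mul_sub, Matrix.mul_sub, c5]
  have t4 : A * (A† * (S * (U4 * (Rp N * (D * (B† * B)))))) = S * (U4 * (Rp N * D)) := by
    rw [hDB, ← Matrix.mul_assoc A†, mul_reassoc hAS, Matrix.mul_sub, Rp_mul, sub_zero]
  have t2 : A * (A† * (C * (M† * (E * (B† * B))))) =
      C * (M† * (E * (B† * B))) - (E - A * (A† * E)) * (B† * B) := by
    rw [← Matrix.mul_assoc A†, mul_reassoc hAC, Matrix.sub_mul, ← c1]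
    simp only [Matrix.mul_assoc]
  have s1 : S * Lp S = 0 := mul_Lp S
  simp only [Matrix.mul_assoc, Matrix.mul_add, Matrix.add_mul, Matrix.mul_sub, Matrix.sub_mul,
    mul_reassoc (mul_Lp A), Rp_mul, Matrix.zero_mul, Matrix.mul_zero, mul_reassoc hCM,
    mul_reassoc s1, t3, t4, t2, c2]
  rw [← Matrix.mul_assoc S† S, mul_reassoc hCS]
  abel

/-- Every solution of `A X B + C Y D = E` arises from a choice of parameters. -/
theorem two_term_complete (hM : M = Rp A * C) (hN : N = D * Lp B) (hS : S = C * Lp M)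
    {X : Matrix p q ℍ[ℝ]} {Y : Matrix k l ℍ[ℝ]} (h : A * X * B + C * Y * D = E) :
    ∃ (U4 : Matrix k l ℍ[ℝ]) (U5 U6 : Matrix p q ℍ[ℝ]) (U7 U8 : Matrix k l ℍ[ℝ]),
      X = A† * E * B† - A† * C * M† * E * B† - A† * S * C† * E * N† * D * B†
        - A† * S * U4 * Rp N * D * B† + Lp A * U5 + U6 * Rp B ∧
      Y = M† * E * D† + S† * S * C† * E * N† + Lp M * Lp S * U7 + U8 * Rp D
        + Lp M * U4 * Rp N := by
  have h1 : Rp M * (Rp A * E) = 0 := by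
    rw [← h]
    simp only [Matrix.mul_assoc, Matrix.mul_add, mul_reassoc (Rp_mul A), Matrix.zero_mul,
      zero_add, mul_reassoc hM.symm, mul_reassoc (Rp_mul M)]
  have h2 : Rp A * E * Lp D = 0 := by
    rw [← h]
    simp only [Matrix.mul_assoc, Matrix.mul_add, mul_reassoc (Rp_mul A),
      Matrix.zero_mul, Matrix.mul_zero, zero_add, mul_Lp]
  have h3 : Rp C * E * Lp B = 0 := by
    rw [← h]
    simp only [Matrix.mul_assoc, Matrix.mul_add, Matrix.add_mul, mul_reassoc (Rp_mul C),
      Matrix.zero_mul, Matrix.mul_zero, zero_add, mul_Lp]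
  have h4 : E * Lp B * Lp N = 0 := by
    rw [← h]
    simp only [Matrix.mul_assoc, Matrix.add_mul, Matrix.mul_zero, zero_add, mul_reassoc hN.symm, mul_Lp]
  have sound := two_term_sound hM hN hS h1 h2 h3 h4
  -- the difference of `Y` and the particular solution
  obtain ⟨Y', hY'⟩ : ∃ Y', Y' = Y - (M† * E * D† + S† * S * C† * E * N†) := ⟨_, rfl⟩
  have hp := sound 0 0 0 0 0
  simp only [Matrix.mul_zero, Matrix.zero_mul, add_zero, sub_zero] at hp
  obtain ⟨X₁, hX₁⟩ : ∃ X₁ : Matrix p q ℍ[ℝ], A * X₁ * B + C * Y' * D = 0 := by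
    refine ⟨X - (A† * E * B† - A† * C * M† * E * B† - A† * S * C† * E * N† * D * B†), ?_⟩
    rw [hY', Matrix.mul_sub A, Matrix.sub_mul _ _ B, Matrix.mul_sub C, Matrix.sub_mul _ _ D,
      sub_add_sub_comm, h, hp, sub_self]
  -- Multiplying the homogeneous equation by `Rp A` on the left, or by `Lp B` on the right,
  -- eliminates `X₁`, so `Y'` solves a homogeneous nested pair.
  have e1 : M * Y' * D = 0 := by
    have := congrArg (Rp A * ·) hX₁
    simpa only [hM, Matrix.mul_assoc, Matrix.mul_add, mul_reassoc (Rp_mul A), Matrix.zero_mul,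
      zero_add, Matrix.mul_zero] using this
  have e2 : C * Y' * N = 0 := by
    have := congrArg (· * Lp B) hX₁
    simpa only [hN, Matrix.mul_assoc, Matrix.add_mul, mul_Lp, Matrix.zero_mul,
      zero_add, Matrix.mul_zero] using this
  have e3 := nested_pair_complete hM hN e1 e2
  -- The nested pair yields a term in `Lp C`, whereas the formula has `Lp M * Lp S`. Since `M` and
  -- `S` kill `Lp C`, the factor `Lp C` absorbs both projectors.
  have e4 : Lp M * Lp S * Lp C = Lp C := by
    have e5 : Lp M * Lp C = Lp C :=
      Lp_mul_of_mul_eq_zero (by rw [hM, Matrix.mul_assoc, mul_Lp, Matrix.mul_zero])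
    rw [Matrix.mul_assoc, Lp_mul_of_mul_eq_zero (A := S), e5]
    rw [hS, Matrix.mul_assoc, e5, mul_Lp]
  have hY : Y = M† * E * D† + S† * S * C† * E * N† + Lp M * Lp S * (Lp C * Y')
      + C† * C * Y' * Rp D + Lp M * (C† * C * Y' * D * D†) * Rp N := by
    rw [← Matrix.mul_assoc, e4, add_assoc, add_assoc, ← add_assoc (Lp C * Y'), ← e3, hY']
    abel
  -- With these parameters and `U5 = U6 = 0` the formula gives another solution with the same `Y`.
  -- The two first components differ by a solution of `A · B = 0`, which the terms in `U5` and `U6`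
  -- absorb.
  have hs := sound (C† * C * Y' * D * D†) 0 0 (Lp C * Y') (C† * C * Y')
  simp only [Matrix.mul_zero, Matrix.zero_mul, add_zero] at hs
  rw [← hY, ← h, add_left_inj, ← sub_eq_zero, ← Matrix.sub_mul, ← Matrix.mul_sub, h,
    ← neg_eq_zero, ← Matrix.neg_mul, ← Matrix.mul_neg, neg_sub] at hs
  have hX := sub_eq_iff_eq_add'.1 (eq_of_mul_mul_eq_zero hs)
  exact ⟨_, _, _, _, _, hX.trans (add_assoc _ _ _).symm, hY⟩

end TwoTerm

end QuatMat

namespace QuatMat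

/-! ### Rank of quaternion matrices; rank equalities as solvability of linear equations. -/

section Rank

theorem mem_span_row_iff {m n : Type*} [Fintype m] {A : Matrix m n ℍ[ℝ]} {v : n → ℍ[ℝ]} :
    v ∈ Submodule.span ℍ[ℝ] (Set.range A.row) ↔ ∃ x, x ᵥ* A = v := by
  rw [← range_vecMulLinear]
  rfl

theorem span_row_mul_le {l m n : Type*} [Fintype l] [Fintype m] (X : Matrix l m ℍ[ℝ])
    (B : Matrix m n ℍ[ℝ]) :
    Submodule.span ℍ[ℝ] (Set.range (X * B).row) ≤ Submodule.span ℍ[ℝ] (Set.range B.row) := by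
  intro v hv
  rw [mem_span_row_iff] at hv ⊢
  obtain ⟨x, rfl⟩ := hv
  exact ⟨x ᵥ* X, Matrix.vecMul_vecMul _ _ _⟩

theorem rk_eq_of_mul_eq {l m n : Type*} [Fintype l] [Fintype m] {A : Matrix l n ℍ[ℝ]}
    {B : Matrix m n ℍ[ℝ]} {X : Matrix l m ℍ[ℝ]} {Y : Matrix m l ℍ[ℝ]}
    (hA : X * B = A) (hB : Y * A = B) : rk A = rk B := by
  have h : Submodule.span ℍ[ℝ] (Set.range A.row) = Submodule.span ℍ[ℝ] (Set.range B.row) :=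
    le_antisymm (hA ▸ span_row_mul_le X B) (hB ▸ span_row_mul_le Y A)
  rw [rk, rk, h]

theorem rk_submatrix {k l m n : Type*} (A : Matrix m n ℍ[ℝ]) (e : k ≃ m) (f : l ≃ n) :
    rk (A.submatrix e f) = rk A := by
  have h : Submodule.span ℍ[ℝ] (Set.range (A.submatrix e f).row)
      = (Submodule.span ℍ[ℝ] (Set.range A.row)).map
        (LinearEquiv.funCongrLeft ℍ[ℝ] ℍ[ℝ] f : (n → ℍ[ℝ]) →ₗ[ℍ[ℝ]] (l → ℍ[ℝ])) := by
    rw [Submodule.map_span, ← Set.range_comp, ← e.surjective.range_comp]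
    rfl
  rw [rk, h, LinearEquiv.finrank_map_eq, rk]

/-- The row space of `B` lies in that of `D ⊟ B`, so equal dimensions force equal spaces. The rows
of `D` are then combinations of rows of `B`, and `Lp B` kills these. -/
theorem rk_fromRows_eq_iff {l m n : Type*} [Fintype l] [Fintype m] [Fintype n] [DecidableEq n]
    [DecidableEq m] {D : Matrix l n ℍ[ℝ]} {B : Matrix m n ℍ[ℝ]} :
    rk (D ⊟ B) = rk B ↔ D * Lp B = 0 := by
  constructor
  · intro h
    have hle : Submodule.span ℍ[ℝ] (Set.range B.row)
        ≤ Submodule.span ℍ[ℝ] (Set.range (D ⊟ B).row) := by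
      refine Submodule.span_mono ?_
      rintro _ ⟨i, rfl⟩
      exact ⟨Sum.inr i, rfl⟩
    have heq := Submodule.eq_of_le_of_finrank_eq hle h.symm
    ext1 i j
    have hi : D i ∈ Submodule.span ℍ[ℝ] (Set.range B.row) := by
      rw [heq]
      exact Submodule.subset_span ⟨Sum.inl i, rfl⟩
    obtain ⟨x, hx⟩ := mem_span_row_iff.1 hi
    have : D i ᵥ* Lp B = 0 := by
      rw [← hx, Matrix.vecMul_vecMul, mul_Lp, Matrix.vecMul_zero]
    exact congrFun this j
  · intro h
    rw [mul_Lp_eq_zero_iff, ← Matrix.mul_assoc] at h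
    refine rk_eq_of_mul_eq (X := D * B† ⊟ 1) (Y := 0 │ 1) ?_ ?_
    · rw [Matrix.fromRows_mul, h, Matrix.one_mul]
    · rw [Matrix.fromCols_mul_fromRows, Matrix.zero_mul, Matrix.one_mul, zero_add]

theorem finrank_eq_map_add_inf_ker {K V W : Type*} [DivisionRing K] [AddCommGroup V] [Module K V]
    [AddCommGroup W] [Module K W] [FiniteDimensional K V] (f : V →ₗ[K] W) (S : Submodule K V) :
    Module.finrank K S
      = Module.finrank K (S.map f) + Module.finrank K (S ⊓ LinearMap.ker f : Submodule K V) := by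
  have h := LinearMap.finrank_range_add_finrank_ker (f.domRestrict S)
  have e := (Submodule.equivMapOfInjective S.subtype S.subtype_injective
    (LinearMap.ker (f.domRestrict S))).finrank_eq
  rw [LinearMap.ker_domRestrict, Submodule.map_comap_subtype] at e
  rw [← h, LinearMap.range_domRestrict, ← e, LinearMap.ker_domRestrict]

/-- Project the row space of `T │ E` to the columns of `E`: the image is the row space of `E`, and
the kernel consists of the vectors `(x T, 0)` with `x E = 0`. By `R + E Z = 1` such `x` satisfy `x =
x R`, so the kernel is the row space of `R T`. A general `R` instead of `Rp E` permits a block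
diagonal choice when `E` is itself a block column. -/
theorem rk_fromCols {m n₁ n₂ : Type*} [Fintype m] [Fintype n₁] [Fintype n₂] [DecidableEq m]
    (T : Matrix m n₁ ℍ[ℝ]) (E : Matrix m n₂ ℍ[ℝ]) {R : Matrix m m ℍ[ℝ]} {Z : Matrix n₂ m ℍ[ℝ]}
    (hR : R * E = 0) (hZ : R + E * Z = 1) : rk (T │ E) = rk E + rk (R * T) := by
  have h := finrank_eq_map_add_inf_ker (LinearMap.funLeft ℍ[ℝ] ℍ[ℝ] (Sum.inr : n₂ → n₁ ⊕ n₂))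
    (Submodule.span ℍ[ℝ] (Set.range (T │ E).row))
  have h1 : (Submodule.span ℍ[ℝ] (Set.range (T │ E).row)).map
      (LinearMap.funLeft ℍ[ℝ] ℍ[ℝ] (Sum.inr : n₂ → n₁ ⊕ n₂))
      = Submodule.span ℍ[ℝ] (Set.range E.row) := by
    rw [Submodule.map_span, ← Set.range_comp]
    rfl
  obtain ⟨g, hg⟩ : ∃ g : (n₁ → ℍ[ℝ]) →ₗ[ℍ[ℝ]] (n₁ ⊕ n₂ → ℍ[ℝ]), ∀ v, g v = Sum.elim v 0 :=
    ⟨{ toFun := fun v => Sum.elim v 0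
       map_add' := fun v w => by ext (i | i) <;> simp
       map_smul' := fun c v => by ext (i | i) <;> simp }, fun _ => rfl⟩
  have hinj : Function.Injective g := by
    intro v w hvw
    ext1 i
    simpa [hg] using congrFun hvw (Sum.inl i)
  have h2 : Submodule.span ℍ[ℝ] (Set.range (T │ E).row)
      ⊓ LinearMap.ker (LinearMap.funLeft ℍ[ℝ] ℍ[ℝ] (Sum.inr : n₂ → n₁ ⊕ n₂))
      = (Submodule.span ℍ[ℝ] (Set.range (R * T).row)).map g := by
    ext v
    rw [Submodule.mem_inf, Submodule.mem_map, mem_span_row_iff, LinearMap.mem_ker]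
    constructor
    · rintro ⟨⟨x, rfl⟩, hx⟩
      rw [Matrix.vecMul_fromCols] at hx ⊢
      have hx' : x ᵥ* E = 0 := hx
      have hxR : x ᵥ* R = x := by
        calc x ᵥ* R = x ᵥ* (R + E * Z) := by
              rw [Matrix.vecMul_add, ← Matrix.vecMul_vecMul, hx', Matrix.zero_vecMul, add_zero]
          _ = x := by rw [hZ, Matrix.vecMul_one]
      refine ⟨x ᵥ* T, mem_span_row_iff.2 ⟨x, ?_⟩, ?_⟩
      · rw [← Matrix.vecMul_vecMul, hxR]
      · rw [hg, hx']
    · rintro ⟨w, hw, rfl⟩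
      obtain ⟨x, rfl⟩ := mem_span_row_iff.1 hw
      refine ⟨⟨x ᵥ* R, ?_⟩, ?_⟩
      · rw [Matrix.vecMul_fromCols, Matrix.vecMul_vecMul, Matrix.vecMul_vecMul, hR,
          Matrix.vecMul_zero, hg]
      · rw [hg]
        rfl
  rw [h1, h2, ← (Submodule.equivMapOfInjective g hinj _).finrank_eq] at h
  exact h

theorem rk_eq_zero_iff {m n : Type*} [Finite n] {A : Matrix m n ℍ[ℝ]} : rk A = 0 ↔ A = 0 := by
  rw [rk, Submodule.finrank_eq_zero, Submodule.span_eq_bot]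
  constructor
  · intro h
    ext1 i j
    exact congrFun (h _ ⟨i, rfl⟩) j
  · rintro rfl _ ⟨i, rfl⟩
    rfl

theorem Rp_add_mul_pinv {m n : Type*} [Fintype m] [Fintype n] [DecidableEq m]
    (A : Matrix m n ℍ[ℝ]) : Rp A + A * A† = 1 := by
  rw [Rp, sub_add_cancel]

theorem rk_fromCols_eq_iff {m n₁ n₂ : Type*} [Fintype m] [Fintype n₁] [Fintype n₂] [DecidableEq m]
    {T : Matrix m n₁ ℍ[ℝ]} {E : Matrix m n₂ ℍ[ℝ]} : rk (T │ E) = rk E ↔ Rp E * T = 0 := by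
  rw [rk_fromCols T E (Rp_mul E) (Rp_add_mul_pinv E), Nat.add_eq_left, rk_eq_zero_iff]

/-- Splitting off the columns `E ⊟ 0` leaves `(Rp E * T) ⊟ F`, whose rank is `rk F` exactly when its
upper rows lie in the row space of `F`. -/
theorem rk_fromBlocks_zero_eq_iff {m₁ m₂ n₁ n₂ : Type*} [Fintype m₁] [Fintype m₂] [Fintype n₁]
    [Fintype n₂] [DecidableEq m₁] [DecidableEq m₂] [DecidableEq n₁]
    {T : Matrix m₁ n₁ ℍ[ℝ]} {E : Matrix m₁ n₂ ℍ[ℝ]} {F : Matrix m₂ n₁ ℍ[ℝ]} :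
    rk (T │ E ⊟ F │ 0) = rk E + rk F ↔ Rp E * T * Lp F = 0 := by
  have h0 : (T │ E ⊟ F │ 0) = (T ⊟ F) │ (E ⊟ 0) := by
    rw [Matrix.fromRows_fromCols_eq_fromBlocks, Matrix.fromCols_fromRows_eq_fromBlocks]
  have h1 : rk (E ⊟ (0 : Matrix m₂ n₂ ℍ[ℝ])) = rk E :=
    rk_eq_of_mul_eq (X := (1 : Matrix m₁ m₁ ℍ[ℝ]) ⊟ 0) (Y := (1 : Matrix m₁ m₁ ℍ[ℝ]) │ 0)
      (by rw [Matrix.fromRows_mul, Matrix.one_mul, Matrix.zero_mul])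
      (by rw [Matrix.fromCols_mul_fromRows, Matrix.one_mul, Matrix.zero_mul, add_zero])
  rw [h0, rk_fromCols (R := Matrix.fromBlocks (Rp E) 0 0 1) (Z := E† │ 0) (T ⊟ F), h1,
    Matrix.fromBlocks_mul_fromRows, Nat.add_left_cancel_iff]
  · simp only [Matrix.zero_mul, add_zero, Matrix.one_mul, zero_add]
    exact rk_fromRows_eq_iff
  · rw [Matrix.fromBlocks_mul_fromRows, Rp_mul]
    simp
  · rw [Matrix.fromRows_mul_fromCols, Matrix.fromBlocks_add, Rp_add_mul_pinv]
    simp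

theorem Rp_mul_mul_Lp_eq_zero_iff {m n p q : Type*} [Fintype m] [Fintype n] [Fintype p] [Fintype q]
    [DecidableEq m] [DecidableEq n] {T : Matrix m n ℍ[ℝ]} {E : Matrix m p ℍ[ℝ]}
    {F : Matrix q n ℍ[ℝ]} :
    Rp E * T * Lp F = 0 ↔ ∃ (P : Matrix p n ℍ[ℝ]) (Q : Matrix m q ℍ[ℝ]), T = E * P + Q * F := by
  constructor
  · intro h
    rw [mul_Lp_eq_zero_iff] at h
    refine ⟨E† * T, Rp E * T * F†, ?_⟩
    rw [Matrix.mul_assoc _ F† F, h, Rp_mul_apply]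
    abel
  · rintro ⟨P, Q, rfl⟩
    rw [Matrix.mul_add, ← Matrix.mul_assoc, Rp_mul, Matrix.zero_mul, zero_add, Matrix.mul_assoc,
      Matrix.mul_assoc, mul_Lp, Matrix.mul_zero, Matrix.mul_zero]

/-- The rank equality of a bordered matrix as the solvability of a system of linear equations. -/
theorem rk_bordered_eq_iff {s t a b p q : Type*} [Fintype s] [Fintype t] [Fintype a] [Fintype b]
    [Fintype p] [Fintype q] [DecidableEq s] [DecidableEq t] [DecidableEq a] [DecidableEq b]
    [DecidableEq p] [DecidableEq q]
    {c : Matrix s t ℍ[ℝ]} {g : Matrix s b ℍ[ℝ]} {h : Matrix a t ℍ[ℝ]} {e : Matrix s p ℍ[ℝ]}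
    {A : Matrix a p ℍ[ℝ]} {f : Matrix q t ℍ[ℝ]} {B : Matrix q b ℍ[ℝ]}
    (hh : Rp A * h = 0) (hg : g * Lp B = 0) :
    rk ((c │ g ⊟ h │ 0) │ (e ⊟ A) ⊟ (f │ B) │ 0) = rk (e ⊟ A) + rk (f │ B) ↔
      ∃ (P : Matrix p t ℍ[ℝ]) (Q : Matrix s q ℍ[ℝ]), A * P = h ∧ Q * B = g ∧ c = e * P + Q * f := by
  rw [rk_fromBlocks_zero_eq_iff, Rp_mul_mul_Lp_eq_zero_iff]
  constructor
  · rintro ⟨P, Q, hPQ⟩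
    obtain ⟨P₁, P₂, rfl⟩ : ∃ P₁ P₂, P = P₁ │ P₂ := ⟨_, _, (Matrix.fromCols_toCols P).symm⟩
    obtain ⟨Q₁, Q₂, rfl⟩ : ∃ Q₁ Q₂, Q = Q₁ ⊟ Q₂ := ⟨_, _, (Matrix.fromRows_toRows Q).symm⟩
    rw [Matrix.fromRows_mul_fromCols, Matrix.fromRows_mul_fromCols, Matrix.fromBlocks_add,
      Matrix.fromRows_fromCols_eq_fromBlocks, Matrix.fromBlocks_inj] at hPQ
    obtain ⟨h1, h2, h3, h4⟩ := hPQ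
    rw [Rp_mul_eq_zero_iff] at hh
    rw [mul_Lp_eq_zero_iff] at hg
    have e1 : Q₂ * f = h - A * P₁ := by rw [h3]; abel
    have e2 : Q₁ * B = g - e * P₂ := by rw [h2]; abel
    have e3 : Q₂ * B = - (A * P₂) := eq_neg_of_add_eq_zero_right h4.symm
    -- `e Lp A P₂` differs from `g` by a left multiple of `B`, and `g` absorbs `B† B` by `hg`.
    have e4 : e * (Lp A * (P₂ * (B† * B))) = e * (Lp A * P₂) := by
      have : e * (Lp A * P₂) = g - (Q₁ - e * (A† * Q₂)) * B := by
        rw [Matrix.sub_mul, e2, Matrix.mul_assoc, Matrix.mul_assoc, e3, Matrix.mul_neg,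
          Lp_mul_apply, Matrix.mul_sub, Matrix.mul_neg]
        abel
      calc e * (Lp A * (P₂ * (B† * B))) = (e * (Lp A * P₂)) * (B† * B) := by
            simp only [Matrix.mul_assoc]
        _ = e * (Lp A * P₂) := by
            rw [this, Matrix.sub_mul, hg, Matrix.mul_assoc _ B, mul_pinv_mul]
    -- The term in `A†` corrects `A P` to `h`. The term in `Lp A` does not affect `A P` and corrects
    -- `Q B` to `g`. Each correction occurs with opposite signs in `e P` and `Q f`, so `c` is
    -- unchanged.
    refine ⟨P₁ + A† * (Q₂ * f) - Lp A * (P₂ * (B† * f)),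
      Q₁ - e * (A† * Q₂) + e * (Lp A * (P₂ * B†)), ?_, ?_, ?_⟩
    · rw [Matrix.mul_sub, Matrix.mul_add, mul_reassoc (mul_Lp A), Matrix.zero_mul, e1,
        Matrix.mul_sub, Matrix.mul_sub, hh, mul_pinv_mul_assoc]
      abel
    · simp only [Matrix.add_mul, Matrix.sub_mul, Matrix.mul_assoc, e2, e3, e4]
      rw [Lp_mul_apply, Matrix.mul_sub, Matrix.mul_neg, Matrix.mul_neg]
      abel
    · rw [h1]
      simp only [Matrix.add_mul, Matrix.sub_mul, Matrix.mul_assoc, Matrix.mul_add, Matrix.mul_sub]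
      abel
  · rintro ⟨P, Q, rfl, rfl, rfl⟩
    refine ⟨P │ 0, Q ⊟ 0, ?_⟩
    rw [Matrix.fromRows_mul_fromCols, Matrix.fromRows_mul_fromCols, Matrix.fromBlocks_add,
      Matrix.fromRows_fromCols_eq_fromBlocks]
    simp

end Rank

/-! ### Permutations of block indices that bring the partitioned matrices to bordered form. -/

section Blocks

variable {α β γ δ : Type*}

/-- The permutation `(s, q, a, b) ↦ ((s, a, b), q)` of the blocks. -/
def blockEquivOne : α ⊕ β ⊕ γ ⊕ δ ≃ (α ⊕ γ ⊕ δ) ⊕ β where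
  toFun
    | .inl x => .inl (.inl x)
    | .inr (.inl x) => .inr x
    | .inr (.inr x) => .inl (.inr x)
  invFun
    | .inl (.inl x) => .inl x
    | .inr x => .inr (.inl x)
    | .inl (.inr x) => .inr (.inr x)
  left_inv := by rintro (_ | _ | _) <;> rfl
  right_inv := by rintro ((_ | _) | _) <;> rfl

/-- The permutation `(s, q, q', a) ↦ ((s, a), (q, q'))` of the blocks. -/
def blockEquivTwo : α ⊕ β ⊕ γ ⊕ δ ≃ (α ⊕ δ) ⊕ (β ⊕ γ) where
  toFun
    | .inl x => .inl (.inl x)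
    | .inr (.inl x) => .inr (.inl x)
    | .inr (.inr (.inl x)) => .inr (.inr x)
    | .inr (.inr (.inr x)) => .inl (.inr x)
  invFun
    | .inl (.inl x) => .inl x
    | .inr (.inl x) => .inr (.inl x)
    | .inr (.inr x) => .inr (.inr (.inl x))
    | .inl (.inr x) => .inr (.inr (.inr x))
  left_inv := by rintro (_ | _ | _ | _) <;> rfl
  right_inv := by rintro ((_ | _) | _ | _) <;> rfl

/-- The permutation `(s, s', q, q', q'', a) ↦ (((s, s'), a), (q, q', q''))` of the blocks. -/
def blockEquivThree {ε ζ : Type*} : α ⊕ β ⊕ γ ⊕ δ ⊕ ε ⊕ ζ ≃ ((α ⊕ β) ⊕ ζ) ⊕ (γ ⊕ δ ⊕ ε) where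
  toFun
    | .inl x => .inl (.inl (.inl x))
    | .inr (.inl x) => .inl (.inl (.inr x))
    | .inr (.inr (.inl x)) => .inr (.inl x)
    | .inr (.inr (.inr (.inl x))) => .inr (.inr (.inl x))
    | .inr (.inr (.inr (.inr (.inl x)))) => .inr (.inr (.inr x))
    | .inr (.inr (.inr (.inr (.inr x)))) => .inl (.inr x)
  invFun
    | .inl (.inl (.inl x)) => .inl x
    | .inl (.inl (.inr x)) => .inr (.inl x)
    | .inr (.inl x) => .inr (.inr (.inl x))
    | .inr (.inr (.inl x)) => .inr (.inr (.inr (.inl x)))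
    | .inr (.inr (.inr x)) => .inr (.inr (.inr (.inr (.inl x))))
    | .inl (.inr x) => .inr (.inr (.inr (.inr (.inr x))))
  left_inv := by rintro (_ | _ | _ | _ | _ | _) <;> rfl
  right_inv := by rintro (((_ | _) | _) | _ | _ | _) <;> rfl

end Blocks

end QuatMat

namespace QuatMat

/-! ### The block rank conditions of the theorem as linear equations. -/

section BlockRank

theorem fromCols_add_fromCols {m n₁ n₂ : Type*} (A C : Matrix m n₁ ℍ[ℝ]) (B D : Matrix m n₂ ℍ[ℝ]) :
    (A │ B) + (C │ D) = (A + C) │ (B + D) := by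
  ext i (j | j) <;> rfl

theorem fromRows_add_fromRows {m₁ m₂ n : Type*} (A C : Matrix m₁ n ℍ[ℝ]) (B D : Matrix m₂ n ℍ[ℝ]) :
    (A ⊟ B) + (C ⊟ D) = (A + C) ⊟ (B + D) := by
  ext (i | i) j <;> rfl

theorem Rp_mul_eq_zero_iff_exists {m n p : Type*} [Fintype m] [Fintype p] [DecidableEq m]
    {A : Matrix m p ℍ[ℝ]} {h : Matrix m n ℍ[ℝ]} :
    Rp A * h = 0 ↔ ∃ P : Matrix p n ℍ[ℝ], A * P = h := by
  constructor
  · exact fun hh => ⟨_, Rp_mul_eq_zero_iff.1 hh⟩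
  · rintro ⟨P, rfl⟩
    rw [← Matrix.mul_assoc, Rp_mul, Matrix.zero_mul]

theorem mul_Lp_eq_zero_iff_exists {m n q : Type*} [Fintype n] [Fintype q] [DecidableEq n]
    {B : Matrix q n ℍ[ℝ]} {g : Matrix m n ℍ[ℝ]} :
    g * Lp B = 0 ↔ ∃ Q : Matrix m q ℍ[ℝ], Q * B = g := by
  constructor
  · intro hg
    rw [mul_Lp_eq_zero_iff, ← Matrix.mul_assoc] at hg
    exact ⟨_, hg⟩
  · rintro ⟨Q, rfl⟩
    rw [Matrix.mul_assoc, mul_Lp, Matrix.mul_zero]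

variable {s t : Type*} [Fintype s] [Fintype t]
  {a₁ a₂ a₃ p₁ p₂ p₃ q₁ q₂ q₃ b₁ b₂ b₃ : Type*} [Fintype a₁] [Fintype a₂] [Fintype a₃]
  [Fintype p₁] [Fintype p₂] [Fintype p₃] [Fintype q₁] [Fintype q₂] [Fintype q₃]
  [Fintype b₁] [Fintype b₂] [Fintype b₃]
  {C : Matrix s t ℍ[ℝ]}
  {E₁ : Matrix s p₁ ℍ[ℝ]} {A₁ : Matrix a₁ p₁ ℍ[ℝ]} {h₁ : Matrix a₁ t ℍ[ℝ]}
  {E₂ : Matrix s p₂ ℍ[ℝ]} {A₂ : Matrix a₂ p₂ ℍ[ℝ]} {h₂ : Matrix a₂ t ℍ[ℝ]}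
  {E₃ : Matrix s p₃ ℍ[ℝ]} {A₃ : Matrix a₃ p₃ ℍ[ℝ]} {h₃ : Matrix a₃ t ℍ[ℝ]}
  {F₁ : Matrix q₁ t ℍ[ℝ]} {B₁ : Matrix q₁ b₁ ℍ[ℝ]} {g₁ : Matrix s b₁ ℍ[ℝ]}
  {F₂ : Matrix q₂ t ℍ[ℝ]} {B₂ : Matrix q₂ b₂ ℍ[ℝ]} {g₂ : Matrix s b₂ ℍ[ℝ]}
  {F₃ : Matrix q₃ t ℍ[ℝ]} {B₃ : Matrix q₃ b₃ ℍ[ℝ]} {g₃ : Matrix s b₃ ℍ[ℝ]}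

theorem rk_three_cols_eq_iff :
    rk (C │ E₁ │ E₂ │ E₃ ⊟ h₁ │ A₁ │ 0 │ 0 ⊟ h₂ │ 0 │ A₂ │ 0 ⊟ h₃ │ 0 │ 0 │ A₃)
      = rk (E₁ │ E₂ │ E₃ ⊟ A₁ │ 0 │ 0 ⊟ 0 │ A₂ │ 0 ⊟ 0 │ 0 │ A₃) ↔
    ∃ (P₁ : Matrix p₁ t ℍ[ℝ]) (P₂ : Matrix p₂ t ℍ[ℝ]) (P₃ : Matrix p₃ t ℍ[ℝ]),
      A₁ * P₁ = h₁ ∧ A₂ * P₂ = h₂ ∧ A₃ * P₃ = h₃ ∧ C = E₁ * P₁ + E₂ * P₂ + E₃ * P₃ := by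
  classical
  have h0 : (C │ E₁ │ E₂ │ E₃ ⊟ h₁ │ A₁ │ 0 │ 0 ⊟ h₂ │ 0 │ A₂ │ 0 ⊟ h₃ │ 0 │ 0 │ A₃)
      = (C ⊟ h₁ ⊟ h₂ ⊟ h₃) │ (E₁ │ E₂ │ E₃ ⊟ A₁ │ 0 │ 0 ⊟ 0 │ A₂ │ 0 ⊟ 0 │ 0 │ A₃) := by
    ext (i | i | i | i) (j | j) <;> rfl
  rw [h0, rk_fromCols_eq_iff, Rp_mul_eq_zero_iff_exists]
  constructor
  · rintro ⟨P, hP⟩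
    obtain ⟨P₁, P', rfl⟩ : ∃ P₁ P', P = P₁ ⊟ P' := ⟨_, _, (Matrix.fromRows_toRows P).symm⟩
    obtain ⟨P₂, P₃, rfl⟩ : ∃ P₂ P₃, P' = P₂ ⊟ P₃ := ⟨_, _, (Matrix.fromRows_toRows P').symm⟩
    simp only [Matrix.fromRows_mul, Matrix.fromCols_mul_fromRows, Matrix.zero_mul, zero_add,
      add_zero, Matrix.fromRows_ext_iff] at hP
    exact ⟨P₁, P₂, P₃, hP.2.1, hP.2.2.1, hP.2.2.2, by rw [← hP.1, add_assoc]⟩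
  · rintro ⟨P₁, P₂, P₃, rfl, rfl, rfl, rfl⟩
    refine ⟨P₁ ⊟ P₂ ⊟ P₃, ?_⟩
    simp only [Matrix.fromRows_mul, Matrix.fromCols_mul_fromRows, Matrix.zero_mul, zero_add,
      add_zero, add_assoc]

theorem rk_three_rows_eq_iff :
    rk (C │ g₁ │ g₂ │ g₃ ⊟ F₁ │ B₁ │ 0 │ 0 ⊟ F₂ │ 0 │ B₂ │ 0 ⊟ F₃ │ 0 │ 0 │ B₃)
      = rk (F₁ │ B₁ │ 0 │ 0 ⊟ F₂ │ 0 │ B₂ │ 0 ⊟ F₃ │ 0 │ 0 │ B₃) ↔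
    ∃ (Q₁ : Matrix s q₁ ℍ[ℝ]) (Q₂ : Matrix s q₂ ℍ[ℝ]) (Q₃ : Matrix s q₃ ℍ[ℝ]),
      Q₁ * B₁ = g₁ ∧ Q₂ * B₂ = g₂ ∧ Q₃ * B₃ = g₃ ∧ C = Q₁ * F₁ + Q₂ * F₂ + Q₃ * F₃ := by
  classical
  rw [rk_fromRows_eq_iff, mul_Lp_eq_zero_iff_exists]
  constructor
  · rintro ⟨Q, hQ⟩
    obtain ⟨Q₁, Q', rfl⟩ : ∃ Q₁ Q', Q = Q₁ │ Q' := ⟨_, _, (Matrix.fromCols_toCols Q).symm⟩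
    obtain ⟨Q₂, Q₃, rfl⟩ : ∃ Q₂ Q₃, Q' = Q₂ │ Q₃ := ⟨_, _, (Matrix.fromCols_toCols Q').symm⟩
    simp only [Matrix.mul_fromCols, Matrix.fromCols_mul_fromRows, Matrix.mul_zero, zero_add,
      add_zero, fromCols_add_fromCols, Matrix.fromCols_ext_iff] at hQ
    exact ⟨Q₁, Q₂, Q₃, hQ.2.1, hQ.2.2.1, hQ.2.2.2, by rw [← hQ.1, add_assoc]⟩
  · rintro ⟨Q₁, Q₂, Q₃, rfl, rfl, rfl, rfl⟩
    refine ⟨Q₁ │ Q₂ │ Q₃, ?_⟩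
    simp only [Matrix.mul_fromCols, Matrix.fromCols_mul_fromRows, Matrix.mul_zero, zero_add,
      add_zero, fromCols_add_fromCols, add_assoc]

/-- The separate solvability hypotheses are those that `rk_bordered_eq_iff` needs for the border; in
the applications a solution of the one-sided equations provides them. -/
theorem rk_two_cols_one_row_eq_iff (hh₁ : ∃ P : Matrix p₁ t ℍ[ℝ], A₁ * P = h₁) (hh₂ : ∃ P : Matrix p₂ t ℍ[ℝ], A₂ * P = h₂)
    (hg : ∃ Q : Matrix s q₃ ℍ[ℝ], Q * B₃ = g₃) :
    rk (C │ E₁ │ E₂ │ g₃ ⊟ F₃ │ 0 │ 0 │ B₃ ⊟ h₁ │ A₁ │ 0 │ 0 ⊟ h₂ │ 0 │ A₂ │ 0)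
      = rk (E₁ │ E₂ ⊟ A₁ │ 0 ⊟ 0 │ A₂) + rk (F₃ │ B₃) ↔
    ∃ (P₁ : Matrix p₁ t ℍ[ℝ]) (P₂ : Matrix p₂ t ℍ[ℝ]) (Q₃ : Matrix s q₃ ℍ[ℝ]),
      A₁ * P₁ = h₁ ∧ A₂ * P₂ = h₂ ∧ Q₃ * B₃ = g₃ ∧ C = E₁ * P₁ + E₂ * P₂ + Q₃ * F₃ := by
  classical
  have h0 : (C │ E₁ │ E₂ │ g₃ ⊟ F₃ │ 0 │ 0 │ B₃ ⊟ h₁ │ A₁ │ 0 │ 0 ⊟ h₂ │ 0 │ A₂ │ 0)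
      = ((C │ g₃ ⊟ (h₁ ⊟ h₂) │ 0) │ ((E₁ │ E₂) ⊟ (A₁ │ 0 ⊟ 0 │ A₂)) ⊟ (F₃ │ B₃) │ 0).submatrix
        blockEquivOne blockEquivTwo := by
    ext (i | i | i | i) (j | j | j | j) <;> rfl
  have hh : Rp (A₁ │ 0 ⊟ 0 │ A₂) * (h₁ ⊟ h₂) = 0 := by
    obtain ⟨P₁, rfl⟩ := hh₁
    obtain ⟨P₂, rfl⟩ := hh₂
    refine Rp_mul_eq_zero_iff_exists.2 ⟨P₁ ⊟ P₂, ?_⟩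
    simp only [Matrix.fromRows_mul, Matrix.fromCols_mul_fromRows, Matrix.zero_mul, zero_add,
      add_zero]
  rw [h0, rk_submatrix, rk_bordered_eq_iff hh (mul_Lp_eq_zero_iff_exists.2 hg)]
  constructor
  · rintro ⟨P, Q, hP, hQ, hC⟩
    obtain ⟨P₁, P₂, rfl⟩ : ∃ P₁ P₂, P = P₁ ⊟ P₂ := ⟨_, _, (Matrix.fromRows_toRows P).symm⟩
    simp only [Matrix.fromRows_mul, Matrix.fromCols_mul_fromRows, Matrix.zero_mul, zero_add,
      add_zero, Matrix.fromRows_ext_iff] at hP hC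
    exact ⟨P₁, P₂, Q, hP.1, hP.2, hQ, hC⟩
  · rintro ⟨P₁, P₂, Q, rfl, rfl, rfl, rfl⟩
    refine ⟨P₁ ⊟ P₂, Q, ?_, rfl, ?_⟩ <;>
    simp only [Matrix.fromRows_mul, Matrix.fromCols_mul_fromRows, Matrix.zero_mul, zero_add,
      add_zero]

theorem rk_one_col_two_rows_eq_iff (hh : ∃ P : Matrix p₃ t ℍ[ℝ], A₃ * P = h₃) (hg₁ : ∃ Q : Matrix s q₁ ℍ[ℝ], Q * B₁ = g₁)
    (hg₂ : ∃ Q : Matrix s q₂ ℍ[ℝ], Q * B₂ = g₂) :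
    rk (C │ E₃ │ g₁ │ g₂ ⊟ F₁ │ 0 │ B₁ │ 0 ⊟ F₂ │ 0 │ 0 │ B₂ ⊟ h₃ │ A₃ │ 0 │ 0)
      = rk (F₁ │ B₁ │ 0 ⊟ F₂ │ 0 │ B₂) + rk (E₃ ⊟ A₃) ↔
    ∃ (Q₁ : Matrix s q₁ ℍ[ℝ]) (Q₂ : Matrix s q₂ ℍ[ℝ]) (P₃ : Matrix p₃ t ℍ[ℝ]),
      Q₁ * B₁ = g₁ ∧ Q₂ * B₂ = g₂ ∧ A₃ * P₃ = h₃ ∧ C = Q₁ * F₁ + Q₂ * F₂ + E₃ * P₃ := by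
  classical
  have h0 : (C │ E₃ │ g₁ │ g₂ ⊟ F₁ │ 0 │ B₁ │ 0 ⊟ F₂ │ 0 │ 0 │ B₂ ⊟ h₃ │ A₃ │ 0 │ 0)
      = ((C │ (g₁ │ g₂) ⊟ h₃ │ 0) │ (E₃ ⊟ A₃)
          ⊟ ((F₁ ⊟ F₂) │ (B₁ │ 0 ⊟ 0 │ B₂)) │ 0).submatrix blockEquivTwo blockEquivOne := by
    ext (i | i | i | i) (j | j | j | j) <;> rfl
  have h0' : (F₁ │ B₁ │ 0 ⊟ F₂ │ 0 │ B₂) = (F₁ ⊟ F₂) │ (B₁ │ 0 ⊟ 0 │ B₂) := by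
    ext (i | i) (j | j | j) <;> rfl
  have hg : (g₁ │ g₂) * Lp (B₁ │ 0 ⊟ 0 │ B₂) = 0 := by
    obtain ⟨Q₁, rfl⟩ := hg₁
    obtain ⟨Q₂, rfl⟩ := hg₂
    refine mul_Lp_eq_zero_iff_exists.2 ⟨Q₁ │ Q₂, ?_⟩
    simp only [Matrix.mul_fromCols, Matrix.fromCols_mul_fromRows, Matrix.mul_zero, zero_add,
      add_zero, fromCols_add_fromCols]
  rw [h0, h0', rk_submatrix, add_comm, rk_bordered_eq_iff (Rp_mul_eq_zero_iff_exists.2 hh) hg]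
  constructor
  · rintro ⟨P, Q, hP, hQ, hC⟩
    obtain ⟨Q₁, Q₂, rfl⟩ : ∃ Q₁ Q₂, Q = Q₁ │ Q₂ := ⟨_, _, (Matrix.fromCols_toCols Q).symm⟩
    simp only [Matrix.mul_fromCols, Matrix.fromCols_mul_fromRows, Matrix.mul_zero, zero_add,
      add_zero, fromCols_add_fromCols, Matrix.fromCols_ext_iff] at hQ hC
    exact ⟨Q₁, Q₂, P, hQ.1, hQ.2, hP, by rw [hC, add_comm]⟩
  · rintro ⟨Q₁, Q₂, P, rfl, rfl, rfl, rfl⟩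
    refine ⟨P, Q₁ │ Q₂, rfl, ?_, ?_⟩ <;>
    simp only [Matrix.mul_fromCols, Matrix.fromCols_mul_fromRows, Matrix.mul_zero, zero_add,
      add_zero, fromCols_add_fromCols]
    rw [add_comm]

/-- The unknowns are the blocks of a 3 × 2 matrix `P` and of a 2 × 3 matrix `Q`, and the last four
equations are the blocks of `diag(C, -C)`. Since `E₃` occurs in both block rows and `F₃` in both
block columns, `P₃`, `P₃'`, `Q₃`, `Q₃'` are each shared by two equations; this is the coupling. -/
theorem rk_coupled_eq_iff (hh₁ : ∃ P : Matrix p₁ t ℍ[ℝ], A₁ * P = h₁) (hh₂ : ∃ P : Matrix p₂ t ℍ[ℝ], A₂ * P = h₂)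
    (hh₃ : ∃ P : Matrix p₃ t ℍ[ℝ], A₃ * P = h₃) (hg₁ : ∃ Q : Matrix s q₁ ℍ[ℝ], Q * B₁ = g₁) (hg₂ : ∃ Q : Matrix s q₂ ℍ[ℝ], Q * B₂ = g₂)
    (hg₃ : ∃ Q : Matrix s q₃ ℍ[ℝ], Q * B₃ = g₃) :
    rk (C │ 0 │ E₁ │ 0 │ E₃ │ g₂ │ 0 │ g₃ ⊟
        0 │ -C │ 0 │ E₂ │ E₃ │ 0 │ -g₁ │ 0 ⊟
        F₂ │ 0 │ 0 │ 0 │ 0 │ B₂ │ 0 │ 0 ⊟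
        0 │ F₁ │ 0 │ 0 │ 0 │ 0 │ B₁ │ 0 ⊟
        F₃ │ F₃ │ 0 │ 0 │ 0 │ 0 │ 0 │ B₃ ⊟
        h₁ │ 0 │ A₁ │ 0 │ 0 │ 0 │ 0 │ 0 ⊟
        0 │ -h₂ │ 0 │ A₂ │ 0 │ 0 │ 0 │ 0 ⊟
        0 │ -h₃ │ 0 │ 0 │ A₃ │ 0 │ 0 │ 0)
      = rk (F₂ │ 0 │ B₂ │ 0 │ 0 ⊟ 0 │ F₁ │ 0 │ B₁ │ 0 ⊟ F₃ │ F₃ │ 0 │ 0 │ B₃)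
      + rk (E₁ │ 0 │ E₃ ⊟ 0 │ E₂ │ E₃ ⊟ A₁ │ 0 │ 0 ⊟ 0 │ A₂ │ 0 ⊟ 0 │ 0 │ A₃) ↔
    ∃ (P₁ P₁' : Matrix p₁ t ℍ[ℝ]) (P₂ P₂' : Matrix p₂ t ℍ[ℝ]) (P₃ P₃' : Matrix p₃ t ℍ[ℝ])
      (Q₁ Q₁' : Matrix s q₁ ℍ[ℝ]) (Q₂ Q₂' : Matrix s q₂ ℍ[ℝ]) (Q₃ Q₃' : Matrix s q₃ ℍ[ℝ]),
      ((A₁ * P₁ = h₁ ∧ A₁ * P₁' = 0) ∧ (A₂ * P₂ = 0 ∧ A₂ * P₂' = -h₂) ∧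
        (A₃ * P₃ = 0 ∧ A₃ * P₃' = -h₃)) ∧
      ((Q₁ * B₁ = 0 ∧ Q₁' * B₁ = -g₁) ∧ (Q₂ * B₂ = g₂ ∧ Q₂' * B₂ = 0) ∧
        (Q₃ * B₃ = g₃ ∧ Q₃' * B₃ = 0)) ∧
      C = E₁ * P₁ + E₃ * P₃ + (Q₂ * F₂ + Q₃ * F₃) ∧
      0 = E₁ * P₁' + E₃ * P₃' + (Q₁ * F₁ + Q₃ * F₃) ∧
      0 = E₂ * P₂ + E₃ * P₃ + (Q₂' * F₂ + Q₃' * F₃) ∧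
      -C = E₂ * P₂' + E₃ * P₃' + (Q₁' * F₁ + Q₃' * F₃) := by
  classical
  have h0 : (C │ 0 │ E₁ │ 0 │ E₃ │ g₂ │ 0 │ g₃ ⊟
        0 │ -C │ 0 │ E₂ │ E₃ │ 0 │ -g₁ │ 0 ⊟
        F₂ │ 0 │ 0 │ 0 │ 0 │ B₂ │ 0 │ 0 ⊟
        0 │ F₁ │ 0 │ 0 │ 0 │ 0 │ B₁ │ 0 ⊟
        F₃ │ F₃ │ 0 │ 0 │ 0 │ 0 │ 0 │ B₃ ⊟
        h₁ │ 0 │ A₁ │ 0 │ 0 │ 0 │ 0 │ 0 ⊟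
        0 │ -h₂ │ 0 │ A₂ │ 0 │ 0 │ 0 │ 0 ⊟
        0 │ -h₃ │ 0 │ 0 │ A₃ │ 0 │ 0 │ 0)
      = (((C │ 0 ⊟ 0 │ -C) │ (g₂ │ 0 │ g₃ ⊟ 0 │ -g₁ │ 0) ⊟
            (h₁ │ 0 ⊟ 0 │ -h₂ ⊟ 0 │ -h₃) │ 0) │
          ((E₁ │ 0 │ E₃ ⊟ 0 │ E₂ │ E₃) ⊟ (A₁ │ 0 │ 0 ⊟ 0 │ A₂ │ 0 ⊟ 0 │ 0 │ A₃)) ⊟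
          ((F₂ │ 0 ⊟ 0 │ F₁ ⊟ F₃ │ F₃) │ (B₂ │ 0 │ 0 ⊟ 0 │ B₁ │ 0 ⊟ 0 │ 0 │ B₃)) │ 0).submatrix
        blockEquivThree blockEquivThree := by
    ext (i | i | i | i | i | i | i | i) (j | j | j | j | j | j | j | j) <;> rfl
  have h0' : (F₂ │ 0 │ B₂ │ 0 │ 0 ⊟ 0 │ F₁ │ 0 │ B₁ │ 0 ⊟ F₃ │ F₃ │ 0 │ 0 │ B₃)
      = ((F₂ │ 0 ⊟ 0 │ F₁ ⊟ F₃ │ F₃) │ (B₂ │ 0 │ 0 ⊟ 0 │ B₁ │ 0 ⊟ 0 │ 0 │ B₃)).submatrix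
        (Equiv.refl _) (Equiv.sumAssoc _ _ _).symm := by
    ext (i | i | i) (j | j | j | j | j) <;> rfl
  have h0'' : (E₁ │ 0 │ E₃ ⊟ 0 │ E₂ │ E₃ ⊟ A₁ │ 0 │ 0 ⊟ 0 │ A₂ │ 0 ⊟ 0 │ 0 │ A₃)
      = ((E₁ │ 0 │ E₃ ⊟ 0 │ E₂ │ E₃) ⊟ (A₁ │ 0 │ 0 ⊟ 0 │ A₂ │ 0 ⊟ 0 │ 0 │ A₃)).submatrix
        (Equiv.sumAssoc _ _ _).symm (Equiv.refl _) := by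
    ext (i | i | i | i | i) (j | j | j) <;> rfl
  have hh : Rp (A₁ │ 0 │ 0 ⊟ 0 │ A₂ │ 0 ⊟ 0 │ 0 │ A₃) * (h₁ │ 0 ⊟ 0 │ -h₂ ⊟ 0 │ -h₃) = 0 := by
    obtain ⟨P₁, rfl⟩ := hh₁
    obtain ⟨P₂, rfl⟩ := hh₂
    obtain ⟨P₃, rfl⟩ := hh₃
    refine Rp_mul_eq_zero_iff_exists.2 ⟨P₁ │ 0 ⊟ 0 │ -P₂ ⊟ 0 │ -P₃, ?_⟩
    simp only [Matrix.fromRows_mul, Matrix.fromCols_mul_fromRows, Matrix.mul_fromCols,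
      Matrix.zero_mul, Matrix.mul_zero, zero_add, add_zero, Matrix.mul_neg]
  have hg : (g₂ │ 0 │ g₃ ⊟ 0 │ -g₁ │ 0) * Lp (B₂ │ 0 │ 0 ⊟ 0 │ B₁ │ 0 ⊟ 0 │ 0 │ B₃) = 0 := by
    obtain ⟨Q₁, rfl⟩ := hg₁
    obtain ⟨Q₂, rfl⟩ := hg₂
    obtain ⟨Q₃, rfl⟩ := hg₃
    refine mul_Lp_eq_zero_iff_exists.2 ⟨Q₂ │ 0 │ Q₃ ⊟ 0 │ -Q₁ │ 0, ?_⟩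
    simp only [Matrix.fromRows_mul, Matrix.fromCols_mul_fromRows, Matrix.mul_fromCols,
      Matrix.zero_mul, Matrix.mul_zero, zero_add, add_zero, Matrix.neg_mul, fromCols_add_fromCols,
      Matrix.fromCols_neg, neg_zero]
  rw [h0, h0', h0'', rk_submatrix, rk_submatrix, rk_submatrix, add_comm, rk_bordered_eq_iff hh hg]
  constructor
  · rintro ⟨P, Q, hP, hQ, hC⟩
    obtain ⟨X₁, X', rfl⟩ : ∃ X₁ X', P = X₁ ⊟ X' := ⟨_, _, (Matrix.fromRows_toRows P).symm⟩
    obtain ⟨X₂, X₃, rfl⟩ : ∃ X₂ X₃, X' = X₂ ⊟ X₃ := ⟨_, _, (Matrix.fromRows_toRows X').symm⟩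
    obtain ⟨P₁, P₁', rfl⟩ : ∃ P₁ P₁', X₁ = P₁ │ P₁' := ⟨_, _, (Matrix.fromCols_toCols _).symm⟩
    obtain ⟨P₂, P₂', rfl⟩ : ∃ P₂ P₂', X₂ = P₂ │ P₂' := ⟨_, _, (Matrix.fromCols_toCols _).symm⟩
    obtain ⟨P₃, P₃', rfl⟩ : ∃ P₃ P₃', X₃ = P₃ │ P₃' := ⟨_, _, (Matrix.fromCols_toCols _).symm⟩
    obtain ⟨Y, Y', rfl⟩ : ∃ Y Y', Q = Y ⊟ Y' := ⟨_, _, (Matrix.fromRows_toRows Q).symm⟩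
    obtain ⟨Q₂, Z, rfl⟩ : ∃ Q₂ Z, Y = Q₂ │ Z := ⟨_, _, (Matrix.fromCols_toCols _).symm⟩
    obtain ⟨Q₁, Q₃, rfl⟩ : ∃ Q₁ Q₃, Z = Q₁ │ Q₃ := ⟨_, _, (Matrix.fromCols_toCols _).symm⟩
    obtain ⟨Q₂', Z', rfl⟩ : ∃ Q₂ Z, Y' = Q₂ │ Z := ⟨_, _, (Matrix.fromCols_toCols _).symm⟩
    obtain ⟨Q₁', Q₃', rfl⟩ : ∃ Q₁ Q₃, Z' = Q₁ │ Q₃ := ⟨_, _, (Matrix.fromCols_toCols _).symm⟩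
    simp only [Matrix.fromRows_mul, Matrix.fromCols_mul_fromRows, Matrix.mul_fromCols,
      Matrix.zero_mul, Matrix.mul_zero, zero_add, add_zero, fromCols_add_fromCols,
      fromRows_add_fromRows, Matrix.fromRows_ext_iff, Matrix.fromCols_ext_iff] at hP hQ hC
    obtain ⟨⟨p1, p2⟩, ⟨p3, p4⟩, p5, p6⟩ := hP
    obtain ⟨⟨r1, r2, r3⟩, r4, r5, r6⟩ := hQ
    obtain ⟨⟨c1, c2⟩, c3, c4⟩ := hC
    exact ⟨P₁, P₁', P₂, P₂', P₃, P₃', Q₁, Q₁', Q₂, Q₂', Q₃, Q₃', ⟨⟨p1, p2⟩, ⟨p3, p4⟩, p5, p6⟩,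
      ⟨⟨r2, r5⟩, ⟨r1, r4⟩, r3, r6⟩, c1, c2, c3, c4⟩
  · rintro ⟨P₁, P₁', P₂, P₂', P₃, P₃', Q₁, Q₁', Q₂, Q₂', Q₃, Q₃', ⟨⟨p1, p2⟩, ⟨p3, p4⟩, p5, p6⟩,
      ⟨⟨r2, r5⟩, ⟨r1, r4⟩, r3, r6⟩, c1, c2, c3, c4⟩
    refine ⟨P₁ │ P₁' ⊟ P₂ │ P₂' ⊟ P₃ │ P₃', Q₂ │ Q₁ │ Q₃ ⊟ Q₂' │ Q₁' │ Q₃', ?_, ?_, ?_⟩ <;>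
    simp only [Matrix.fromRows_mul, Matrix.fromCols_mul_fromRows, Matrix.mul_fromCols,
      Matrix.zero_mul, Matrix.mul_zero, zero_add, add_zero, fromCols_add_fromCols,
      fromRows_add_fromRows, Matrix.fromRows_ext_iff, Matrix.fromCols_ext_iff]
    · exact ⟨⟨p1, p2⟩, ⟨p3, p4⟩, p5, p6⟩
    · exact ⟨⟨r1, r2, r3⟩, r4, r5, r6⟩
    · exact ⟨⟨c1, c2⟩, c3, c4⟩

end BlockRank

end QuatMat

/-! ### Auxiliary matrices of the system and the equations for `U₃`. -/

namespace QuatMat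

/-- Separating a particular solution `W` of `A P = A W` from `E P`. -/
theorem mul_eq_add_of_mul_eq {m n p s : Type*} [Fintype m] [Fintype p] [DecidableEq p]
    {A : Matrix m p ℍ[ℝ]} {P W : Matrix p n ℍ[ℝ]} (h : A * P = A * W) (E : Matrix s p ℍ[ℝ]) :
    E * P = E * W + E * Lp A * (P - W) := by
  rw [Matrix.mul_assoc, Lp_mul_of_mul_eq_zero (by rw [Matrix.mul_sub, h, sub_self]),
    Matrix.mul_sub]
  abel

theorem eq_mul_add_of_mul_eq {m n q t : Type*} [Fintype n] [Fintype q] [DecidableEq q]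
    {B : Matrix q n ℍ[ℝ]} {P W : Matrix m q ℍ[ℝ]} (h : P * B = W * B) (F : Matrix q t ℍ[ℝ]) :
    P * F = W * F + (P - W) * (Rp B * F) := by
  rw [← Matrix.mul_assoc, mul_Rp_of_mul_eq_zero (by rw [Matrix.sub_mul, h, sub_self]),
    Matrix.sub_mul]
  abel

namespace TwoSidedSystem

variable {s t p₁ q₁ a₁ b₁ p₂ q₂ a₂ b₂ p₃ q₃ a₃ b₃ : ℕ}
  (Q : TwoSidedSystem s t p₁ q₁ a₁ b₁ p₂ q₂ a₂ b₂ p₃ q₃ a₃ b₃)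

/-! ### Relations between the auxiliary matrices -/

/-- With `L1_mul_Lp_B22` and the definition of `H2`, this gives equations 1 and 2 the nested form;
`H3_mul_Lp_N1`, `L3_mul_Lp_N1` and the definition of `G3` do so for equations 3 and 4. -/
theorem Rp_M1_mul_G2 : Q.G1 = Rp Q.M1 * Q.G2 := Matrix.mul_assoc _ _ _

theorem H3_mul_Lp_N1 : Q.H4 = Q.H3 * Lp Q.N1 := (Matrix.mul_assoc _ _ _).symm

theorem L1_mul_Lp_B22 : Q.L1 * Lp Q.B22 = Rp Q.M1 * Q.L2 := by
  simp only [L1, L2, G, Matrix.mul_assoc]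

theorem L3_mul_Lp_N1 : Q.L3 * Lp Q.N1 = Rp Q.A22 * Q.L4 := by
  simp only [L3, L4, H, Matrix.mul_assoc]

theorem G_mul_A11 : Q.G * Q.A11 = 0 := by
  rw [G, Matrix.mul_assoc, Rp_mul, Matrix.mul_zero]

theorem G_mul_A22 : Q.G * Q.A22 = 0 := by
  rw [G, Matrix.mul_assoc]
  exact Rp_mul Q.M1

theorem B11_mul_H : Q.B11 * Q.H = 0 := by
  rw [H, ← Matrix.mul_assoc, mul_Lp, Matrix.zero_mul]

theorem B22_mul_H : Q.B22 * Q.H = 0 := by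
  rw [H, ← Matrix.mul_assoc]
  exact mul_Lp Q.N1

theorem G_mul_Rp_A22 : Q.G * Rp Q.A22 = Q.G := mul_Rp_of_mul_eq_zero Q.G_mul_A22

theorem Lp_B22_mul_H : Lp Q.B22 * Q.H = Q.H := Lp_mul_of_mul_eq_zero Q.B22_mul_H

/-- This and `H2_mul_H` relate the two pairs to each other, which makes `F10` and `F20` comparable.
-/
theorem G_mul_G3 : Q.G * Q.G3 = Q.G1 := by
  rw [G3, ← Matrix.mul_assoc, G_mul_Rp_A22, G1]

theorem H2_mul_H : Q.H2 * Q.H = Q.H4 := by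
  rw [H2, Matrix.mul_assoc, Lp_B22_mul_H, H4]

theorem Rp_C11_mul_Lp_G2 : Rp Q.C11 * Lp Q.G2 = 0 := by
  have h := Rp_mul Q.C11
  nth_rewrite 2 [C11] at h
  rw [Matrix.mul_fromCols, ← Matrix.fromCols_zero, Matrix.fromCols_ext_iff] at h
  exact h.1

theorem Rp_H3_mul_Lp_D11 : Rp Q.H3 * Lp Q.D11 = 0 := by
  have h := mul_Lp Q.D11
  nth_rewrite 1 [D11] at h
  rw [Matrix.fromRows_mul, ← Matrix.fromRows_zero, Matrix.fromRows_ext_iff] at h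
  exact h.2

/-! ### The four equations for `U₃` -/

/-- The linear equations which say that `A₁₁ U₁ B₁₁ + A₂₂ U₂ B₂₂ = T₁ - A₃₃ U B₃₃` is solvable. -/
def IsAdmissible (U : Matrix (Fin p₃) (Fin q₃) ℍ[ℝ]) : Prop :=
  (Q.G1 * U * Q.H1 = Q.L1 ∧ Q.G2 * U * Q.H2 = Q.L2) ∧
    (Q.G3 * U * Q.H3 = Q.L3 ∧ Q.G4 * U * Q.H4 = Q.L4)

variable {Q}

/-- In each of the four equations the left and right multipliers together annihilate the terms in
`X` and `Y`. -/
theorem isAdmissible_of_eq {X : Matrix (Fin p₁) (Fin q₁) ℍ[ℝ]} {Y : Matrix (Fin p₂) (Fin q₂) ℍ[ℝ]}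
    {Z : Matrix (Fin p₃) (Fin q₃) ℍ[ℝ]}
    (h : Q.A11 * X * Q.B11 + Q.A22 * Y * Q.B22 + Q.A33 * Z * Q.B33 = Q.T1) :
    Q.IsAdmissible Z := by
  refine ⟨⟨?_, ?_⟩, ?_, ?_⟩
  · rw [L1, ← h]
    simp only [Matrix.mul_add, Matrix.mul_assoc, mul_reassoc Q.G_mul_A11,
      mul_reassoc Q.G_mul_A22, Matrix.zero_mul, zero_add, G1, H1]
  · rw [L2, ← h]
    simp only [Matrix.mul_add, Matrix.add_mul, Matrix.mul_assoc, mul_reassoc (Rp_mul Q.A11),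
      mul_Lp, Matrix.mul_zero, Matrix.zero_mul, zero_add, G2, H2]
  · rw [L3, ← h]
    simp only [Matrix.mul_add, Matrix.add_mul, Matrix.mul_assoc, mul_reassoc (Rp_mul Q.A22),
      mul_Lp, Matrix.mul_zero, Matrix.zero_mul, zero_add, G3, H3]
  · rw [L4, ← h]
    simp only [Matrix.add_mul, Matrix.mul_assoc, B11_mul_H, B22_mul_H,
      Matrix.mul_zero, zero_add, G4, H4]

/-- For the right-hand side `Q.T U`, the four conditions of `two_term_sound` read `Lⱼ - Gⱼ U Hⱼ =
0`. -/
theorem two_term_of_isAdmissible {U : Matrix (Fin p₃) (Fin q₃) ℍ[ℝ]} (h : Q.IsAdmissible U)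
    (P : FreeParams p₁ q₁ p₂ q₂ p₃ q₃) :
    Q.A11 * Q.U1 P U * Q.B11 + Q.A22 * Q.U2 P U * Q.B22 + Q.A33 * U * Q.B33 = Q.T1 := by
  obtain ⟨⟨h1, h2⟩, h3, h4⟩ := h
  rw [← eq_sub_iff_add_eq]
  refine two_term_sound (E := Q.T U) rfl rfl rfl ?_ ?_ ?_ ?_ P.U4 P.U5 P.U6 P.U7 P.U8
  · rw [← Matrix.mul_assoc, T, Matrix.mul_sub]
    change Q.L1 - _ = 0
    rw [← h1, sub_eq_zero]
    simp only [G1, H1, G, Matrix.mul_assoc]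
    rfl
  · rw [T, Matrix.mul_sub, Matrix.sub_mul]
    change Q.L2 - _ = 0
    rw [← h2, sub_eq_zero]
    simp only [G2, H2, Matrix.mul_assoc]
  · rw [T, Matrix.mul_sub, Matrix.sub_mul]
    change Q.L3 - _ = 0
    rw [← h3, sub_eq_zero]
    simp only [G3, H3, Matrix.mul_assoc]
  · rw [Matrix.mul_assoc, T, Matrix.sub_mul]
    change Q.L4 - _ = 0
    rw [← h4, sub_eq_zero]
    simp only [G4, H4, H, Matrix.mul_assoc]
    rfl

/-- The solvability conditions for the four equations for `U₃`, taken one by one. -/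
def PairConditions (Q : TwoSidedSystem s t p₁ q₁ a₁ b₁ p₂ q₂ a₂ b₂ p₃ q₃ a₃ b₃) : Prop :=
  (Rp Q.G1 * Q.L1 = 0 ∧ Q.L1 * Lp Q.H1 = 0) ∧
  (Rp Q.G2 * Q.L2 = 0 ∧ Q.L2 * Lp Q.H2 = 0) ∧
  (Rp Q.G3 * Q.L3 = 0 ∧ Q.L3 * Lp Q.H3 = 0) ∧
  (Rp Q.G4 * Q.L4 = 0 ∧ Q.L4 * Lp Q.H4 = 0)

theorem F10_spec (h : Q.PairConditions) :
    Q.G1 * Q.F10 * Q.H1 = Q.L1 ∧ Q.G2 * Q.F10 * Q.H2 = Q.L2 :=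
  nested_pair_particular Q.Rp_M1_mul_G2 rfl Q.L1_mul_Lp_B22 h.1.1 h.1.2 h.2.1.1 h.2.1.2

theorem F20_spec (h : Q.PairConditions) :
    Q.G3 * Q.F20 * Q.H3 = Q.L3 ∧ Q.G4 * Q.F20 * Q.H4 = Q.L4 :=
  nested_pair_particular rfl Q.H3_mul_Lp_N1 Q.L3_mul_Lp_N1 h.2.2.1.1 h.2.2.1.2 h.2.2.2.1
    h.2.2.2.2

/-- Equation 3 multiplied by `G` and equation 1 multiplied by `Lp B11` have the same right-hand
side, so `F20` and `F10` give the same value. -/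
theorem G1_mul_F_mul_H3 (h : Q.PairConditions) : Q.G1 * Q.F * Q.H3 = 0 := by
  have e1 : Q.G1 * Q.F20 * Q.H3 = Q.G * Q.T1 * Lp Q.B11 := by
    rw [← G_mul_G3, Matrix.mul_assoc, Matrix.mul_assoc, ← Matrix.mul_assoc Q.G3, (F20_spec h).1,
      L3, Matrix.mul_assoc, mul_reassoc Q.G_mul_Rp_A22, Matrix.mul_assoc]
  have e2 : Q.G1 * Q.F10 * Q.H3 = Q.G * Q.T1 * Lp Q.B11 := by
    rw [H3, ← Matrix.mul_assoc]
    exact congrArg (· * Lp Q.B11) (F10_spec h).1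
  rw [F, Matrix.mul_sub, Matrix.sub_mul, e1, e2, sub_self]

/-- Here equation 4 multiplied by `Rp A11` is compared with equation 2 multiplied by `H`. -/
theorem G2_mul_F_mul_H4 (h : Q.PairConditions) : Q.G2 * Q.F * Q.H4 = 0 := by
  have e1 : Q.G2 * Q.F20 * Q.H4 = Rp Q.A11 * Q.T1 * Q.H := by
    rw [G2, Matrix.mul_assoc, Matrix.mul_assoc, Matrix.mul_assoc, ← Matrix.mul_assoc Q.A33]
    exact congrArg (Rp Q.A11 * ·) (F20_spec h).2
  have e2 : Q.G2 * Q.F10 * Q.H4 = Rp Q.A11 * Q.T1 * Q.H := by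
    rw [← H2_mul_H, ← Matrix.mul_assoc, (F10_spec h).2, L2, Matrix.mul_assoc, Lp_B22_mul_H]
  rw [F, Matrix.mul_sub, Matrix.sub_mul, e1, e2, sub_self]

/-- `Lp D11` factors through `H3`, and `F H3` absorbs `Lp G1 = C22` because `G1 F H3 = 0`; hence `E`
is a right multiple of `E11`. -/
theorem Rp_E11_mul_E (h : Q.PairConditions) : Rp Q.E11 * Q.E = 0 := by
  have e1 : Q.H3 * (Q.H3† * Lp Q.D11) = Lp Q.D11 := Rp_mul_eq_zero_iff.1 Q.Rp_H3_mul_Lp_D11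
  have e2 : Lp Q.G1 * (Q.F * Q.H3) = Q.F * Q.H3 :=
    Lp_mul_of_mul_eq_zero (by rw [← Matrix.mul_assoc, G1_mul_F_mul_H3 h])
  have e3 : Q.E = Q.E11 * (Q.F * Lp Q.D11) := by
    rw [E, E11, C22, ← e1, Matrix.mul_assoc, Matrix.mul_assoc, ← Matrix.mul_assoc Q.F,
      ← Matrix.mul_assoc (Lp Q.G1), e2]
  rw [e3, ← Matrix.mul_assoc, Rp_mul, Matrix.zero_mul]

/-- Dually, `Rp C11` factors through `G2`, and `G2 F` absorbs `Rp H4 = D33`; hence `E` is a left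
multiple of `E44`. -/
theorem E_mul_Lp_E44 (h : Q.PairConditions) : Q.E * Lp Q.E44 = 0 := by
  have e1 : Rp Q.C11 * (Q.G2† * Q.G2) = Rp Q.C11 := mul_Lp_eq_zero_iff.1 Q.Rp_C11_mul_Lp_G2
  have e2 : Q.G2 * Q.F * Rp Q.H4 = Q.G2 * Q.F := mul_Rp_of_mul_eq_zero (G2_mul_F_mul_H4 h)
  have e3 : Q.E = Rp Q.C11 * Q.G2† * (Q.G2 * Q.F) * Q.E44 := by
    rw [E44, D33, ← Matrix.mul_assoc, Matrix.mul_assoc (_ * _) (_ * _) (Rp _), e2, E]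
    simp only [Matrix.mul_assoc, mul_mul_reassoc e1]
  rw [e3, Matrix.mul_assoc, mul_Lp, Matrix.mul_zero]

end TwoSidedSystem

end QuatMat

namespace QuatMat

theorem one_fromCols_zero_mul {p q n : Type*} [Fintype p] [Fintype q] [DecidableEq p]
    (X : Matrix p n ℍ[ℝ]) (Y : Matrix q n ℍ[ℝ]) : (1 │ 0 : Matrix p (p ⊕ q) ℍ[ℝ]) * (X ⊟ Y) = X := by
  rw [Matrix.fromCols_mul_fromRows, Matrix.one_mul, Matrix.zero_mul, add_zero]

theorem zero_fromCols_one_mul {p q n : Type*} [Fintype p] [Fintype q] [DecidableEq q]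
    (X : Matrix p n ℍ[ℝ]) (Y : Matrix q n ℍ[ℝ]) : (0 │ 1 : Matrix q (p ⊕ q) ℍ[ℝ]) * (X ⊟ Y) = Y := by
  rw [Matrix.fromCols_mul_fromRows, Matrix.one_mul, Matrix.zero_mul, zero_add]

theorem mul_one_fromRows_zero {p q n : Type*} [Fintype p] [Fintype q] [DecidableEq p]
    (X : Matrix n p ℍ[ℝ]) (Y : Matrix n q ℍ[ℝ]) : (X │ Y) * (1 ⊟ 0 : Matrix (p ⊕ q) p ℍ[ℝ]) = X := by
  rw [Matrix.fromCols_mul_fromRows, Matrix.mul_one, Matrix.mul_zero, add_zero]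

theorem mul_zero_fromRows_one {p q n : Type*} [Fintype p] [Fintype q] [DecidableEq q]
    (X : Matrix n p ℍ[ℝ]) (Y : Matrix n q ℍ[ℝ]) : (X │ Y) * (0 ⊟ 1 : Matrix (p ⊕ q) q ℍ[ℝ]) = Y := by
  rw [Matrix.fromCols_mul_fromRows, Matrix.mul_one, Matrix.mul_zero, zero_add]

theorem fromCols_mul_eq {m p q n : Type*} [Fintype p] [Fintype q] [DecidableEq p] [DecidableEq q]
    (A : Matrix m p ℍ[ℝ]) (B : Matrix m q ℍ[ℝ]) (X : Matrix (p ⊕ q) n ℍ[ℝ]) :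
    (A │ B) * X = A * ((1 │ 0 : Matrix p (p ⊕ q) ℍ[ℝ]) * X) + B * ((0 │ 1 : Matrix q (p ⊕ q) ℍ[ℝ]) * X) := by
  rw [← Matrix.fromRows_toRows X, one_fromCols_zero_mul, zero_fromCols_one_mul,
    Matrix.fromCols_mul_fromRows]

theorem mul_fromRows_eq {m p q n : Type*} [Fintype p] [Fintype q] [DecidableEq p] [DecidableEq q]
    (A : Matrix p m ℍ[ℝ]) (B : Matrix q m ℍ[ℝ]) (X : Matrix n (p ⊕ q) ℍ[ℝ]) :
    X * (A ⊟ B) = X * (1 ⊟ 0 : Matrix (p ⊕ q) p ℍ[ℝ]) * A + X * (0 ⊟ 1 : Matrix (p ⊕ q) q ℍ[ℝ]) * B := by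
  rw [← Matrix.fromCols_toCols X, mul_one_fromRows_zero, mul_zero_fromRows_one,
    Matrix.fromCols_mul_fromRows]

namespace TwoSidedSystem

variable {s t p₁ q₁ a₁ b₁ p₂ q₂ a₂ b₂ p₃ q₃ a₃ b₃ : ℕ}
  {Q : TwoSidedSystem s t p₁ q₁ a₁ b₁ p₂ q₂ a₂ b₂ p₃ q₃ a₃ b₃}

/-! ### The general solution of the four equations -/

section Sandwich

variable (Q)

/-- Each pseudoinverse next to `F` in `V3` and `W3` inverts a matrix that already carries `Rp C11`
on the left or `Lp D11` on the right, and so absorbs that projector. This turns `F` into `E` and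
makes the two-term results applicable. -/
theorem pinv_E11_mul : Q.E11† * Rp Q.C11 = Q.E11† :=
  pinv_mul_Rp (by rw [E11, ← Matrix.mul_assoc, Rp_mul_Rp])

theorem pinv_E22_mul : Q.E22† * Rp Q.C11 = Q.E22† :=
  pinv_mul_Rp (by rw [E22, ← Matrix.mul_assoc, Rp_mul_Rp])

theorem mul_pinv_E33 : Lp Q.D11 * Q.E33† = Q.E33† :=
  Lp_mul_pinv (by rw [E33, Matrix.mul_assoc, Lp_mul_Lp])

theorem mul_pinv_E44 : Lp Q.D11 * Q.E44† = Q.E44† :=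
  Lp_mul_pinv (by rw [E44, Matrix.mul_assoc, Lp_mul_Lp])

theorem pinv_M_mul : Q.M† * Rp Q.C11 = Q.M† := by
  have h1 : Rp Q.C11 * Q.E11 = Q.E11 := by rw [E11, ← Matrix.mul_assoc, Rp_mul_Rp]
  have h2 : Rp Q.C11 * Q.E22 = Q.E22 := by rw [E22, ← Matrix.mul_assoc, Rp_mul_Rp]
  refine pinv_mul_Rp ?_
  rw [M, Rp_mul_apply Q.E11, Matrix.mul_sub, h2, mul_reassoc h1]

theorem mul_pinv_N : Lp Q.D11 * Q.N† = Q.N† := by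
  have h1 : Q.E33 * Lp Q.D11 = Q.E33 := by rw [E33, Matrix.mul_assoc, Lp_mul_Lp]
  have h2 : Q.E44 * Lp Q.D11 = Q.E44 := by rw [E44, Matrix.mul_assoc, Lp_mul_Lp]
  refine Lp_mul_pinv ?_
  rw [N, mul_Lp_apply _ Q.E33, Matrix.sub_mul, h2]
  simp only [Matrix.mul_assoc, h1]

variable (P : FreeParams p₁ q₁ p₂ q₂ p₃ q₃)

/-- In the formula for `V₃` the matrix `F` may be replaced by `E`. -/
theorem V3_eq : Q.V3 P = Q.E11† * Q.E * Q.E33† - Q.E11† * Q.E22 * Q.M† * Q.E * Q.E33†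
    - Q.E11† * Q.S * Q.E22† * Q.E * Q.N† * Q.E44 * Q.E33†
    - Q.E11† * Q.S * P.U31 * Rp Q.N * Q.E44 * Q.E33†
    + Lp Q.E11 * P.U32 + P.U33 * Rp Q.E33 := by
  simp only [V3, E, Matrix.mul_assoc, mul_reassoc Q.pinv_E11_mul, mul_reassoc Q.pinv_E22_mul,
    mul_reassoc Q.pinv_M_mul, Q.mul_pinv_E33, mul_reassoc Q.mul_pinv_N]

/-- In the formula for `W₃` the matrix `F` may be replaced by `E`. -/
theorem W3_eq : Q.W3 P = Q.M† * Q.E * Q.E44† + Q.S† * Q.S * Q.E22† * Q.E * Q.N†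
    + Lp Q.M * Lp Q.S * P.U41 + P.U42 * Rp Q.E44 + Lp Q.M * P.U31 * Rp Q.N := by
  rw [add_right_comm]
  simp only [W3, E, Matrix.mul_assoc, mul_reassoc Q.pinv_E22_mul,
    mul_reassoc Q.pinv_M_mul, Q.mul_pinv_E44, Q.mul_pinv_N]

end Sandwich

/-- Only `h9` has to be assumed: the other three conditions of `two_term_sound` follow from
`Rp_E11_mul_E` and `E_mul_Lp_E44`. -/
theorem V3_W3_spec (h : Q.PairConditions) (h9 : Rp Q.E22 * Q.E * Lp Q.E33 = 0)
    (P : FreeParams p₁ q₁ p₂ q₂ p₃ q₃) :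
    Q.E11 * Q.V3 P * Q.E33 + Q.E22 * Q.W3 P * Q.E44 = Q.E := by
  rw [V3_eq, W3_eq]
  refine two_term_sound rfl rfl rfl ?_ ?_ h9 ?_ _ _ _ _ _
  · rw [Rp_E11_mul_E h, Matrix.mul_zero]
  · rw [Rp_E11_mul_E h, Matrix.zero_mul]
  -- Inserting `E44† E44` after `E` produces `E44 * Lp E33 = N`, which `Lp N` kills.
  · have h1 : Q.E * (Q.E44† * Q.E44) = Q.E := mul_Lp_eq_zero_iff.1 (E_mul_Lp_E44 h)
    rw [← h1]
    simp only [Matrix.mul_assoc]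
    rw [← Matrix.mul_assoc Q.E44]
    change Q.E * (Q.E44† * (Q.N * Lp Q.N)) = 0
    rw [mul_Lp, Matrix.mul_zero, Matrix.mul_zero]

/-- This is the solvability condition of the one-sided equation `C11 V + W D11 = Res`. -/
theorem Res_spec (h : Q.PairConditions) (h9 : Rp Q.E22 * Q.E * Lp Q.E33 = 0)
    (P : FreeParams p₁ q₁ p₂ q₂ p₃ q₃) : Rp Q.C11 * Q.Res P * Lp Q.D11 = 0 := by
  have h1 := V3_W3_spec h h9 P
  rw [E, ← sub_eq_zero, ← neg_eq_zero] at h1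
  rw [← h1, Res]
  simp only [E11, E22, E33, E44, Matrix.mul_sub, Matrix.sub_mul, Matrix.mul_assoc]
  abel

section Blocks

variable (Q) (P : FreeParams p₁ q₁ p₂ q₂ p₃ q₃)

/-- `V1` and `W1` are the two blocks of one unknown of that one-sided equation; `V2` and `W2` are
the blocks of the other. -/
theorem V1_eq : Q.V1 P = (1 │ 0 : Matrix (Fin p₃) (Fin p₃ ⊕ Fin p₃) ℍ[ℝ])
    * (Q.C11† * Q.Res P - (Q.C11† * P.U11 * Q.D11 - Lp Q.C11 * P.U12)) := by
  rw [Matrix.mul_sub]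
  rfl

theorem W1_eq : Q.W1 P = (0 │ 1 : Matrix (Fin p₃) (Fin p₃ ⊕ Fin p₃) ℍ[ℝ])
    * (Q.C11† * Q.Res P - (Q.C11† * P.U11 * Q.D11 - Lp Q.C11 * P.U12)) := by
  rw [Matrix.mul_sub]
  rfl

theorem V2_eq : Q.V2 P = (Rp Q.C11 * Q.Res P * Q.D11†
    + (Q.C11 * Q.C11† * P.U11 + P.U21 * Rp Q.D11))
      * (1 ⊟ 0 : Matrix (Fin q₃ ⊕ Fin q₃) (Fin q₃) ℍ[ℝ]) := by
  rw [Matrix.add_mul]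
  rfl

theorem W2_eq : Q.W2 P = (Rp Q.C11 * Q.Res P * Q.D11†
    + (Q.C11 * Q.C11† * P.U11 + P.U21 * Rp Q.D11))
      * (0 ⊟ 1 : Matrix (Fin q₃ ⊕ Fin q₃) (Fin q₃) ℍ[ℝ]) := by
  rw [Matrix.add_mul]
  rfl

end Blocks

theorem Lp_G2_mul_V1_add (h : Q.PairConditions) (h9 : Rp Q.E22 * Q.E * Lp Q.E33 = 0)
    (P : FreeParams p₁ q₁ p₂ q₂ p₃ q₃) :
    Lp Q.G2 * Q.V1 P + Lp Q.G4 * Q.W1 P + (Q.V2 P * Rp Q.H1 + Q.W2 P * Rp Q.H3) = Q.Res P := by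
  rw [V1_eq, W1_eq, V2_eq, W2_eq, ← fromCols_mul_eq, ← mul_fromRows_eq]
  exact sylvester_sound (Res_spec h h9 P) P.U11 P.U21 P.U12

theorem U3_eq_U3' (h : Q.PairConditions) (h9 : Rp Q.E22 * Q.E * Lp Q.E33 = 0)
    (P : FreeParams p₁ q₁ p₂ q₂ p₃ q₃) : Q.U3 P = Q.U3' P := by
  have h1 := Lp_G2_mul_V1_add h h9 P
  rw [Res, F, ← sub_eq_zero] at h1
  rw [U3, U3', ← sub_eq_zero, ← h1, C22, C33, D22, D33]
  abel

/-- The first expression solves equations 1 and 2 for any `V₁`, `V₂`, `V₃`, the second solves 3 and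
4 for any `W₁`, `W₂`, `W₃`. As the expressions coincide, all four equations hold. -/
theorem isAdmissible_U3 (h : Q.PairConditions) (h9 : Rp Q.E22 * Q.E * Lp Q.E33 = 0)
    (P : FreeParams p₁ q₁ p₂ q₂ p₃ q₃) : Q.IsAdmissible (Q.U3 P) := by
  have e1 : Q.G1 * Lp Q.G2 = 0 := by
    rw [Rp_M1_mul_G2, Matrix.mul_assoc, mul_Lp, Matrix.mul_zero]
  have e2 : Rp Q.H1 * Q.H2 = 0 := by
    change Rp Q.H1 * (Q.H1 * Lp Q.B22) = 0
    rw [← Matrix.mul_assoc, Rp_mul, Matrix.zero_mul]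
  have e3 : Q.G3 * Lp Q.G4 = 0 := by
    change Rp Q.A22 * Q.G4 * Lp Q.G4 = 0
    rw [Matrix.mul_assoc, mul_Lp, Matrix.mul_zero]
  have e4 : Rp Q.H3 * Q.H4 = 0 := by
    rw [H3_mul_Lp_N1, ← Matrix.mul_assoc, Rp_mul, Matrix.zero_mul]
  refine ⟨⟨?_, ?_⟩, ?_, ?_⟩
  · rw [← (F10_spec h).1, U3]
    simp only [Matrix.mul_add, Matrix.add_mul, Matrix.mul_assoc, mul_reassoc e1,
      mul_reassoc (mul_Lp Q.G1), Rp_mul, Matrix.zero_mul, Matrix.mul_zero, add_zero]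
  · rw [← (F10_spec h).2, U3]
    simp only [Matrix.mul_add, Matrix.add_mul, Matrix.mul_assoc, e2,
      mul_reassoc (mul_Lp Q.G2), Rp_mul, Matrix.zero_mul, Matrix.mul_zero, add_zero]
  · rw [← (F20_spec h).1, U3_eq_U3' h h9, U3']
    simp only [Matrix.mul_sub, Matrix.sub_mul, Matrix.mul_assoc, mul_reassoc e3,
      mul_reassoc (mul_Lp Q.G3), Rp_mul, Matrix.zero_mul, Matrix.mul_zero, sub_zero]
  · rw [← (F20_spec h).2, U3_eq_U3' h h9, U3']
    simp only [Matrix.mul_sub, Matrix.sub_mul, Matrix.mul_assoc, e4,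
      mul_reassoc (mul_Lp Q.G4), Rp_mul, Matrix.zero_mul, Matrix.mul_zero, sub_zero]

/-- Every solution of the four equations is given by the formula for `U₃`. -/
theorem exists_eq_U3 (h : Q.PairConditions) {U : Matrix (Fin p₃) (Fin q₃) ℍ[ℝ]}
    (hU : Q.IsAdmissible U) (P₀ : FreeParams p₁ q₁ p₂ q₂ p₃ q₃) :
    ∃ U11 U12 U21 U31 U32 U33 U41 U42, U = Q.U3 { P₀ with
      U11 := U11, U12 := U12, U21 := U21, U31 := U31, U32 := U32, U33 := U33, U41 := U41,
      U42 := U42 } := by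
  obtain ⟨⟨h1, h2⟩, h3, h4⟩ := hU
  -- Both differences solve homogeneous nested pairs. The second is taken as `F20 - U` to match the
  -- signs in `U3'`, so that the two add up to `F`.
  have e1 := nested_pair_complete (U := U - Q.F10) Q.Rp_M1_mul_G2 (H₁ := Q.H1) (H₂ := Q.H2) rfl
    (by rw [Matrix.mul_sub, Matrix.sub_mul, h1, (F10_spec h).1, sub_self])
    (by rw [Matrix.mul_sub, Matrix.sub_mul, h2, (F10_spec h).2, sub_self])
  have e2 := nested_pair_complete (U := Q.F20 - U) (G₁ := Q.G3) (G₂ := Q.G4) rfl Q.H3_mul_Lp_N1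
    (by rw [Matrix.mul_sub, Matrix.sub_mul, h3, (F20_spec h).1, sub_self])
    (by rw [Matrix.mul_sub, Matrix.sub_mul, h4, (F20_spec h).2, sub_self])
  generalize Q.G2† * Q.G2 * (U - Q.F10) * Q.H1 * Q.H1† = v3 at e1
  generalize Q.G2† * Q.G2 * (U - Q.F10) = v2 at e1
  generalize hV1 : Lp Q.G2 * (U - Q.F10) = lv1 at e1
  generalize Q.G4† * Q.G4 * (Q.F20 - U) * Q.H3 * Q.H3† = w3 at e2
  generalize Q.G4† * Q.G4 * (Q.F20 - U) = w2 at e2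
  generalize hW1 : Lp Q.G4 * (Q.F20 - U) = lw1 at e2
  have e3 : Q.C11 * ((U - Q.F10) ⊟ (Q.F20 - U)) + (v2 │ w2) * Q.D11
      = Q.F - Q.C22 * v3 * Q.D22 - Q.C33 * w3 * Q.D33 := by
    have eF : Q.F = (lv1 + v2 * Rp Q.H1 + Lp Q.G1 * v3 * Rp Q.H2)
        + (lw1 + w2 * Rp Q.H3 + Lp Q.G3 * w3 * Rp Q.H4) := by
      rw [← e1, ← e2, F]
      abel
    rw [eF, C11, D11, Matrix.fromCols_mul_fromRows, Matrix.fromCols_mul_fromRows, hV1, hW1, C22, C33,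
      D22, D33]
    abel
  -- The outer projectors remove the `C11` and `D11` terms of `e3`.
  have e4 : Q.E11 * v3 * Q.E33 + Q.E22 * w3 * Q.E44 = Q.E := by
    have h5 := congrArg (Rp Q.C11 * · * Lp Q.D11) e3
    simp only [Matrix.mul_add, Matrix.add_mul, Matrix.mul_assoc, mul_reassoc (Rp_mul Q.C11),
      mul_Lp, Matrix.zero_mul, Matrix.mul_zero, add_zero, Matrix.mul_sub, Matrix.sub_mul] at h5
    rw [eq_comm, sub_sub, sub_eq_zero] at h5
    rw [E, Matrix.mul_assoc (Rp Q.C11) Q.F, h5]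
    simp only [E11, E22, E33, E44, Matrix.mul_assoc]
  obtain ⟨U31, U32, U33, U41, U42, hV3, hW3⟩ := two_term_complete rfl rfl rfl e4
  obtain ⟨hV, hW⟩ := sylvester_complete e3
  -- The first three parameters are those by which `sylvester_complete` reproduces a given solution.
  refine ⟨v2 │ w2, (U - Q.F10) ⊟ (Q.F20 - U), Rp Q.C11 * (v2 │ w2), U31, U32, U33, U41, U42, ?_⟩
  generalize hP : (FreeParams.mk _ _ _ _ _ _ _ _ _ _ _ _ _ : FreeParams p₁ q₁ p₂ q₂ p₃ q₃) = P
  have k3 : Q.V3 P = v3 := by rw [V3_eq, hV3, ← hP]; rfl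
  have k3' : Q.W3 P = w3 := by rw [W3_eq, hW3, ← hP]; rfl
  have kR : Q.Res P = Q.F - Q.C22 * v3 * Q.D22 - Q.C33 * w3 * Q.D33 := by rw [Res, k3, k3']
  have k1 : Q.V1 P = U - Q.F10 := by
    rw [V1_eq, kR, ← hP, ← hV, one_fromCols_zero_mul]
  have k2 : Q.V2 P = v2 := by
    rw [V2_eq, kR, ← hP, ← hW, mul_one_fromRows_zero]
  rw [U3, k1, k2, k3, hV1, add_assoc, add_assoc, ← add_assoc lv1, ← e1]
  abel

end TwoSidedSystem

end QuatMat

namespace QuatMat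

namespace TwoSidedSystem

variable {s t p₁ q₁ a₁ b₁ p₂ q₂ a₂ b₂ p₃ q₃ a₃ b₃ : ℕ}
  {Q : TwoSidedSystem s t p₁ q₁ a₁ b₁ p₂ q₂ a₂ b₂ p₃ q₃ a₃ b₃}

/-! ### The projector conditions from linear equations -/

/-- The condition `R_{E₂₂} E L_{E₃₃} = 0` from the coupled linear equations. -/
theorem Rp_E22_mul_E_mul_Lp_E33 (h : Q.PairConditions)
    {P₁ P₁' : Matrix (Fin p₁) (Fin t) ℍ[ℝ]} {P₂ P₂' : Matrix (Fin p₂) (Fin t) ℍ[ℝ]}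
    {P₃ P₃' : Matrix (Fin p₃) (Fin t) ℍ[ℝ]} {Q₁ Q₁' : Matrix (Fin s) (Fin q₁) ℍ[ℝ]}
    {Q₂ Q₂' : Matrix (Fin s) (Fin q₂) ℍ[ℝ]} {Q₃ Q₃' : Matrix (Fin s) (Fin q₃) ℍ[ℝ]}
    (h1 : Q.T1 = Q.A11 * P₁ + Q.A33 * P₃ + (Q₂ * Q.B22 + Q₃ * Q.B33))
    (h2 : 0 = Q.A11 * P₁' + Q.A33 * P₃' + (Q₁ * Q.B11 + Q₃ * Q.B33))
    (h3 : 0 = Q.A22 * P₂ + Q.A33 * P₃ + (Q₂' * Q.B22 + Q₃' * Q.B33))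
    (h4 : -Q.T1 = Q.A22 * P₂' + Q.A33 * P₃' + (Q₁' * Q.B11 + Q₃' * Q.B33)) :
    Rp Q.E22 * Q.E * Lp Q.E33 = 0 := by
  -- The quantity to kill is `K F Y`. `K` factors through `G2` and through `G3`, and `Y` through
  -- `H2` and through `H3`.
  obtain ⟨K, hK⟩ : ∃ K, K = Rp Q.E22 * Rp Q.C11 := ⟨_, rfl⟩
  obtain ⟨Y, hY⟩ : ∃ Y, Y = Lp Q.D11 * Lp Q.E33 := ⟨_, rfl⟩
  have hKG2 : K * (Q.G2† * Q.G2) = K := by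
    rw [← mul_Lp_eq_zero_iff, hK, Matrix.mul_assoc, Rp_C11_mul_Lp_G2, Matrix.mul_zero]
  have hKG3 : K * (Q.G3† * Q.G3) = K := by
    rw [← mul_Lp_eq_zero_iff, hK, Matrix.mul_assoc]
    exact Rp_mul Q.E22
  have hYH3 : Q.H3 * (Q.H3† * Y) = Y := by
    rw [← Rp_mul_eq_zero_iff, hY, ← Matrix.mul_assoc, Rp_H3_mul_Lp_D11, Matrix.zero_mul]
  have hYH2 : Q.H2 * (Q.H2† * Y) = Y := by
    rw [← Rp_mul_eq_zero_iff, hY, ← Matrix.mul_assoc]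
    exact mul_Lp Q.E33
  -- Test matrices: `l` kills `A11` and `m` kills `A22`, while both send `A33` to `K`; `x` is killed
  -- by `B11` and `z` by `B22`, while `B33` sends both to `Y`. Then `K F Y = m T1 x - l T1 z`, and
  -- the four hypotheses tested with `(l, z)`, `(l, x)`, `(m, z)`, `(m, x)` make this vanish.
  obtain ⟨l, hl⟩ : ∃ l, l = K * Q.G2† * Rp Q.A11 := ⟨_, rfl⟩
  obtain ⟨m, hm⟩ : ∃ m, m = K * Q.G3† * Rp Q.A22 := ⟨_, rfl⟩
  obtain ⟨x, hx⟩ : ∃ x, x = Lp Q.B11 * (Q.H3† * Y) := ⟨_, rfl⟩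
  obtain ⟨z, hz⟩ : ∃ z, z = Lp Q.B22 * (Q.H2† * Y) := ⟨_, rfl⟩
  have l1 : l * Q.A11 = 0 := by rw [hl, Matrix.mul_assoc, Rp_mul, Matrix.mul_zero]
  have m2 : m * Q.A22 = 0 := by rw [hm, Matrix.mul_assoc, Rp_mul, Matrix.mul_zero]
  have l3 : l * Q.A33 = K := by
    rw [hl, Matrix.mul_assoc, Matrix.mul_assoc]
    exact hKG2
  have m3 : m * Q.A33 = K := by
    rw [hm, Matrix.mul_assoc, Matrix.mul_assoc]
    exact hKG3
  have x1 : Q.B11 * x = 0 := by rw [hx, ← Matrix.mul_assoc, mul_Lp, Matrix.zero_mul]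
  have z2 : Q.B22 * z = 0 := by rw [hz, ← Matrix.mul_assoc, mul_Lp, Matrix.zero_mul]
  have x3 : Q.B33 * x = Y := by
    rw [hx, ← Matrix.mul_assoc]
    exact hYH3
  have z3 : Q.B33 * z = Y := by
    rw [hz, ← Matrix.mul_assoc]
    exact hYH2
  have e20 : K * (Q.F20 * Y) = m * (Q.T1 * x) := by
    have e : m * (Q.T1 * x) = K * (Q.G3† * (Q.L3 * (Q.H3† * Y))) := by
      simp only [hm, hx, L3, Matrix.mul_assoc]
    rw [e, ← (F20_spec h).1]
    simp only [Matrix.mul_assoc, mul_mul_reassoc hKG3, hYH3]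
  have e10 : K * (Q.F10 * Y) = l * (Q.T1 * z) := by
    have e : l * (Q.T1 * z) = K * (Q.G2† * (Q.L2 * (Q.H2† * Y))) := by
      simp only [hl, hz, L2, Matrix.mul_assoc]
    rw [e, ← (F10_spec h).2]
    simp only [Matrix.mul_assoc, mul_mul_reassoc hKG2, hYH2]
  have k1 : l * (Q.T1 * z) = K * (P₃ * z) + l * (Q₃ * Y) := by
    rw [h1]
    simp only [Matrix.mul_add, Matrix.add_mul, Matrix.mul_assoc, mul_reassoc l1, mul_reassoc l3,
      z2, z3, Matrix.zero_mul, Matrix.mul_zero, zero_add]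
  have k2 : 0 = K * (P₃' * x) + l * (Q₃ * Y) := by
    have := congrArg (fun X => l * (X * x)) h2
    simpa only [Matrix.mul_add, Matrix.add_mul, Matrix.mul_assoc, mul_reassoc l1, mul_reassoc l3,
      x1, x3, Matrix.zero_mul, Matrix.mul_zero, zero_add] using this
  have k3 : 0 = K * (P₃ * z) + m * (Q₃' * Y) := by
    have := congrArg (fun X => m * (X * z)) h3
    simpa only [Matrix.mul_add, Matrix.add_mul, Matrix.mul_assoc, mul_reassoc m2, mul_reassoc m3,
      z2, z3, Matrix.zero_mul, Matrix.mul_zero, zero_add] using this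
  have k4 : -(m * (Q.T1 * x)) = K * (P₃' * x) + m * (Q₃' * Y) := by
    have := congrArg (fun X => m * (X * x)) h4
    simpa only [Matrix.mul_add, Matrix.add_mul, Matrix.mul_assoc, mul_reassoc m2, mul_reassoc m3,
      x1, x3, Matrix.zero_mul, Matrix.mul_zero, zero_add, Matrix.neg_mul, Matrix.mul_neg] using this
  have goal : Rp Q.E22 * Q.E * Lp Q.E33 = K * (Q.F20 * Y) - K * (Q.F10 * Y) := by
    simp only [E, F, hK, hY, Matrix.mul_assoc, Matrix.mul_sub, Matrix.sub_mul]
  rw [goal, e20, e10, ← neg_eq_zero, neg_sub, sub_eq_add_neg, k4, k1]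
  calc K * (P₃ * z) + l * (Q₃ * Y) + (K * (P₃' * x) + m * (Q₃' * Y))
      = (K * (P₃' * x) + l * (Q₃ * Y)) + (K * (P₃ * z) + m * (Q₃' * Y)) := by abel
    _ = 0 := by rw [← k2, ← k3, add_zero]

/-! ### Reduction to the equation in `T1`, and the general solution. -/

/-- The solvability of `Aᵢ Xᵢ = Cᵢ`, `Xᵢ Bᵢ = Dᵢ` for each `i`. -/
def ParticularSpec (Q : TwoSidedSystem s t p₁ q₁ a₁ b₁ p₂ q₂ a₂ b₂ p₃ q₃ a₃ b₃) : Prop :=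
  (Q.A₁ * Q.X0 = Q.C₁ ∧ Q.X0 * Q.B₁ = Q.D₁) ∧ (Q.A₂ * Q.Y0 = Q.C₂ ∧ Q.Y0 * Q.B₂ = Q.D₂) ∧
    (Q.A₃ * Q.Z0 = Q.C₃ ∧ Q.Z0 * Q.B₃ = Q.D₃)

theorem particularSpec (hc : Q.Compatible) (h₁ : Rp Q.A₁ * Q.C₁ = 0 ∧ Q.D₁ * Lp Q.B₁ = 0)
    (h₂ : Rp Q.A₂ * Q.C₂ = 0 ∧ Q.D₂ * Lp Q.B₂ = 0)
    (h₃ : Rp Q.A₃ * Q.C₃ = 0 ∧ Q.D₃ * Lp Q.B₃ = 0) : Q.ParticularSpec :=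
  ⟨⟨particular_mul h₁.1, mul_particular hc.1 h₁.2⟩,
    ⟨particular_mul h₂.1, mul_particular hc.2.1 h₂.2⟩,
    particular_mul h₃.1, mul_particular hc.2.2 h₃.2⟩

/-- For a system whose one-sided equations are solvable, the last equation in terms of `T₁`. -/
theorem isSolution_iff (hp : Q.ParticularSpec) {X : Matrix (Fin p₁) (Fin q₁) ℍ[ℝ]}
    {Y : Matrix (Fin p₂) (Fin q₂) ℍ[ℝ]} {Z : Matrix (Fin p₃) (Fin q₃) ℍ[ℝ]} :
    Q.IsSolution X Y Z ↔ ∃ (U : Matrix (Fin p₁) (Fin q₁) ℍ[ℝ]) (V : Matrix (Fin p₂) (Fin q₂) ℍ[ℝ])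
      (W : Matrix (Fin p₃) (Fin q₃) ℍ[ℝ]),
      Q.A11 * U * Q.B11 + Q.A22 * V * Q.B22 + Q.A33 * W * Q.B33 = Q.T1 ∧
      X = Q.X0 + Lp Q.A₁ * U * Rp Q.B₁ ∧ Y = Q.Y0 + Lp Q.A₂ * V * Rp Q.B₂ ∧
      Z = Q.Z0 + Lp Q.A₃ * W * Rp Q.B₃ := by
  obtain ⟨hp₁, hp₂, hp₃⟩ := hp
  have key : ∀ (U : Matrix (Fin p₁) (Fin q₁) ℍ[ℝ]) (V : Matrix (Fin p₂) (Fin q₂) ℍ[ℝ])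
      (W : Matrix (Fin p₃) (Fin q₃) ℍ[ℝ]), Q.A11 * U * Q.B11 + Q.A22 * V * Q.B22 + Q.A33 * W * Q.B33 = Q.T1 ↔
      Q.E₁ * (Q.X0 + Lp Q.A₁ * U * Rp Q.B₁) * Q.F₁ + Q.E₂ * (Q.Y0 + Lp Q.A₂ * V * Rp Q.B₂) * Q.F₂
        + Q.E₃ * (Q.Z0 + Lp Q.A₃ * W * Rp Q.B₃) * Q.F₃ = Q.C := by
    intro U V W
    rw [T1, eq_sub_iff_add_eq]
    have : ∀ a b : Matrix (Fin s) (Fin t) ℍ[ℝ], a = b → (a = Q.C ↔ b = Q.C) := by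
      rintro a _ rfl
      rfl
    refine this _ _ ?_
    simp only [A11, A22, A33, B11, B22, B33, Matrix.mul_add, Matrix.add_mul, Matrix.mul_assoc]
    abel
  constructor
  · rintro ⟨⟨x1, x2⟩, ⟨y1, y2⟩, ⟨z1, z2⟩, h⟩
    have hX := eq_particular_add x1 x2
    have hY := eq_particular_add y1 y2
    have hZ := eq_particular_add z1 z2
    -- By `eq_particular_add` a solution serves as its own free parameter.
    refine ⟨X, Y, Z, (key X Y Z).2 ?_, hX, hY, hZ⟩
    change Q.E₁ * (_ + _ + _) * Q.F₁ + Q.E₂ * (_ + _ + _) * Q.F₂ + Q.E₃ * (_ + _ + _) * Q.F₃ = Q.C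
    rw [← hX, ← hY, ← hZ, h]
  · rintro ⟨U, V, W, h, rfl, rfl, rfl⟩
    refine ⟨⟨?_, ?_⟩, ⟨?_, ?_⟩, ⟨?_, ?_⟩, (key U V W).1 h⟩
    · rw [Matrix.mul_add, hp₁.1, Matrix.mul_assoc, mul_reassoc (mul_Lp _), Matrix.zero_mul,
        add_zero]
    · rw [Matrix.add_mul, hp₁.2, Matrix.mul_assoc, Rp_mul, Matrix.mul_zero, add_zero]
    · rw [Matrix.mul_add, hp₂.1, Matrix.mul_assoc, mul_reassoc (mul_Lp _), Matrix.zero_mul,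
        add_zero]
    · rw [Matrix.add_mul, hp₂.2, Matrix.mul_assoc, Rp_mul, Matrix.mul_zero, add_zero]
    · rw [Matrix.mul_add, hp₃.1, Matrix.mul_assoc, mul_reassoc (mul_Lp _), Matrix.zero_mul,
        add_zero]
    · rw [Matrix.add_mul, hp₃.2, Matrix.mul_assoc, Rp_mul, Matrix.mul_zero, add_zero]

theorem isSolution_iff_isGivenBy (hc : Q.Compatible) (h : Q.ProjectorConditions)
    (X : Matrix (Fin p₁) (Fin q₁) ℍ[ℝ]) (Y : Matrix (Fin p₂) (Fin q₂) ℍ[ℝ])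
    (Z : Matrix (Fin p₃) (Fin q₃) ℍ[ℝ]) :
    Q.IsSolution X Y Z ↔ ∃ P : FreeParams p₁ q₁ p₂ q₂ p₃ q₃, Q.IsGivenBy P (Q.U3 P) X Y Z := by
  obtain ⟨h₁, h₂, h₃, k₁, k₂, k₃, k₄, h9⟩ := h
  have hpair : Q.PairConditions := ⟨k₁, k₂, k₃, k₄⟩
  rw [isSolution_iff (particularSpec hc h₁ h₂ h₃)]
  constructor
  · rintro ⟨U, V, W, hT, rfl, rfl, rfl⟩
    have hT' : Q.A11 * U * Q.B11 + Q.A22 * V * Q.B22 = Q.T W := by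
      rw [T, ← hT, add_sub_cancel_right]
    obtain ⟨U4, U5, U6, U7, U8, hU, hV⟩ := two_term_complete rfl rfl rfl hT'
    -- The zeros only fill the fields that `exists_eq_U3` replaces; `U4` to `U8` are kept.
    obtain ⟨U11, U12, U21, U31, U32, U33, U41, U42, hW⟩ := exists_eq_U3 hpair
      (isAdmissible_of_eq hT) ⟨U4, U5, U6, U7, U8, 0, 0, 0, 0, 0, 0, 0, 0⟩
    refine ⟨⟨U4, U5, U6, U7, U8, U11, U12, U21, U31, U32, U33, U41, U42⟩, ?_⟩
    rw [← hW]
    refine ⟨?_, ?_, rfl⟩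
    · rw [hU]
      rfl
    · rw [hV]
      rfl
  · rintro ⟨P, rfl, rfl, rfl⟩
    exact ⟨_, _, _, two_term_of_isAdmissible (isAdmissible_U3 hpair h9 P) P, rfl, rfl, rfl⟩

/-! ### Rank conditions, projector conditions and solutions. -/

theorem projectorConditions_of_rankConditions (hc : Q.Compatible) (h : Q.RankConditions) :
    Q.ProjectorConditions := by
  obtain ⟨⟨r₁, r₁'⟩, ⟨r₂, r₂'⟩, ⟨r₃, r₃'⟩, c1, c2, c3, c4, c5, c6, c7, c8, c9⟩ := h
  rw [rk_fromCols_eq_iff] at r₁ r₂ r₃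
  rw [rk_fromRows_eq_iff] at r₁' r₂' r₃'
  have hp := particularSpec hc ⟨r₁, r₁'⟩ ⟨r₂, r₂'⟩ ⟨r₃, r₃'⟩
  obtain ⟨⟨x1, x2⟩, ⟨y1, y2⟩, z1, z2⟩ := hp
  have x1' : Q.A₁ * (Q.X0 * Q.F₁) = Q.C₁ * Q.F₁ := by rw [← Matrix.mul_assoc, x1]
  have y1' : Q.A₂ * (Q.Y0 * Q.F₂) = Q.C₂ * Q.F₂ := by rw [← Matrix.mul_assoc, y1]
  have z1' : Q.A₃ * (Q.Z0 * Q.F₃) = Q.C₃ * Q.F₃ := by rw [← Matrix.mul_assoc, z1]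
  have x2' : Q.E₁ * Q.X0 * Q.B₁ = Q.E₁ * Q.D₁ := by rw [Matrix.mul_assoc, x2]
  have y2' : Q.E₂ * Q.Y0 * Q.B₂ = Q.E₂ * Q.D₂ := by rw [Matrix.mul_assoc, y2]
  have z2' : Q.E₃ * Q.Z0 * Q.B₃ = Q.E₃ * Q.D₃ := by rw [Matrix.mul_assoc, z2]
  -- reduction of a solution of the one-sided equations to the homogeneous case
  have eP₁ : ∀ P W : Matrix (Fin p₁) (Fin t) ℍ[ℝ], Q.A₁ * P = Q.A₁ * W →
      ∃ P' : Matrix (Fin p₁) (Fin t) ℍ[ℝ], Q.E₁ * P = Q.E₁ * W + Q.A11 * P' :=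
    fun P W h => ⟨_, mul_eq_add_of_mul_eq h _⟩
  have eP₂ : ∀ P W : Matrix (Fin p₂) (Fin t) ℍ[ℝ], Q.A₂ * P = Q.A₂ * W →
      ∃ P' : Matrix (Fin p₂) (Fin t) ℍ[ℝ], Q.E₂ * P = Q.E₂ * W + Q.A22 * P' :=
    fun P W h => ⟨_, mul_eq_add_of_mul_eq h _⟩
  have eP₃ : ∀ P W : Matrix (Fin p₃) (Fin t) ℍ[ℝ], Q.A₃ * P = Q.A₃ * W →
      ∃ P' : Matrix (Fin p₃) (Fin t) ℍ[ℝ], Q.E₃ * P = Q.E₃ * W + Q.A33 * P' :=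
    fun P W h => ⟨_, mul_eq_add_of_mul_eq h _⟩
  have eQ₁ : ∀ R W : Matrix (Fin s) (Fin q₁) ℍ[ℝ], R * Q.B₁ = W * Q.B₁ →
      ∃ R' : Matrix (Fin s) (Fin q₁) ℍ[ℝ], R * Q.F₁ = W * Q.F₁ + R' * Q.B11 :=
    fun R W h => ⟨_, eq_mul_add_of_mul_eq h _⟩
  have eQ₂ : ∀ R W : Matrix (Fin s) (Fin q₂) ℍ[ℝ], R * Q.B₂ = W * Q.B₂ →
      ∃ R' : Matrix (Fin s) (Fin q₂) ℍ[ℝ], R * Q.F₂ = W * Q.F₂ + R' * Q.B22 :=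
    fun R W h => ⟨_, eq_mul_add_of_mul_eq h _⟩
  have eQ₃ : ∀ R W : Matrix (Fin s) (Fin q₃) ℍ[ℝ], R * Q.B₃ = W * Q.B₃ →
      ∃ R' : Matrix (Fin s) (Fin q₃) ℍ[ℝ], R * Q.F₃ = W * Q.F₃ + R' * Q.B33 :=
    fun R W h => ⟨_, eq_mul_add_of_mul_eq h _⟩
  have hpair : Q.PairConditions := by
    -- Each goal uses one rank condition. Subtracting the particular solution writes `T1` as a sum
    -- of terms `Aᵢᵢ P` or `R Bᵢᵢ`, and the multipliers defining `Lⱼ` keep only the term with index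
    -- 3.
    refine ⟨⟨?_, ?_⟩, ⟨?_, ?_⟩, ⟨?_, ?_⟩, ?_, ?_⟩
    · obtain ⟨P₁, P₂, P₃, k₁, k₂, k₃, hC⟩ := rk_three_cols_eq_iff.1 c1
      obtain ⟨P₁', e₁⟩ := eP₁ P₁ _ (k₁.trans x1'.symm)
      obtain ⟨P₂', e₂⟩ := eP₂ P₂ _ (k₂.trans y1'.symm)
      obtain ⟨P₃', e₃⟩ := eP₃ P₃ _ (k₃.trans z1'.symm)
      have hT : Q.T1 = Q.A11 * P₁' + Q.A22 * P₂' + Q.A33 * P₃' := by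
        simp only [T1, hC, e₁, e₂, e₃, Matrix.mul_assoc]
        abel
      refine Rp_mul_eq_zero_iff_exists.2 ⟨P₃', ?_⟩
      simp only [L1, hT, Matrix.mul_add, mul_reassoc Q.G_mul_A11, mul_reassoc Q.G_mul_A22,
        Matrix.zero_mul, zero_add, G1, Matrix.mul_assoc]
    · obtain ⟨P₁, P₂, Q₃, k₁, k₂, k₃, hC⟩ := (rk_two_cols_one_row_eq_iff ⟨_, x1'⟩ ⟨_, y1'⟩
        ⟨_, z2'⟩).1 c5
      obtain ⟨P₁', e₁⟩ := eP₁ P₁ _ (k₁.trans x1'.symm)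
      obtain ⟨P₂', e₂⟩ := eP₂ P₂ _ (k₂.trans y1'.symm)
      obtain ⟨Q₃', e₃⟩ := eQ₃ Q₃ _ (k₃.trans z2'.symm)
      have hT : Q.T1 = Q.A11 * P₁' + Q.A22 * P₂' + Q₃' * Q.B33 := by
        simp only [T1, hC, e₁, e₂, e₃, Matrix.mul_assoc]
        abel
      refine mul_Lp_eq_zero_iff_exists.2 ⟨Q.G * Q₃', ?_⟩
      simp only [L1, hT, Matrix.mul_add, mul_reassoc Q.G_mul_A11, mul_reassoc Q.G_mul_A22,
        Matrix.zero_mul, zero_add, H1, Matrix.mul_assoc]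
    · obtain ⟨P₁, P₃, Q₂, k₁, k₃, k₂, hC⟩ := (rk_two_cols_one_row_eq_iff ⟨_, x1'⟩ ⟨_, z1'⟩
        ⟨_, y2'⟩).1 c2
      obtain ⟨P₁', e₁⟩ := eP₁ P₁ _ (k₁.trans x1'.symm)
      obtain ⟨P₃', e₃⟩ := eP₃ P₃ _ (k₃.trans z1'.symm)
      obtain ⟨Q₂', e₂⟩ := eQ₂ Q₂ _ (k₂.trans y2'.symm)
      have hT : Q.T1 = Q.A11 * P₁' + Q₂' * Q.B22 + Q.A33 * P₃' := by
        simp only [T1, hC, e₁, e₂, e₃, Matrix.mul_assoc]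
        abel
      refine Rp_mul_eq_zero_iff_exists.2 ⟨P₃' * Lp Q.B22, ?_⟩
      simp only [L2, hT, Matrix.mul_add, Matrix.add_mul, Matrix.mul_assoc,
        mul_reassoc (Rp_mul Q.A11), mul_Lp, Matrix.zero_mul, Matrix.mul_zero, zero_add, G2]
    · obtain ⟨Q₃, Q₂, P₁, k₃, k₂, k₁, hC⟩ := (rk_one_col_two_rows_eq_iff ⟨_, x1'⟩ ⟨_, z2'⟩
        ⟨_, y2'⟩).1 c6
      obtain ⟨P₁', e₁⟩ := eP₁ P₁ _ (k₁.trans x1'.symm)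
      obtain ⟨Q₃', e₃⟩ := eQ₃ Q₃ _ (k₃.trans z2'.symm)
      obtain ⟨Q₂', e₂⟩ := eQ₂ Q₂ _ (k₂.trans y2'.symm)
      have hT : Q.T1 = Q.A11 * P₁' + Q₂' * Q.B22 + Q₃' * Q.B33 := by
        simp only [T1, hC, e₁, e₂, e₃, Matrix.mul_assoc]
        abel
      refine mul_Lp_eq_zero_iff_exists.2 ⟨Rp Q.A11 * Q₃', ?_⟩
      simp only [L2, hT, Matrix.mul_add, Matrix.add_mul, Matrix.mul_assoc,
        mul_reassoc (Rp_mul Q.A11), mul_Lp, Matrix.zero_mul, Matrix.mul_zero, zero_add, H2]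
    · obtain ⟨P₃, P₂, Q₁, k₃, k₂, k₁, hC⟩ := (rk_two_cols_one_row_eq_iff ⟨_, z1'⟩ ⟨_, y1'⟩
        ⟨_, x2'⟩).1 c3
      obtain ⟨Q₁', e₁⟩ := eQ₁ Q₁ _ (k₁.trans x2'.symm)
      obtain ⟨P₂', e₂⟩ := eP₂ P₂ _ (k₂.trans y1'.symm)
      obtain ⟨P₃', e₃⟩ := eP₃ P₃ _ (k₃.trans z1'.symm)
      have hT : Q.T1 = Q.A22 * P₂' + Q₁' * Q.B11 + Q.A33 * P₃' := by
        simp only [T1, hC, e₁, e₂, e₃, Matrix.mul_assoc]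
        abel
      refine Rp_mul_eq_zero_iff_exists.2 ⟨P₃' * Lp Q.B11, ?_⟩
      simp only [L3, hT, Matrix.mul_add, Matrix.add_mul, Matrix.mul_assoc,
        mul_reassoc (Rp_mul Q.A22), mul_Lp, Matrix.zero_mul, Matrix.mul_zero, zero_add, G3]
    · obtain ⟨Q₁, Q₃, P₂, k₁, k₃, k₂, hC⟩ := (rk_one_col_two_rows_eq_iff ⟨_, y1'⟩ ⟨_, x2'⟩
        ⟨_, z2'⟩).1 c7
      obtain ⟨Q₁', e₁⟩ := eQ₁ Q₁ _ (k₁.trans x2'.symm)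
      obtain ⟨P₂', e₂⟩ := eP₂ P₂ _ (k₂.trans y1'.symm)
      obtain ⟨Q₃', e₃⟩ := eQ₃ Q₃ _ (k₃.trans z2'.symm)
      have hT : Q.T1 = Q.A22 * P₂' + Q₁' * Q.B11 + Q₃' * Q.B33 := by
        simp only [T1, hC, e₁, e₂, e₃, Matrix.mul_assoc]
        abel
      refine mul_Lp_eq_zero_iff_exists.2 ⟨Rp Q.A22 * Q₃', ?_⟩
      simp only [L3, hT, Matrix.mul_add, Matrix.add_mul, Matrix.mul_assoc,
        mul_reassoc (Rp_mul Q.A22), mul_Lp, Matrix.zero_mul, Matrix.mul_zero, zero_add, H3]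
    · obtain ⟨Q₁, Q₂, P₃, k₁, k₂, k₃, hC⟩ := (rk_one_col_two_rows_eq_iff ⟨_, z1'⟩ ⟨_, x2'⟩
        ⟨_, y2'⟩).1 c4
      obtain ⟨Q₁', e₁⟩ := eQ₁ Q₁ _ (k₁.trans x2'.symm)
      obtain ⟨Q₂', e₂⟩ := eQ₂ Q₂ _ (k₂.trans y2'.symm)
      obtain ⟨P₃', e₃⟩ := eP₃ P₃ _ (k₃.trans z1'.symm)
      have hT : Q.T1 = Q₁' * Q.B11 + Q₂' * Q.B22 + Q.A33 * P₃' := by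
        simp only [T1, hC, e₁, e₂, e₃, Matrix.mul_assoc]
        abel
      refine Rp_mul_eq_zero_iff_exists.2 ⟨P₃' * Q.H, ?_⟩
      simp only [L4, hT, Matrix.add_mul, Matrix.mul_assoc, B11_mul_H, B22_mul_H,
        Matrix.mul_zero, zero_add, G4]
    · obtain ⟨Q₁, Q₂, Q₃, k₁, k₂, k₃, hC⟩ := rk_three_rows_eq_iff.1 c8
      obtain ⟨Q₁', e₁⟩ := eQ₁ Q₁ _ (k₁.trans x2'.symm)
      obtain ⟨Q₂', e₂⟩ := eQ₂ Q₂ _ (k₂.trans y2'.symm)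
      obtain ⟨Q₃', e₃⟩ := eQ₃ Q₃ _ (k₃.trans z2'.symm)
      have hT : Q.T1 = Q₁' * Q.B11 + Q₂' * Q.B22 + Q₃' * Q.B33 := by
        simp only [T1, hC, e₁, e₂, e₃, Matrix.mul_assoc]
        abel
      refine mul_Lp_eq_zero_iff_exists.2 ⟨Q₃', ?_⟩
      simp only [L4, hT, Matrix.add_mul, Matrix.mul_assoc, B11_mul_H, B22_mul_H,
        Matrix.mul_zero, zero_add, H4]
  refine ⟨⟨r₁, r₁'⟩, ⟨r₂, r₂'⟩, ⟨r₃, r₃'⟩, hpair.1, hpair.2.1, hpair.2.2.1, hpair.2.2.2, ?_⟩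
  obtain ⟨P₁, P₁', P₂, P₂', P₃, P₃', Q₁, Q₁', Q₂, Q₂', Q₃, Q₃', ⟨⟨i1, i1'⟩, ⟨i2, i2'⟩, i3, i3'⟩,
    ⟨⟨j1, j1'⟩, ⟨j2, j2'⟩, j3, j3'⟩, hC1, hC2, hC3, hC4⟩ :=
    (rk_coupled_eq_iff ⟨_, x1'⟩ ⟨_, y1'⟩ ⟨_, z1'⟩ ⟨_, x2'⟩ ⟨_, y2'⟩ ⟨_, z2'⟩).1 c9
  -- The unknowns of the (1,1) block are compared with the particular solution, those of the (2,2)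
  -- block with its negative, and the others with zero. The four equations then have left-hand sides
  -- `T1`, `0`, `0`, `-T1`.
  obtain ⟨U1, eP1⟩ := eP₁ P₁ _ (i1.trans x1'.symm)
  obtain ⟨U1', eP1'⟩ := eP₁ P₁' 0 (i1'.trans (Matrix.mul_zero _).symm)
  obtain ⟨U2, eP2⟩ := eP₂ P₂ 0 (i2.trans (Matrix.mul_zero _).symm)
  obtain ⟨U2', eP2'⟩ := eP₂ P₂' (-(Q.Y0 * Q.F₂)) (by rw [i2', Matrix.mul_neg, y1'])
  obtain ⟨U3, eP3⟩ := eP₃ P₃ 0 (i3.trans (Matrix.mul_zero _).symm)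
  obtain ⟨U3', eP3'⟩ := eP₃ P₃' (-(Q.Z0 * Q.F₃)) (by rw [i3', Matrix.mul_neg, z1'])
  obtain ⟨W1, eQ1⟩ := eQ₁ Q₁ 0 (j1.trans (Matrix.zero_mul _).symm)
  obtain ⟨W1', eQ1'⟩ := eQ₁ Q₁' (-(Q.E₁ * Q.X0)) (by rw [j1', Matrix.neg_mul, x2'])
  obtain ⟨W2, eQ2⟩ := eQ₂ Q₂ _ (j2.trans y2'.symm)
  obtain ⟨W2', eQ2'⟩ := eQ₂ Q₂' 0 (j2'.trans (Matrix.zero_mul _).symm)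
  obtain ⟨W3, eQ3⟩ := eQ₃ Q₃ _ (j3.trans z2'.symm)
  obtain ⟨W3', eQ3'⟩ := eQ₃ Q₃' 0 (j3'.trans (Matrix.zero_mul _).symm)
  simp only [Matrix.mul_zero, Matrix.zero_mul, zero_add, Matrix.mul_neg, Matrix.neg_mul,
    Matrix.mul_assoc] at eP1 eP1' eP2 eP2' eP3 eP3' eQ1 eQ1' eQ2 eQ2' eQ3 eQ3'
  rw [eP1, eP3, eQ2, eQ3] at hC1
  rw [eP1', eP3', eQ1, eQ3] at hC2
  rw [eP2, eP3, eQ2', eQ3'] at hC3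
  rw [eP2', eP3', eQ1', eQ3'] at hC4
  have hT1 : Q.T1 = Q.A11 * U1 + Q.A33 * U3 + (W2 * Q.B22 + W3 * Q.B33) := by
    rw [T1, hC1]
    simp only [Matrix.mul_assoc]
    abel
  have hT2 : 0 = Q.A11 * U1' + Q.A33 * U3' + (W1 * Q.B11 + W3 * Q.B33) :=
    hC2.trans (by abel)
  have hT4 : -Q.T1 = Q.A22 * U2' + Q.A33 * U3' + (W1' * Q.B11 + W3' * Q.B33) := by
    rw [T1, neg_sub, sub_eq_add_neg, hC4]
    simp only [Matrix.mul_assoc]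
    abel
  exact Rp_E22_mul_E_mul_Lp_E33 hpair hT1 hT2 hC3 hT4

/-- In each block condition the unknown attached to `X` is `X * F₁` if `A₁` borders the matrix, and
`E₁ * X` if `B₁` does; likewise for `Y` and `Z`. -/
theorem rankConditions_of_isSolution {X : Matrix (Fin p₁) (Fin q₁) ℍ[ℝ]}
    {Y : Matrix (Fin p₂) (Fin q₂) ℍ[ℝ]} {Z : Matrix (Fin p₃) (Fin q₃) ℍ[ℝ]}
    (h : Q.IsSolution X Y Z) : Q.Compatible ∧ Q.RankConditions := by
  obtain ⟨⟨x1, x2⟩, ⟨y1, y2⟩, ⟨z1, z2⟩, hC⟩ := h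
  have x1' : Q.A₁ * (X * Q.F₁) = Q.C₁ * Q.F₁ := by rw [← Matrix.mul_assoc, x1]
  have y1' : Q.A₂ * (Y * Q.F₂) = Q.C₂ * Q.F₂ := by rw [← Matrix.mul_assoc, y1]
  have z1' : Q.A₃ * (Z * Q.F₃) = Q.C₃ * Q.F₃ := by rw [← Matrix.mul_assoc, z1]
  have x2' : Q.E₁ * X * Q.B₁ = Q.E₁ * Q.D₁ := by rw [Matrix.mul_assoc, x2]
  have y2' : Q.E₂ * Y * Q.B₂ = Q.E₂ * Q.D₂ := by rw [Matrix.mul_assoc, y2]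
  have z2' : Q.E₃ * Z * Q.B₃ = Q.E₃ * Q.D₃ := by rw [Matrix.mul_assoc, z2]
  have hC' : Q.C = Q.E₁ * (X * Q.F₁) + Q.E₂ * (Y * Q.F₂) + Q.E₃ * (Z * Q.F₃) := by
    rw [← hC]
    simp only [Matrix.mul_assoc]
  refine ⟨⟨?_, ?_, ?_⟩, ⟨?_, ?_⟩, ⟨?_, ?_⟩, ⟨?_, ?_⟩, ?_, ?_, ?_, ?_, ?_, ?_, ?_, ?_, ?_⟩
  · rw [← x1, ← x2, Matrix.mul_assoc]
  · rw [← y1, ← y2, Matrix.mul_assoc]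
  · rw [← z1, ← z2, Matrix.mul_assoc]
  · exact rk_fromCols_eq_iff.2 (Rp_mul_eq_zero_iff_exists.2 ⟨X, x1⟩)
  · exact rk_fromRows_eq_iff.2 (mul_Lp_eq_zero_iff_exists.2 ⟨X, x2⟩)
  · exact rk_fromCols_eq_iff.2 (Rp_mul_eq_zero_iff_exists.2 ⟨Y, y1⟩)
  · exact rk_fromRows_eq_iff.2 (mul_Lp_eq_zero_iff_exists.2 ⟨Y, y2⟩)
  · exact rk_fromCols_eq_iff.2 (Rp_mul_eq_zero_iff_exists.2 ⟨Z, z1⟩)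
  · exact rk_fromRows_eq_iff.2 (mul_Lp_eq_zero_iff_exists.2 ⟨Z, z2⟩)
  · exact rk_three_cols_eq_iff.2 ⟨_, _, _, x1', y1', z1', hC'⟩
  · refine (rk_two_cols_one_row_eq_iff ⟨_, x1'⟩ ⟨_, z1'⟩ ⟨_, y2'⟩).2
      ⟨_, _, _, x1', z1', y2', ?_⟩
    rw [hC', Matrix.mul_assoc Q.E₂]
    abel
  · refine (rk_two_cols_one_row_eq_iff ⟨_, z1'⟩ ⟨_, y1'⟩ ⟨_, x2'⟩).2
      ⟨_, _, _, z1', y1', x2', ?_⟩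
    rw [hC', Matrix.mul_assoc Q.E₁]
    abel
  · refine (rk_one_col_two_rows_eq_iff ⟨_, z1'⟩ ⟨_, x2'⟩ ⟨_, y2'⟩).2
      ⟨_, _, _, x2', y2', z1', ?_⟩
    rw [hC', Matrix.mul_assoc Q.E₁, Matrix.mul_assoc Q.E₂]
  · refine (rk_two_cols_one_row_eq_iff ⟨_, x1'⟩ ⟨_, y1'⟩ ⟨_, z2'⟩).2
      ⟨_, _, _, x1', y1', z2', ?_⟩
    rw [hC', Matrix.mul_assoc Q.E₃]
  · refine (rk_one_col_two_rows_eq_iff ⟨_, x1'⟩ ⟨_, z2'⟩ ⟨_, y2'⟩).2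
      ⟨_, _, _, z2', y2', x1', ?_⟩
    rw [hC', Matrix.mul_assoc Q.E₃, Matrix.mul_assoc Q.E₂]
    abel
  · refine (rk_one_col_two_rows_eq_iff ⟨_, y1'⟩ ⟨_, x2'⟩ ⟨_, z2'⟩).2
      ⟨_, _, _, x2', z2', y1', ?_⟩
    rw [hC', Matrix.mul_assoc Q.E₁, Matrix.mul_assoc Q.E₃]
    abel
  · exact rk_three_rows_eq_iff.2 ⟨_, _, _, x2', y2', z2', hC.symm⟩
  · refine (rk_coupled_eq_iff ⟨_, x1'⟩ ⟨_, y1'⟩ ⟨_, z1'⟩ ⟨_, x2'⟩ ⟨_, y2'⟩ ⟨_, z2'⟩).2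
      -- The diagonal blocks reproduce `C` and `-C`. In the (1,2) block the shared unknowns `-(Z *
      -- F₃)` and `E₃ * Z` cancel, and in the (2,1) block every term vanishes.
      ⟨X * Q.F₁, 0, 0, -(Y * Q.F₂), 0, -(Z * Q.F₃), 0, -(Q.E₁ * X), Q.E₂ * Y, 0, Q.E₃ * Z, 0,
        ⟨⟨x1', Matrix.mul_zero _⟩, ⟨Matrix.mul_zero _, ?_⟩, Matrix.mul_zero _, ?_⟩,
        ⟨⟨Matrix.zero_mul _, ?_⟩, ⟨y2', Matrix.zero_mul _⟩, z2', Matrix.zero_mul _⟩, ?_, ?_, ?_, ?_⟩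
    · rw [Matrix.mul_neg, y1']
    · rw [Matrix.mul_neg, z1']
    · rw [Matrix.neg_mul, x2']
    all_goals
      simp only [hC', Matrix.mul_zero, Matrix.zero_mul, Matrix.mul_neg, Matrix.neg_mul,
        Matrix.mul_assoc]
      abel

end TwoSidedSystem

end QuatMat

/-! ### The main theorem. -/

theorem theorem3p2 {s t p₁ q₁ a₁ b₁ p₂ q₂ a₂ b₂ p₃ q₃ a₃ b₃ : ℕ}
    (Q : QuatMat.TwoSidedSystem s t p₁ q₁ a₁ b₁ p₂ q₂ a₂ b₂ p₃ q₃ a₃ b₃) :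
    -- the three statements are equivalent
    List.TFAE [
      ∃ X Y Z, Q.IsSolution X Y Z,
      Q.Compatible ∧ Q.ProjectorConditions,
      Q.Compatible ∧ Q.RankConditions] ∧
    -- the general solution of a solvable system, with either of the two expressions for `U₃`
    ((∃ X Y Z, Q.IsSolution X Y Z) →
      (∀ X Y Z, Q.IsSolution X Y Z ↔
        ∃ P : QuatMat.FreeParams p₁ q₁ p₂ q₂ p₃ q₃, Q.IsGivenBy P (Q.U3 P) X Y Z) ∧
      (∀ X Y Z, Q.IsSolution X Y Z ↔
        ∃ P : QuatMat.FreeParams p₁ q₁ p₂ q₂ p₃ q₃, Q.IsGivenBy P (Q.U3' P) X Y Z)) := by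
  have h13 : (∃ X Y Z, Q.IsSolution X Y Z) → Q.Compatible ∧ Q.RankConditions := by
    rintro ⟨X, Y, Z, h⟩
    exact Q.rankConditions_of_isSolution h
  have h32 : Q.Compatible ∧ Q.RankConditions → Q.Compatible ∧ Q.ProjectorConditions :=
    fun h => ⟨h.1, QuatMat.TwoSidedSystem.projectorConditions_of_rankConditions h.1 h.2⟩
  refine ⟨?_, fun h => ?_⟩
  · tfae_have 1 → 3 := h13
    tfae_have 3 → 2 := h32
    tfae_have 2 → 1 := by
      rintro ⟨hc, hp⟩
      -- Any choice of the parameters yields a solution; zero is taken.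
      exact ⟨_, _, _, (QuatMat.TwoSidedSystem.isSolution_iff_isGivenBy hc hp _ _ _).2
        ⟨⟨0, 0, 0, 0, 0, 0, 0, 0, 0, 0, 0, 0, 0⟩, rfl, rfl, rfl⟩⟩
    tfae_finish
  · obtain ⟨hc, hp⟩ := h32 (h13 h)
    refine ⟨QuatMat.TwoSidedSystem.isSolution_iff_isGivenBy hc hp, fun X Y Z => ?_⟩
    rw [QuatMat.TwoSidedSystem.isSolution_iff_isGivenBy hc hp]
    obtain ⟨-, -, -, k₁, k₂, k₃, k₄, h9⟩ := hp
    simp only [QuatMat.TwoSidedSystem.U3_eq_U3' ⟨k₁, k₂, k₃, k₄⟩ h9]
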